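/- **Theorem (choice-free duality for cylindric ortholattices).** Let $I$ be a set. *Algebras.* An ortholattice is a bounded lattice $A$ with a map $^\perp\colon A\to A$ such that $a\wedge a^\perp=0$, $a\vee a^\perp=1$, $a\le b\Rightarrow b^\perp\le a^\perp$ and $a^{\perp\perp}=a$. A quantifier on $A$ is a map $\exists\colon A\to A$ with $\exists(a\vee b)=\exists a\vee\exists b$, $\exists 0=0$, $\exists\exists a=\exists a$, $a\le\exists a$ and $\exists(\exists a)^\perp=(\exists a)^\perp$. An $I$-dimensional cylindric ortholattice is an ortholattice with quantifiers $(\exists_i)_{i\in I}$ and constants $(\delta_{i,k})_{i,k\in I}$ such that $\exists_i\exists_k a=\exists_k\exists_i a$, $\delta_{i,k}=\delta_{k,i}$, $\delta_{i,i}=1$, and $\exists_k(\delta_{i,k}\wedge\delta_{k,l})=\delta_{i,l}$ whenever $i\neq k$ and $l\neq k$. With the bounded lattice homomorphisms that preserve $^\perp$, all $\exists_i$ and all $\delta_{i,k}$, they form the category $\mathcal{COL}$. *Spaces.* Let $X$ be a set with an irreflexive symmetric relation $\perp$. For $U\subseteq X$ let $U^\perp=\{x: x\perp y\text{ for all }y\in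 U\}$; $U$ is biorthogonally closed if $U=U^{\perp\perp}$. For a relation $R$ on $X$ let $R[U]=\{y: xRy\text{ for some }x\in U\}$ and $\exists_RU=R[U]^{\perp\perp}$. An $I$-dimensional cylindric UVO-space is a $T_0$ topological space $X$ with such a $\perp$, relations $(R_i)_{i\in I}$ and subsets $(\Delta_{i,k})_{i,k\in I}$ such that, writing $\mathcal{CO}(X)$ for the set of compact open sets and $\mathcal{COB}(X)$ for the set of compact open biorthogonally closed sets, for all $i,k,l\in I$: 1. $R_i$ is reflexive and transitive, $R_i[R_i[\{x\}]^\perp]\subseteq R_i[\{x\}]^\perp$ for all $x$, and $R_i\circ R_k=R_k\circ R_i$; 2. $\Delta_{i,k}=\Delta_{k,i}=\Delta_{i,k}^{\perp\perp}$, $\Delta_{i,i}=X$, $\Delta_{i,k}\in\mathcal{CO}(X)$, and $R_k[\Delta_{i,k}\cap\Delta_{k,l}]=\Delta_{i,l}$ whenever $i\neq k$ and $l\neq k$; 3. $\mathcal{COB}(X)$ is a basis of $X$ and is closed under $\cap$ and $^\perp$; 4. every proper filter of $(\mathcal{COB}(X),\subseteq)$ is of the form $\{U\in\mathcal{COB}(X):x\in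 U\}$ for some $x\in X$; 5. if $x\perp y$, there is $U\in\mathcal{COB}(X)$ with $x\in U$ and $y\in U^\perp$; 6. $R_i[U]\in\mathcal{COB}(X)$ for all $U\in\mathcal{COB}(X)$, and if not $xR_iy$, there is $V\in\mathcal{COB}(X)$ with $x\in V$, $\exists_{R_i}V\in\mathcal{COB}(X)$ and $y\notin\exists_{R_i}V$. A cylindric UVO-map is a map $f\colon X\to X'$ such that $f^{-1}[U]\in\mathcal{CO}(X)$ for $U\in\mathcal{CO}(X')$; $x\not\perp y$ implies $f(x)\not\perp f(y)$; if $z\not\perp f(y)$, there is $x$ with $x\not\perp y$ and $z\leqslant f(x)$ in the specialization order ($z\leqslant w$ iff every open set containing $z$ contains $w$); $R_i[f^{-1}[U]]=f^{-1}[R'_i[U]]$ for $U\in\mathcal{COB}(X')$; and $f^{-1}[\Delta'_{i,k}]=\Delta_{i,k}$. These spaces and maps form the category $\mathcal{CUVO}$. *Functors.* For a cylindric ortholattice $A$, $\mathcal S_0(A)$ is the set of proper (non-empty) filters of $A$ with the topology generated by the sets $\phi(a)=\{x:a\in x\}$, $a\in A$, with $x\perp y$ iff $a^\perp\in y$ for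 some $a\in x$, with $xR_iy$ iff $\{\exists_ia:a\in x\}\subseteq y$, and with $\Delta_{i,k}=\phi(\delta_{i,k})$; for a homomorphism $h$, $\mathcal S_1(h)=h^{-1}$. For a cylindric UVO-space $X$, $\mathcal A_0(X)=\langle\mathcal{COB}(X);\cap,\sqcup,{}^\perp,\emptyset,X,(\exists_{R_i})_{i\in I},(\Delta_{i,k})_{i,k\in I}\rangle$ with $U\sqcup V=(U\cup V)^{\perp\perp}$; for a cylindric UVO-map $f$, $\mathcal A_1(f)=f^{-1}$. *Claim.* $\mathcal S_F=\langle\mathcal S_0,\mathcal S_1\rangle\colon\mathcal{COL}\to\mathcal{CUVO}$ and $\mathcal A_F=\langle\mathcal A_0,\mathcal A_1\rangle\colon\mathcal{CUVO}\to\mathcal{COL}$ are contravariant functors that constitute a dual equivalence between $\mathcal{COL}$ and $\mathcal{CUVO}$: the maps $\phi\colon A\to\mathcal A_0(\mathcal S_0(A))$, $a\mapsto\phi(a)$, and $\psi\colon X\to\mathcal S_0(\mathcal A_0(X))$, $x\mapsto\{U\in\mathcal{COB}(X):x\in U\}$, are natural isomorphisms $\mathrm{id}_{\mathcal{COL}}\cong\mathcal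 A_F\circ\mathcal S_F$ and $\mathrm{id}_{\mathcal{CUVO}}\cong\mathcal S_F\circ\mathcal A_F$. Moreover the duality holds in ZF, without the axiom of choice: in every model of ZF, and for every set $I$ of the model, the categories and functors formed inside the model constitute a dual equivalence with the natural isomorphisms $\phi$ and $\psi$. -/

import Mathlib

open CategoryTheory

universe u v w

/-! ## Cylindric ortholattices -/

/-- An ortholattice: a bounded lattice with an orthocomplementation, written `aᶜ`. -/
class Ortholattice (A : Type v) extends Lattice A, BoundedOrder A, Compl A where
  inf_compl : ∀ a : A, a ⊓ aᶜ = ⊥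
  sup_compl : ∀ a : A, a ⊔ aᶜ = ⊤
  compl_anti : ∀ a b : A, a ≤ b → bᶜ ≤ aᶜ
  compl_compl : ∀ a : A, aᶜᶜ = a

/-- Quantifiers on an ortholattice. -/
structure IsQuantifier {A : Type v} [Ortholattice A] (q : A → A) : Prop where
  map_sup : ∀ a b, q (a ⊔ b) = q a ⊔ q b
  map_bot : q ⊥ = ⊥
  idem : ∀ a, q (q a) = q a
  le : ∀ a, a ≤ q a
  compl : ∀ a, q (q a)ᶜ = (q a)ᶜ

/-- The structure of an `I`-dimensional cylindric ortholattice on an ortholattice `A`. -/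
class CylindricOrtholattice (I : Type u) (A : Type v) [Ortholattice A] where
  ex : I → A → A
  diag : I → I → A
  quantifier : ∀ i, IsQuantifier (ex i)
  ex_comm : ∀ i k a, ex i (ex k a) = ex k (ex i a)
  diag_symm : ∀ i k, diag i k = diag k i
  diag_self : ∀ i, diag i i = ⊤
  ex_diag : ∀ i k l, i ≠ k → l ≠ k → ex k (diag i k ⊓ diag k l) = diag i l

open CylindricOrtholattice (ex diag)

/-- Homomorphisms of `I`-dimensional cylindric ortholattices. -/
structure CylHom (I : Type u) (A : Type v) (B : Type w) [Ortholattice A] [Ortholattice B]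
    [CylindricOrtholattice I A] [CylindricOrtholattice I B] extends BoundedLatticeHom A B where
  map_compl' : ∀ a, toFun aᶜ = (toFun a)ᶜ
  map_ex' : ∀ (i : I) a, toFun (ex i a) = ex i (toFun a)
  map_diag' : ∀ i k : I, toFun (diag i k) = diag i k

namespace CylHom

instance instFunLike (I : Type u) (A : Type v) (B : Type w) [Ortholattice A] [Ortholattice B]
    [CylindricOrtholattice I A] [CylindricOrtholattice I B] : FunLike (CylHom I A B) A B where
  coe h := h.toFun
  coe_injective := by
    rintro ⟨⟨⟨⟨f, _⟩, _⟩, _, _⟩, _, _, _⟩ ⟨⟨⟨⟨g, _⟩, _⟩, _, _⟩, _, _, _⟩ h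
    cases h
    rfl

/-- The identity homomorphism. -/
protected def id (I : Type u) (A : Type v) [Ortholattice A] [CylindricOrtholattice I A] :
    CylHom I A A where
  toBoundedLatticeHom := BoundedLatticeHom.id A
  map_compl' _ := rfl
  map_ex' _ _ := rfl
  map_diag' _ _ := rfl

/-- `h.comp g` is `g` after `h`. -/
protected def comp {I : Type u} {A B C : Type*} [Ortholattice A] [Ortholattice B] [Ortholattice C]
    [CylindricOrtholattice I A] [CylindricOrtholattice I B] [CylindricOrtholattice I C]
    (h : CylHom I A B) (g : CylHom I B C) : CylHom I A C where
  toBoundedLatticeHom := g.toBoundedLatticeHom.comp h.toBoundedLatticeHom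
  map_compl' a := (congrArg g.toFun (h.map_compl' a)).trans (g.map_compl' _)
  map_ex' i a := (congrArg g.toFun (h.map_ex' i a)).trans (g.map_ex' i _)
  map_diag' i k := (congrArg g.toFun (h.map_diag' i k)).trans (g.map_diag' i k)

end CylHom

/-- The category `COL` of `I`-dimensional cylindric ortholattices. -/
structure COL (I : Type u) where
  carrier : Type v
  [ortholattice : Ortholattice carrier]
  [cylindric : CylindricOrtholattice I carrier]

attribute [instance] COL.ortholattice COL.cylindric

instance COL.instCategory (I : Type u) : Category (COL.{u, v} I) where
  Hom A B := CylHom I A.carrier B.carrier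
  id A := CylHom.id I A.carrier
  comp h g := h.comp g

/-- Proper filters of a bounded lattice. -/
structure IsProperFilter {A : Type v} [Lattice A] (x : Set A) : Prop where
  nonempty : x.Nonempty
  upward : ∀ a b, a ∈ x → a ≤ b → b ∈ x
  inf_mem : ∀ a b, a ∈ x → b ∈ x → a ⊓ b ∈ x
  proper : x ≠ Set.univ

/-! ## Cylindric orthoframes -/

/-- `U^⊥`, the set of points orthogonal to every point of `U`. -/
def orth {X : Type v} (perp : X → X → Prop) (U : Set X) : Set X := {x | ∀ y ∈ U, perp x y}

/-- `R[U]`, the relational image of `U`. -/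
def relImage {X : Type v} (R : X → X → Prop) (U : Set X) : Set X := {y | ∃ x ∈ U, R x y}

/-- `U` is biorthogonally closed. -/
def IsBiorth {X : Type v} (perp : X → X → Prop) (U : Set X) : Prop := orth perp (orth perp U) = U

structure IsOrthoframe {X : Type v} (perp : X → X → Prop) : Prop where
  irrefl : ∀ x, ¬ perp x x
  symm : ∀ x y, perp x y → perp y x

structure IsMonadicOrthoframe {X : Type v} (perp R : X → X → Prop) : Prop
    extends IsOrthoframe perp where
  refl : ∀ x, R x x
  trans : ∀ x y z, R x y → R y z → R x z
  image_orth : ∀ x, relImage R (orth perp (relImage R {x})) ⊆ orth perp (relImage R {x})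

structure IsCylindricOrthoframe {I : Type u} {X : Type v} (perp : X → X → Prop)
    (R : I → X → X → Prop) (Δ : I → I → Set X) : Prop extends IsOrthoframe perp where
  monadic : ∀ i, IsMonadicOrthoframe perp (R i)
  comm : ∀ i k x z, (∃ y, R i x y ∧ R k y z) ↔ ∃ y, R k x y ∧ R i y z
  diag_symm : ∀ i k, Δ i k = Δ k i
  diag_biorth : ∀ i k, IsBiorth perp (Δ i k)
  diag_self : ∀ i, Δ i i = Set.univ
  image_diag : ∀ i k l, i ≠ k → l ≠ k → relImage (R k) (Δ i k ∩ Δ k l) = Δ i l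

/-! ## Cylindric UVO-spaces -/

/-- `𝓕` is a proper filter in the family `C` of sets, ordered by inclusion and closed
under intersection. -/
structure IsProperFilterIn {X : Type v} (C 𝓕 : Set (Set X)) : Prop where
  subset : 𝓕 ⊆ C
  nonempty : 𝓕.Nonempty
  upward : ∀ U W, U ∈ 𝓕 → W ∈ C → U ⊆ W → W ∈ 𝓕
  inter_mem : ∀ U W, U ∈ 𝓕 → W ∈ 𝓕 → U ∩ W ∈ 𝓕
  proper : 𝓕 ≠ C

section Spaces

variable {I : Type u} {X : Type v} [TopologicalSpace X]

/-- `CO(X)`, the compact open sets. -/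
def CO (X : Type v) [TopologicalSpace X] : Set (Set X) := {U | IsCompact U ∧ IsOpen U}

/-- `COB(X)`, the compact open biorthogonally closed sets. -/
def COB (perp : X → X → Prop) : Set (Set X) := {U | U ∈ CO X ∧ IsBiorth perp U}

/-- Upper Vietoris orthospaces. -/
structure IsUVOSpace (perp : X → X → Prop) : Prop extends IsOrthoframe perp where
  t0 : T0Space X
  basis : TopologicalSpace.IsTopologicalBasis (COB perp)
  inter_mem : ∀ U W, U ∈ COB perp → W ∈ COB perp → U ∩ W ∈ COB perp
  orth_mem : ∀ U, U ∈ COB perp → orth perp U ∈ COB perp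
  filter : ∀ 𝓕, IsProperFilterIn (COB perp) 𝓕 → ∃ x, 𝓕 = {U | U ∈ COB perp ∧ x ∈ U}
  perp_sep : ∀ x y, perp x y → ∃ U ∈ COB perp, x ∈ U ∧ y ∈ orth perp U

/-- Monadic UVO-spaces. -/
structure IsMonadicUVOSpace (perp R : X → X → Prop) : Prop
    extends IsUVOSpace perp, IsMonadicOrthoframe perp R where
  image_mem : ∀ U, U ∈ COB perp → relImage R U ∈ COB perp
  rel_sep : ∀ x y, ¬ R x y → ∃ U ∈ COB perp,
    (∃ W ∈ COB perp, x ∈ W ∧ U = orth perp (orth perp (relImage R W))) ∧ y ∉ U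

/-- `I`-dimensional cylindric UVO-spaces; the conditions that do not mention the relations `R i`
are required also when `I` is empty. -/
structure IsCylindricUVOSpace (perp : X → X → Prop) (R : I → X → X → Prop)
    (Δ : I → I → Set X) : Prop extends IsUVOSpace perp, IsCylindricOrthoframe perp R Δ where
  monadicUVO : ∀ i, IsMonadicUVOSpace perp (R i)
  diag_mem : ∀ i k, Δ i k ∈ CO X

end Spaces

/-- The objects of the category `CUVO` of `I`-dimensional cylindric UVO-spaces. -/
structure CUVO (I : Type u) where
  carrier : Type v
  [top : TopologicalSpace carrier]
  perp : carrier → carrier → Prop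
  R : I → carrier → carrier → Prop
  Δ : I → I → Set carrier
  isCylindric : IsCylindricUVOSpace perp R Δ

attribute [instance] CUVO.top

/-- `I`-dimensional cylindric UVO-maps; the inequality `z ⩽ f x` in `lift` is the
specialization order. -/
structure IsCUVOMap {I : Type u} (X Y : CUVO.{u, v} I) (f : X.carrier → Y.carrier) : Prop where
  spectral : ∀ U, U ∈ CO Y.carrier → f ⁻¹' U ∈ CO X.carrier
  nonperp : ∀ x y, ¬ X.perp x y → ¬ Y.perp (f x) (f y)
  lift : ∀ z y, ¬ Y.perp z (f y) →
    ∃ x, ¬ X.perp x y ∧ ∀ U : Set Y.carrier, IsOpen U → z ∈ U → f x ∈ U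
  image : ∀ i U, U ∈ COB Y.perp → relImage (X.R i) (f ⁻¹' U) = f ⁻¹' relImage (Y.R i) U
  diag : ∀ i k, f ⁻¹' Y.Δ i k = X.Δ i k

section Orth

variable {X : Type v} {Y : Type w} {perp : X → X → Prop} {perp' : Y → Y → Prop}

theorem orth_anti {U W : Set X} (h : U ⊆ W) : orth perp W ⊆ orth perp U :=
  fun _ hx y hy => hx y (h hy)

theorem subset_orth_orth (hp : IsOrthoframe perp) (U : Set X) : U ⊆ orth perp (orth perp U) :=
  fun x hx y hy => hp.symm y x (hy x hx)

theorem isBiorth_orth (hp : IsOrthoframe perp) (U : Set X) : IsBiorth perp (orth perp U) :=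
  Set.Subset.antisymm (orth_anti (subset_orth_orth hp U)) (subset_orth_orth hp _)

theorem inter_orth (hp : IsOrthoframe perp) (U : Set X) : U ∩ orth perp U = ∅ := by
  ext x
  simp only [Set.mem_inter_iff, Set.mem_empty_iff_false, iff_false, not_and]
  exact fun hx h => hp.irrefl x (h x hx)

/-- Preimages under a frame morphism commute with `^⊥` on the sets that are closed upwards
for the relation used in the lifting condition. -/
theorem preimage_orth {f : X → Y} {le : Y → Y → Prop} {U : Set Y}
    (hp : IsOrthoframe perp) (hp' : IsOrthoframe perp')
    (h2 : ∀ x y, ¬ perp x y → ¬ perp' (f x) (f y))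
    (h3 : ∀ z y, ¬ perp' z (f y) → ∃ x, ¬ perp x y ∧ le z (f x))
    (hU : ∀ z w, le z w → z ∈ U → w ∈ U) :
    f ⁻¹' orth perp' U = orth perp (f ⁻¹' U) := by
  ext x
  constructor
  · intro hx y hy
    by_contra h
    exact h2 x y h (hx _ hy)
  · intro hx z hz
    by_contra h
    obtain ⟨w, hw, hle⟩ := h3 z x fun h' => h (hp'.symm _ _ h')
    exact hw (hp.symm _ _ (hx w (hU _ _ hle hz)))

end Orth

theorem IsCUVOMap.preimage_mem {I : Type u} {X Y : CUVO.{u, v} I} {f : X.carrier → Y.carrier}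
    (hf : IsCUVOMap X Y f) {U : Set Y.carrier} (hU : U ∈ COB Y.perp) :
    f ⁻¹' U ∈ COB X.perp := by
  have key : ∀ W, W ∈ COB Y.perp → f ⁻¹' orth Y.perp W = orth X.perp (f ⁻¹' W) := fun W hW =>
    preimage_orth (le := fun z w => ∀ V : Set Y.carrier, IsOpen V → z ∈ V → w ∈ V)
      X.isCylindric.toIsOrthoframe Y.isCylindric.toIsOrthoframe hf.nonperp hf.lift
      (fun z w h => h W hW.1.2)
  refine ⟨hf.spectral U hU.1, ?_⟩
  rw [IsBiorth, ← key U hU, ← key _ (Y.isCylindric.orth_mem U hU), hU.2]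

theorem IsCUVOMap.id {I : Type u} (X : CUVO.{u, v} I) : IsCUVOMap X X id :=
  ⟨fun _ h => h, fun _ _ h => h, fun z _ h => ⟨z, h, fun _ _ h => h⟩, fun _ _ _ => rfl,
    fun _ _ => rfl⟩

theorem IsCUVOMap.continuous {I : Type u} {X Y : CUVO.{u, v} I} {f : X.carrier → Y.carrier}
    (hf : IsCUVOMap X Y f) : Continuous f :=
  Y.isCylindric.basis.continuous_iff.2 fun _ hU => (hf.spectral _ hU.1).2

theorem IsCUVOMap.comp {I : Type u} {X Y Z : CUVO.{u, v} I} {f : X.carrier → Y.carrier}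
    {g : Y.carrier → Z.carrier} (hf : IsCUVOMap X Y f) (hg : IsCUVOMap Y Z g) :
    IsCUVOMap X Z (g ∘ f) where
  spectral U hU := hf.spectral _ (hg.spectral U hU)
  nonperp x y h := hg.nonperp _ _ (hf.nonperp x y h)
  lift z y h := by
    obtain ⟨x', hx', hz⟩ := hg.lift z (f y) h
    obtain ⟨x, hx, hx''⟩ := hf.lift x' y hx'
    exact ⟨x, hx, fun U hU hzU => hx'' _ (hU.preimage hg.continuous) (hz U hU hzU)⟩
  image i U hU := by
    rw [Set.preimage_comp, hf.image i _ (hg.preimage_mem hU), hg.image i U hU]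
    rfl
  diag i k := by rw [Set.preimage_comp, hg.diag, hf.diag]

instance CUVO.instCategory (I : Type u) : Category (CUVO.{u, v} I) where
  Hom X Y := {f : X.carrier → Y.carrier // IsCUVOMap X Y f}
  id X := ⟨id, IsCUVOMap.id X⟩
  comp f g := ⟨g.1 ∘ f.1, f.2.comp g.2⟩

/-! ## The spectrum of a cylindric ortholattice -/

section Spectrum

variable (I : Type u) (A : Type v) [Ortholattice A] [CylindricOrtholattice I A]

/-- The set of proper filters of `A`. -/
def ProperFilter (A : Type v) [Ortholattice A] : Type v := {x : Set A // IsProperFilter x}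

/-- `φ a`, the set of proper filters that contain `a`. -/
def phi {A : Type v} [Ortholattice A] (a : A) : Set (ProperFilter A) := {x | a ∈ x.1}

/-- The topology generated by the sets `φ a`. -/
instance ProperFilter.instTop (A : Type v) [Ortholattice A] : TopologicalSpace (ProperFilter A) :=
  TopologicalSpace.generateFrom (Set.range phi)

/-- `x ⊥ y` iff some `a ∈ x` has `aᶜ ∈ y`. -/
def specPerp (x y : ProperFilter A) : Prop := ∃ a ∈ x.1, aᶜ ∈ y.1

/-- `x R_i y` iff `∃_i[x] ⊆ y`. -/
def specR (i : I) (x y : ProperFilter A) : Prop := (fun a => ex i a) '' x.1 ⊆ y.1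

/-- `Δ_{i,k} = φ(δ_{i,k})`. -/
def specDiag (i k : I) : Set (ProperFilter A) := phi (diag i k)

variable {I A}

theorem Ortholattice.compl_bot : (⊥ : A)ᶜ = ⊤ := by
  have := Ortholattice.sup_compl (⊥ : A)
  rwa [bot_sup_eq] at this

theorem Ortholattice.compl_sup (a b : A) : (a ⊔ b)ᶜ = aᶜ ⊓ bᶜ := by
  refine le_antisymm (le_inf (compl_anti _ _ le_sup_left) (compl_anti _ _ le_sup_right)) ?_
  have h : a ⊔ b ≤ (aᶜ ⊓ bᶜ)ᶜ := sup_le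
    (by simpa [Ortholattice.compl_compl] using compl_anti (aᶜ ⊓ bᶜ) aᶜ inf_le_left)
    (by simpa [Ortholattice.compl_compl] using compl_anti (aᶜ ⊓ bᶜ) bᶜ inf_le_right)
  simpa [Ortholattice.compl_compl] using compl_anti _ _ h

theorem IsQuantifier.mono {q : A → A} (hq : IsQuantifier q) {a b : A} (h : a ≤ b) : q a ≤ q b := by
  have := hq.map_sup a b
  rw [sup_eq_right.2 h] at this
  rw [this]
  exact le_sup_left

theorem IsProperFilter.bot_notMem {x : Set A} (hx : IsProperFilter x) : ⊥ ∉ x :=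
  fun h => hx.proper (Set.eq_univ_of_forall fun a => hx.upward ⊥ a h bot_le)

theorem IsProperFilter.top_mem {x : Set A} (hx : IsProperFilter x) : ⊤ ∈ x :=
  let ⟨a, ha⟩ := hx.nonempty
  hx.upward a ⊤ ha le_top

theorem isProperFilter_Ici {a : A} (ha : a ≠ ⊥) : IsProperFilter (Set.Ici a) where
  nonempty := ⟨a, le_rfl⟩
  upward _ _ h h' := le_trans h h'
  inf_mem _ _ h h' := le_inf h h'
  proper h := ha (le_bot_iff.1 (show ⊥ ∈ Set.Ici a from h ▸ Set.mem_univ _))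

theorem phi_bot : phi (⊥ : A) = ∅ :=
  Set.eq_empty_of_forall_notMem fun x hx => x.2.bot_notMem hx

theorem phi_top : phi (⊤ : A) = Set.univ := Set.eq_univ_of_forall fun x => x.2.top_mem

theorem phi_inf (a b : A) : phi (a ⊓ b) = phi a ∩ phi b :=
  Set.ext fun x => ⟨fun h => ⟨x.2.upward _ _ h inf_le_left, x.2.upward _ _ h inf_le_right⟩,
    fun h => x.2.inf_mem _ _ h.1 h.2⟩

theorem phi_subset {a b : A} : phi a ⊆ phi b ↔ a ≤ b := by
  refine ⟨fun h => ?_, fun h x hx => x.2.upward _ _ hx h⟩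
  by_cases ha : a = ⊥
  · rw [ha]; exact bot_le
  · exact h (show (⟨Set.Ici a, isProperFilter_Ici ha⟩ : ProperFilter A) ∈ phi a from le_refl a)

theorem isOrthoframe_spec : IsOrthoframe (specPerp A) where
  irrefl := by
    rintro x ⟨a, ha, ha'⟩
    exact x.2.bot_notMem (Ortholattice.inf_compl a ▸ x.2.inf_mem _ _ ha ha')
  symm := by
    rintro x y ⟨a, ha, ha'⟩
    exact ⟨aᶜ, ha', by rwa [Ortholattice.compl_compl]⟩

theorem orth_phi (a : A) : orth (specPerp A) (phi a) = phi aᶜ := by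
  ext x
  constructor
  · intro h
    by_cases ha : a = ⊥
    · rw [ha, Ortholattice.compl_bot, phi_top]; trivial
    · obtain ⟨b, hb, hb'⟩ := h ⟨Set.Ici a, isProperFilter_Ici ha⟩ (le_refl a)
      refine x.2.upward b _ hb ?_
      simpa [Ortholattice.compl_compl] using Ortholattice.compl_anti _ _ (Set.mem_Ici.1 hb')
  · intro h y hy
    exact ⟨aᶜ, h, by rwa [Ortholattice.compl_compl]⟩

theorem orth_union {X : Type v} (perp : X → X → Prop) (U W : Set X) :
    orth perp (U ∪ W) = orth perp U ∩ orth perp W :=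
  Set.ext fun _ => ⟨fun h => ⟨fun y hy => h y (.inl hy), fun y hy => h y (.inr hy)⟩,
    fun h y hy => hy.elim (h.1 y) (h.2 y)⟩

theorem isBiorth_phi (a : A) : IsBiorth (specPerp A) (phi a) := by
  rw [IsBiorth, orth_phi, orth_phi, Ortholattice.compl_compl]

theorem isTopologicalBasis_phi :
    TopologicalSpace.IsTopologicalBasis (Set.range (phi : A → Set (ProperFilter A))) where
  exists_subset_inter := by
    rintro _ ⟨a, rfl⟩ _ ⟨b, rfl⟩ x hx
    exact ⟨_, ⟨a ⊓ b, rfl⟩, (phi_inf a b) ▸ hx, (phi_inf a b).le⟩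
  sUnion_eq := Set.eq_univ_of_forall fun x => ⟨phi ⊤, ⟨⊤, rfl⟩, x.2.top_mem⟩
  eq_generateFrom := rfl

theorem phi_mem_CO (a : A) : phi a ∈ CO (ProperFilter A) := by
  refine ⟨?_, isTopologicalBasis_phi.isOpen ⟨a, rfl⟩⟩
  by_cases ha : a = ⊥
  · rw [ha, phi_bot]; exact isCompact_empty
  · refine isCompact_of_finite_subcover fun {ι} U hU hc => ?_
    obtain ⟨j, hj⟩ := Set.mem_iUnion.1
      (hc (show (⟨Set.Ici a, isProperFilter_Ici ha⟩ : ProperFilter A) ∈ phi a from le_refl a))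
    obtain ⟨_, ⟨b, rfl⟩, hb, hbU⟩ := isTopologicalBasis_phi.exists_subset_of_mem_open hj (hU j)
    refine ⟨{j}, ?_⟩
    simpa using (phi_subset.2 (show a ≤ b from hb)).trans hbU

theorem phi_mem_COB (a : A) : phi a ∈ COB (specPerp A) := ⟨phi_mem_CO a, isBiorth_phi a⟩

/-- A finite union of sets `φ a` has the same orthogonal set as a single one. -/
theorem exists_orth_sUnion (s : Set (Set (ProperFilter A))) (hs : s.Finite)
    (h : s ⊆ Set.range phi) : ∃ a : A, orth (specPerp A) (⋃₀ s) = phi aᶜ := by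
  induction s, hs using Set.Finite.induction_on with
  | empty =>
    refine ⟨⊥, ?_⟩
    rw [Ortholattice.compl_bot, phi_top]
    exact Set.eq_univ_of_forall fun x y hy => by simp at hy
  | insert _ _ ih =>
    obtain ⟨a, ha⟩ := ih ((Set.subset_insert _ _).trans h)
    obtain ⟨b, hb⟩ := h (Set.mem_insert _ _)
    refine ⟨b ⊔ a, ?_⟩
    rw [Set.sUnion_insert, orth_union, ha, ← hb, orth_phi, Ortholattice.compl_sup, phi_inf]

theorem COB_spec : COB (specPerp A) = Set.range phi := by
  refine Set.Subset.antisymm ?_ (Set.range_subset_iff.2 phi_mem_COB)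
  rintro U ⟨⟨hc, ho⟩, hb⟩
  obtain ⟨t, ht, rfl⟩ := (isCompact_open_iff_eq_finite_iUnion_of_isTopologicalBasis
    (phi : A → Set (ProperFilter A)) isTopologicalBasis_phi (fun a => (phi_mem_CO a).1) U).1 ⟨hc, ho⟩
  rw [← Set.sUnion_image] at hb ⊢
  obtain ⟨a, ha⟩ := exists_orth_sUnion (phi '' t) (ht.image _) (Set.image_subset_range _ _)
  refine ⟨a, ?_⟩
  rw [IsBiorth, ha, orth_phi, Ortholattice.compl_compl] at hb
  exact hb

theorem relImage_phi (i : I) (a : A) : relImage (specR I A i) (phi a) = phi (ex i a) := by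
  ext y
  constructor
  · rintro ⟨x, hx, hxy⟩
    exact hxy ⟨a, hx, rfl⟩
  · intro hy
    have ha : a ≠ ⊥ := by
      rintro rfl
      rw [(CylindricOrtholattice.quantifier i).map_bot] at hy
      exact y.2.bot_notMem hy
    refine ⟨⟨Set.Ici a, isProperFilter_Ici ha⟩, le_refl a, ?_⟩
    rintro _ ⟨b, hb, rfl⟩
    exact y.2.upward _ _ hy ((CylindricOrtholattice.quantifier i).mono hb)

/-- The filter generated by `∃_i[x]`. -/
def exFilter (i : I) (x : ProperFilter A) : ProperFilter A :=
  ⟨{b | ∃ a ∈ x.1, ex i a ≤ b},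
    { nonempty := ⟨⊤, ⊤, x.2.top_mem, le_top⟩
      upward := by
        rintro b c ⟨a, ha, hab⟩ hbc
        exact ⟨a, ha, hab.trans hbc⟩
      inf_mem := by
        rintro b c ⟨a, ha, hab⟩ ⟨a', ha', hac⟩
        have hq : IsQuantifier (ex (A := A) i) := CylindricOrtholattice.quantifier i
        exact ⟨a ⊓ a', x.2.inf_mem _ _ ha ha', le_inf ((hq.mono inf_le_left).trans hab)
          ((hq.mono inf_le_right).trans hac)⟩
      proper := by
        intro h
        obtain ⟨a, ha, hab⟩ := h.ge (Set.mem_univ ⊥)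
        exact x.2.bot_notMem (x.2.upward _ _ ha
          (((CylindricOrtholattice.quantifier i).le a).trans hab)) }⟩

theorem spec_comm_aux (i k : I) (x z : ProperFilter A)
    (h : ∃ y, specR I A i x y ∧ specR I A k y z) : ∃ y, specR I A k x y ∧ specR I A i y z := by
  obtain ⟨y, hxy, hyz⟩ := h
  refine ⟨exFilter k x, ?_, ?_⟩
  · rintro _ ⟨a, ha, rfl⟩
    exact ⟨a, ha, le_rfl⟩
  · rintro _ ⟨b, ⟨a, ha, hab⟩, rfl⟩
    have h1 : ex k (ex i a) ∈ z.1 := hyz ⟨_, hxy ⟨a, ha, rfl⟩, rfl⟩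
    rw [← CylindricOrtholattice.ex_comm] at h1
    exact z.2.upward _ _ h1 ((CylindricOrtholattice.quantifier i).mono hab)

theorem isMonadicOrthoframe_spec (i : I) : IsMonadicOrthoframe (specPerp A) (specR I A i) where
  toIsOrthoframe := isOrthoframe_spec
  refl x := by
    rintro _ ⟨a, ha, rfl⟩
    exact x.2.upward _ _ ha ((CylindricOrtholattice.quantifier i).le a)
  trans x y z hxy hyz := by
    rintro _ ⟨a, ha, rfl⟩
    have := hyz ⟨_, hxy ⟨a, ha, rfl⟩, rfl⟩
    simpa only [(CylindricOrtholattice.quantifier i).idem] using this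
  image_orth x := by
    have hq : IsQuantifier (ex (A := A) i) := CylindricOrtholattice.quantifier i
    rintro y ⟨w, hw, hwy⟩ z hz
    have hxz : specR I A i x z := by
      obtain ⟨x', rfl, h⟩ := hz
      exact h
    obtain ⟨b, hb, a, ha, hab⟩ := hw (exFilter i x) ⟨x, rfl, by
      rintro _ ⟨a, ha, rfl⟩
      exact ⟨a, ha, le_rfl⟩⟩
    have h1 : b ≤ (ex i a)ᶜ := by
      simpa [Ortholattice.compl_compl] using Ortholattice.compl_anti _ _ hab
    have h2 : ex i (ex i a)ᶜ ∈ y.1 := hwy ⟨_, w.2.upward _ _ hb h1, rfl⟩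
    rw [hq.compl] at h2
    exact ⟨_, h2, by rw [Ortholattice.compl_compl]; exact hxz ⟨a, ha, rfl⟩⟩

theorem isUVOSpace_spec : IsUVOSpace (specPerp A) where
  toIsOrthoframe := isOrthoframe_spec
  t0 := by
    refine ⟨fun x y h => Subtype.ext (Set.ext fun a => ?_)⟩
    have h1 : x ∈ phi a ↔ y ∈ phi a := h.mem_open_iff (phi_mem_CO a).2
    exact h1
  basis := by
    rw [COB_spec]
    exact isTopologicalBasis_phi
  inter_mem := by
    rw [COB_spec]
    rintro _ _ ⟨a, rfl⟩ ⟨b, rfl⟩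
    exact ⟨a ⊓ b, phi_inf a b⟩
  orth_mem := by
    rw [COB_spec]
    rintro _ ⟨a, rfl⟩
    exact ⟨aᶜ, (orth_phi a).symm⟩
  filter := by
    rw [COB_spec]
    intro 𝓕 h𝓕
    refine ⟨⟨{a | phi a ∈ 𝓕}, ?_, ?_, ?_, ?_⟩, ?_⟩
    · obtain ⟨U, hU⟩ := h𝓕.nonempty
      obtain ⟨a, rfl⟩ := h𝓕.subset hU
      exact ⟨a, hU⟩
    · exact fun a b ha hab => h𝓕.upward _ _ ha ⟨b, rfl⟩ (phi_subset.2 hab)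
    · intro a b ha hb
      have := h𝓕.inter_mem _ _ ha hb
      rwa [← phi_inf] at this
    · intro h
      refine h𝓕.proper (Set.Subset.antisymm h𝓕.subset ?_)
      rintro _ ⟨a, rfl⟩
      exact h.ge (Set.mem_univ a)
    · ext U
      constructor
      · intro hU
        obtain ⟨a, rfl⟩ := h𝓕.subset hU
        exact ⟨⟨a, rfl⟩, hU⟩
      · rintro ⟨⟨a, rfl⟩, hU⟩
        exact hU
  perp_sep := by
    rintro x y ⟨a, ha, ha'⟩
    exact ⟨phi a, phi_mem_COB a, ha, by rw [orth_phi]; exact ha'⟩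

theorem isCylindricUVOSpace_spec :
    IsCylindricUVOSpace (specPerp A) (specR I A) (specDiag I A) where
  toIsUVOSpace := isUVOSpace_spec
  monadic := isMonadicOrthoframe_spec
  comm i k x z := ⟨spec_comm_aux i k x z, spec_comm_aux k i x z⟩
  diag_symm i k := congrArg phi (CylindricOrtholattice.diag_symm i k)
  diag_biorth i k := isBiorth_phi _
  diag_self i := by rw [specDiag, CylindricOrtholattice.diag_self, phi_top]
  image_diag i k l h h' := by
    rw [specDiag, specDiag, ← phi_inf, relImage_phi, CylindricOrtholattice.ex_diag i k l h h']
    rfl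
  monadicUVO i :=
    { toIsUVOSpace := isUVOSpace_spec
      refl := (isMonadicOrthoframe_spec i).refl
      trans := (isMonadicOrthoframe_spec i).trans
      image_orth := (isMonadicOrthoframe_spec i).image_orth
      image_mem := by
        rw [COB_spec]
        rintro _ ⟨a, rfl⟩
        exact ⟨ex i a, (relImage_phi i a).symm⟩
      rel_sep := by
        intro x y h
        obtain ⟨_, ⟨a, ha, rfl⟩, hy⟩ := Set.not_subset.1 h
        refine ⟨phi (ex i a), phi_mem_COB _, ⟨phi a, phi_mem_COB _, ha, ?_⟩, hy⟩
        rw [relImage_phi, isBiorth_phi] }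
  diag_mem i k := phi_mem_CO _

end Spectrum

/-- The spectrum `S₀(A)` of a cylindric ortholattice. -/
def S₀ {I : Type u} (A : COL.{u, v} I) : CUVO.{u, v} I where
  carrier := ProperFilter A.carrier
  perp := specPerp A.carrier
  R := specR I A.carrier
  Δ := specDiag I A.carrier
  isCylindric := isCylindricUVOSpace_spec

/-- `S₁(h) = h⁻¹` on points. -/
def S₁fun {I : Type u} {A B : COL.{u, v} I} (h : A ⟶ B) (x : (S₀ B).carrier) : (S₀ A).carrier :=
  ⟨(fun a => (show CylHom I A.carrier B.carrier from h) a) ⁻¹' x.1,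
    { nonempty := ⟨⊤, by
        show h.toFun ⊤ ∈ x.1
        rw [h.map_top']; exact x.2.top_mem⟩
      upward := fun a b ha hab => x.2.upward _ _ ha (OrderHomClass.mono h.toBoundedLatticeHom hab)
      inf_mem := fun a b ha hb => by
        show h.toFun (a ⊓ b) ∈ x.1
        rw [h.map_inf']; exact x.2.inf_mem _ _ ha hb
      proper := fun hu => by
        have h1 : h.toFun ⊥ ∈ x.1 := hu.ge (Set.mem_univ (⊥ : A.carrier))
        rw [h.map_bot'] at h1; exact x.2.bot_notMem h1 }⟩

theorem S₁fun_preimage_phi {I : Type u} {A B : COL.{u, v} I} (h : A ⟶ B) (a : A.carrier) :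
    S₁fun h ⁻¹' phi a = phi (h.toFun a) := rfl

theorem isCUVOMap_S₁ {I : Type u} {A B : COL.{u, v} I} (h : A ⟶ B) :
    IsCUVOMap (S₀ B) (S₀ A) (S₁fun h) where
  spectral := by
    intro U hU
    obtain ⟨s, hs, rfl⟩ := (isCompact_open_iff_eq_finite_iUnion_of_isTopologicalBasis
      (phi : A.carrier → Set (ProperFilter A.carrier)) isTopologicalBasis_phi
      (fun a => (phi_mem_CO a).1) U).1 hU
    have h1 : S₁fun h ⁻¹' (⋃ a ∈ s, phi a) = ⋃ a ∈ s, phi (h.toFun a) := Set.preimage_iUnion₂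
    have h2 : (⋃ a ∈ s, phi (h.toFun a)) ∈ CO (ProperFilter B.carrier) :=
      ⟨hs.isCompact_biUnion fun a _ => (phi_mem_CO (h.toFun a)).1,
        isOpen_biUnion fun a _ => (phi_mem_CO (h.toFun a)).2⟩
    exact (congrArg (fun W => W ∈ CO (ProperFilter B.carrier)) h1).mpr h2
  nonperp := by
    rintro x y hxy ⟨a, ha, ha'⟩
    refine hxy ⟨h.toFun a, ha, ?_⟩
    rw [← h.map_compl']; exact ha'
  lift := by
    intro z y hzy
    refine ⟨⟨{b | ∃ a ∈ z.1, h.toFun a ≤ b}, ?_, ?_, ?_, ?_⟩, ?_, ?_⟩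
    · exact ⟨⊤, ⊤, z.2.top_mem, le_top⟩
    · rintro b c ⟨a, ha, hab⟩ hbc
      exact ⟨a, ha, hab.trans hbc⟩
    · rintro b c ⟨a, ha, hab⟩ ⟨a', ha', hac⟩
      refine ⟨a ⊓ a', z.2.inf_mem _ _ ha ha', ?_⟩
      rw [h.map_inf']
      exact inf_le_inf hab hac
    · intro hu
      obtain ⟨a, ha, hab⟩ := hu.ge (Set.mem_univ (⊥ : B.carrier))
      refine hzy ⟨a, ha, ?_⟩
      show h.toFun aᶜ ∈ y.1
      rw [h.map_compl', le_bot_iff.1 hab, Ortholattice.compl_bot]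
      exact y.2.top_mem
    · rintro ⟨b, ⟨a, ha, hab⟩, hb⟩
      refine hzy ⟨a, ha, ?_⟩
      show h.toFun aᶜ ∈ y.1
      rw [h.map_compl']
      exact y.2.upward _ _ hb (Ortholattice.compl_anti _ _ hab)
    · intro U hU hz
      obtain ⟨_, ⟨a, rfl⟩, ha, haU⟩ := isTopologicalBasis_phi.exists_subset_of_mem_open hz hU
      exact haU ⟨a, ha, le_rfl⟩
  image := by
    intro i U hU
    obtain ⟨a, rfl⟩ := COB_spec.le hU
    rw [S₁fun_preimage_phi]
    refine (relImage_phi i _).trans ?_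
    rw [← h.map_ex', ← S₁fun_preimage_phi]
    exact congrArg _ (relImage_phi i a).symm
  diag i k := by
    refine (S₁fun_preimage_phi h _).trans ?_
    rw [h.map_diag']; rfl

/-- The contravariant functor `S_F`. -/
def S_F (I : Type u) : (COL.{u, v} I)ᵒᵖ ⥤ CUVO.{u, v} I where
  obj A := S₀ A.unop
  map h := ⟨S₁fun h.unop, isCUVOMap_S₁ h.unop⟩

/-! ## The algebra of compact open biorthogonally closed sets -/

section Algebra

variable {I : Type u} (X : CUVO.{u, v} I)

theorem CUVO.empty_mem : ∅ ∈ COB X.perp := by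
  have hp := X.isCylindric.toIsOrthoframe
  rcases isEmpty_or_nonempty X.carrier with h | ⟨⟨x⟩⟩
  · exact ⟨⟨isCompact_empty, isOpen_empty⟩, Subsingleton.elim _ _⟩
  · obtain ⟨U, hU, -⟩ := X.isCylindric.basis.exists_subset_of_mem_open (Set.mem_univ x) isOpen_univ
    rw [← inter_orth hp U]
    exact X.isCylindric.inter_mem _ _ hU (X.isCylindric.orth_mem _ hU)

theorem orth_empty {X : Type v} (perp : X → X → Prop) : orth perp ∅ = Set.univ :=
  Set.eq_univ_of_forall fun _ _ hy => hy.elim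

theorem CUVO.univ_mem : Set.univ ∈ COB X.perp := by
  rw [← orth_empty X.perp]
  exact X.isCylindric.orth_mem _ X.empty_mem

theorem CUVO.sup_mem {U W : Set X.carrier} (hU : U ∈ COB X.perp) (hW : W ∈ COB X.perp) :
    orth X.perp (orth X.perp (U ∪ W)) ∈ COB X.perp := by
  rw [orth_union]
  exact X.isCylindric.orth_mem _ (X.isCylindric.inter_mem _ _ (X.isCylindric.orth_mem _ hU)
    (X.isCylindric.orth_mem _ hW))

theorem CUVO.image_mem (i : I) {U : Set X.carrier} (hU : U ∈ COB X.perp) :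
    orth X.perp (orth X.perp (relImage (X.R i) U)) ∈ COB X.perp :=
  X.isCylindric.orth_mem _ (X.isCylindric.orth_mem _
    ((X.isCylindric.monadicUVO i).image_mem U hU))

/-- The ortholattice `⟨COB(X); ∩, ⊔, ^⊥, ∅, X⟩` with `U ⊔ W = (U ∪ W)^⊥⊥`. -/
instance CUVO.instOrtholattice : Ortholattice {U // U ∈ COB X.perp} where
  le U W := U.1 ⊆ W.1
  le_refl U := subset_rfl
  le_trans _ _ _ h h' := h.trans h'
  le_antisymm _ _ h h' := Subtype.ext (h.antisymm h')
  inf U W := ⟨U.1 ∩ W.1, X.isCylindric.inter_mem _ _ U.2 W.2⟩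
  inf_le_left _ _ := Set.inter_subset_left
  inf_le_right _ _ := Set.inter_subset_right
  le_inf _ _ _ h h' := Set.subset_inter h h'
  sup U W := ⟨orth X.perp (orth X.perp (U.1 ∪ W.1)), X.sup_mem U.2 W.2⟩
  le_sup_left _ _ := Set.subset_union_left.trans (subset_orth_orth X.isCylindric.toIsOrthoframe _)
  le_sup_right _ _ := Set.subset_union_right.trans (subset_orth_orth X.isCylindric.toIsOrthoframe _)
  sup_le U W T h h' := (orth_anti (orth_anti (Set.union_subset h h'))).trans T.2.2.le
  top := ⟨Set.univ, X.univ_mem⟩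
  le_top _ := Set.subset_univ _
  bot := ⟨∅, X.empty_mem⟩
  bot_le _ := Set.empty_subset _
  compl U := ⟨orth X.perp U.1, X.isCylindric.orth_mem _ U.2⟩
  inf_compl U := Subtype.ext (inter_orth X.isCylindric.toIsOrthoframe U.1)
  sup_compl U := Subtype.ext (by
    show orth X.perp (orth X.perp (U.1 ∪ orth X.perp U.1)) = Set.univ
    rw [orth_union, inter_orth X.isCylindric.toIsOrthoframe, orth_empty])
  compl_anti _ _ h := orth_anti h
  compl_compl U := Subtype.ext U.2.2

end Algebra

section Frame

variable {X : Type v} {perp R : X → X → Prop}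

theorem relImage_mono {U W : Set X} (h : U ⊆ W) : relImage R U ⊆ relImage R W :=
  fun _ ⟨x, hx, hxy⟩ => ⟨x, h hx, hxy⟩

theorem IsMonadicOrthoframe.subset_image (h : IsMonadicOrthoframe perp R) (U : Set X) :
    U ⊆ relImage R U := fun x hx => ⟨x, hx, h.refl x⟩

theorem IsMonadicOrthoframe.image_image (h : IsMonadicOrthoframe perp R) (U : Set X) :
    relImage R (relImage R U) = relImage R U :=
  Set.Subset.antisymm (fun _ ⟨_, ⟨w, hw, hwy⟩, hyz⟩ => ⟨w, hw, h.trans _ _ _ hwy hyz⟩)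
    (h.subset_image _)

theorem IsMonadicOrthoframe.image_orth_image (h : IsMonadicOrthoframe perp R) (U : Set X) :
    relImage R (orth perp (relImage R U)) = orth perp (relImage R U) := by
  refine Set.Subset.antisymm ?_ (h.subset_image _)
  rintro z ⟨y, hy, hyz⟩ w ⟨x, hx, hxw⟩
  refine h.image_orth x ⟨y, ?_, hyz⟩ w ⟨x, rfl, hxw⟩
  rintro w' ⟨x', rfl, hw'⟩
  exact hy w' ⟨_, hx, hw'⟩

/-- The sets closed under `R` are stable under `^⊥`. -/
theorem IsMonadicOrthoframe.image_orth_of (h : IsMonadicOrthoframe perp R) {U : Set X}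
    (hU : relImage R U = U) : relImage R (orth perp U) = orth perp U := by
  have := h.image_orth_image U
  rwa [hU] at this

end Frame

section Algebra

variable {I : Type u} (X : CUVO.{u, v} I)

theorem CUVO.biorth_image (i : I) {U : Set X.carrier} (hU : U ∈ COB X.perp) :
    orth X.perp (orth X.perp (relImage (X.R i) U)) = relImage (X.R i) U :=
  ((X.isCylindric.monadicUVO i).image_mem U hU).2

/-- The cylindric structure on `COB(X)` with `∃_i U = R_i[U]^⊥⊥`. -/
instance CUVO.instCylindric : CylindricOrtholattice I {U // U ∈ COB X.perp} where
  ex i U := ⟨orth X.perp (orth X.perp (relImage (X.R i) U.1)), X.image_mem i U.2⟩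
  diag i k := ⟨X.Δ i k, X.isCylindric.diag_mem i k, X.isCylindric.diag_biorth i k⟩
  quantifier i := by
    have hf := X.isCylindric.monadic i
    refine ⟨fun U W => le_antisymm ?_ ?_, ?_, ?_, ?_, ?_⟩
    · show orth X.perp (orth X.perp (relImage (X.R i) (orth X.perp (orth X.perp (U.1 ∪ W.1))))) ⊆
        orth X.perp (orth X.perp (orth X.perp (orth X.perp (relImage (X.R i) U.1)) ∪
          orth X.perp (orth X.perp (relImage (X.R i) W.1))))
      rw [X.biorth_image i (X.sup_mem U.2 W.2), X.biorth_image i U.2, X.biorth_image i W.2]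
      have h1 : relImage (X.R i) (relImage (X.R i) U.1 ∪ relImage (X.R i) W.1) =
          relImage (X.R i) U.1 ∪ relImage (X.R i) W.1 := by
        refine Set.Subset.antisymm ?_ (hf.subset_image _)
        rintro y ⟨x, hx | hx, hxy⟩
        · exact .inl ((hf.image_image U.1).le ⟨x, hx, hxy⟩)
        · exact .inr ((hf.image_image W.1).le ⟨x, hx, hxy⟩)
      rw [← hf.image_orth_of (hf.image_orth_of h1)]
      exact relImage_mono (orth_anti (orth_anti
        (Set.union_subset_union (hf.subset_image _) (hf.subset_image _))))
    · have mono : ∀ S T : {U // U ∈ COB X.perp}, S ≤ T →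
          orth X.perp (orth X.perp (relImage (X.R i) S.1)) ⊆
            orth X.perp (orth X.perp (relImage (X.R i) T.1)) :=
        fun S T h => orth_anti (orth_anti (relImage_mono h))
      exact sup_le (mono U (U ⊔ W) le_sup_left) (mono W (U ⊔ W) le_sup_right)
    · refine Subtype.ext ((X.biorth_image i X.empty_mem).trans ?_)
      exact Set.eq_empty_of_forall_notMem fun y ⟨x, hx, _⟩ => hx
    · intro U
      refine Subtype.ext ?_
      show orth X.perp (orth X.perp (relImage (X.R i) (orth X.perp (orth X.perp
        (relImage (X.R i) U.1))))) = orth X.perp (orth X.perp (relImage (X.R i) U.1))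
      rw [X.biorth_image i U.2, hf.image_image, X.biorth_image i U.2]
    · intro U
      exact (hf.subset_image U.1).trans (X.biorth_image i U.2).ge
    · intro U
      refine Subtype.ext ?_
      show orth X.perp (orth X.perp (relImage (X.R i) (orth X.perp (orth X.perp (orth X.perp
        (relImage (X.R i) U.1)))))) = orth X.perp (orth X.perp (orth X.perp (relImage (X.R i) U.1)))
      rw [X.biorth_image i U.2, hf.image_orth_image, X.biorth_image i U.2]
  ex_comm i k U := by
    refine Subtype.ext ?_
    show orth X.perp (orth X.perp (relImage (X.R i) (orth X.perp (orth X.perp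
        (relImage (X.R k) U.1))))) = orth X.perp (orth X.perp (relImage (X.R k)
        (orth X.perp (orth X.perp (relImage (X.R i) U.1)))))
    rw [X.biorth_image i U.2, X.biorth_image k U.2]
    congr 2
    ext z
    constructor
    · rintro ⟨y, ⟨x, hx, hxy⟩, hyz⟩
      obtain ⟨y', h1, h2⟩ := (X.isCylindric.comm i k x z).2 ⟨y, hxy, hyz⟩
      exact ⟨y', ⟨x, hx, h1⟩, h2⟩
    · rintro ⟨y, ⟨x, hx, hxy⟩, hyz⟩
      obtain ⟨y', h1, h2⟩ := (X.isCylindric.comm i k x z).1 ⟨y, hxy, hyz⟩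
      exact ⟨y', ⟨x, hx, h1⟩, h2⟩
  diag_symm i k := Subtype.ext (X.isCylindric.diag_symm i k)
  diag_self i := Subtype.ext (X.isCylindric.diag_self i)
  ex_diag i k l h h' := by
    refine Subtype.ext ?_
    show orth X.perp (orth X.perp (relImage (X.R k) (X.Δ i k ∩ X.Δ k l))) = X.Δ i l
    rw [X.isCylindric.image_diag i k l h h', X.isCylindric.diag_biorth]

end Algebra

/-- The algebra `A₀(X)` of a cylindric UVO-space. -/
def A₀ {I : Type u} (X : CUVO.{u, v} I) : COL.{u, v} I where
  carrier := {U // U ∈ COB X.perp}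

theorem IsCUVOMap.preimage_orth {I : Type u} {X Y : CUVO.{u, v} I} {f : X.carrier → Y.carrier}
    (hf : IsCUVOMap X Y f) {U : Set Y.carrier} (hU : IsOpen U) :
    f ⁻¹' orth Y.perp U = orth X.perp (f ⁻¹' U) :=
  _root_.preimage_orth (le := fun z w => ∀ V : Set Y.carrier, IsOpen V → z ∈ V → w ∈ V)
      X.isCylindric.toIsOrthoframe Y.isCylindric.toIsOrthoframe hf.nonperp hf.lift
      (fun _ _ h => h U hU)

/-- `A₁(f) = f⁻¹`. -/
def A₁ {I : Type u} {X Y : CUVO.{u, v} I} (f : X ⟶ Y) : A₀ Y ⟶ A₀ X where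
  toFun U := ⟨f.1 ⁻¹' U.1, f.2.preimage_mem U.2⟩
  map_inf' _ _ := rfl
  map_top' := rfl
  map_bot' := rfl
  map_sup' U W := by
    refine Subtype.ext ?_
    show f.1 ⁻¹' orth Y.perp (orth Y.perp (U.1 ∪ W.1)) =
      orth X.perp (orth X.perp (f.1 ⁻¹' U.1 ∪ f.1 ⁻¹' W.1))
    have h1 : IsOpen (orth Y.perp (U.1 ∪ W.1)) := by
      rw [orth_union]
      exact (Y.isCylindric.orth_mem _ U.2).1.2.inter (Y.isCylindric.orth_mem _ W.2).1.2
    rw [f.2.preimage_orth h1, f.2.preimage_orth (U.2.1.2.union W.2.1.2)]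
    rfl
  map_compl' U := Subtype.ext (f.2.preimage_orth U.2.1.2)
  map_ex' i U := by
    refine Subtype.ext ?_
    show f.1 ⁻¹' orth Y.perp (orth Y.perp (relImage (Y.R i) U.1)) =
      orth X.perp (orth X.perp (relImage (X.R i) (f.1 ⁻¹' U.1)))
    rw [Y.biorth_image i U.2, X.biorth_image i (f.2.preimage_mem U.2), f.2.image i U.1 U.2]
  map_diag' i k := Subtype.ext (f.2.diag i k)

/-- The contravariant functor `A_F`. -/
def A_F (I : Type u) : (CUVO.{u, v} I)ᵒᵖ ⥤ COL.{u, v} I where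
  obj X := A₀ X.unop
  map f := A₁ f.unop

/-! ## Models of ZF

Provability in ZF is truth in all models of ZF. A model is a first-order structure `V` in the
language with one binary relation symbol; the axiom schemes range over the classes that are
first-order definable over `V` with parameters. There is no axiom of choice. -/

/-- The relation symbols of the language of set theory. -/
inductive SetLangRel : ℕ → Type
  | mem : SetLangRel 2

/-- The first-order language of set theory. -/
def setLang : FirstOrder.Language.{0, 0} := ⟨fun _ => Empty, SetLangRel⟩

/-- The membership relation of a structure for the language of set theory. -/
def VMem {V : Type w} [setLang.Structure V] (x y : V) : Prop :=
  FirstOrder.Language.Structure.RelMap (L := setLang) SetLangRel.mem ![x, y]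

infix:50 "∊" => VMem

/-- `V` is a model of the axioms of Zermelo-Fraenkel set theory (without choice). -/
class IsZFModel (V : Type w) [setLang.Structure V] : Prop where
  extensionality : ∀ x y : V, (∀ z : V, z ∊ x ↔ z ∊ y) → x = y
  foundation : ∀ x : V, (∃ y : V, y ∊ x) → ∃ y : V, y ∊ x ∧ ∀ z : V, ¬ (z ∊ y ∧ z ∊ x)
  pairing : ∀ x y : V, ∃ z : V, ∀ t : V, t ∊ z ↔ t = x ∨ t = y
  union : ∀ x : V, ∃ z : V, ∀ t : V, t ∊ z ↔ ∃ y : V, t ∊ y ∧ y ∊ x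
  powerset : ∀ x : V, ∃ z : V, ∀ t : V, t ∊ z ↔ ∀ s : V, s ∊ t → s ∊ x
  infinity : ∃ z : V, (∃ e : V, e ∊ z ∧ ∀ t : V, ¬ t ∊ e) ∧
    ∀ x : V, x ∊ z → ∃ y : V, y ∊ z ∧ ∀ t : V, t ∊ y ↔ t ∊ x ∨ t = x
  separation : ∀ D : Set V, Set.univ.Definable₁ setLang D →
    ∀ x : V, ∃ z : V, ∀ t : V, t ∊ z ↔ t ∊ x ∧ t ∈ D
  replacement : ∀ F : Set (V × V), Set.univ.Definable₂ setLang F →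
    ∀ x : V, (∀ s : V, s ∊ x → ∃! t : V, (s, t) ∈ F) →
      ∃ z : V, ∀ t : V, t ∊ z ↔ ∃ s : V, s ∊ x ∧ (s, t) ∈ F

section Model

variable {V : Type w} [setLang.Structure V]

/-- The elements of the set `a` of the model. -/
def El (a : V) : Type w := {x : V // x ∊ a}

/-- `p` is the Kuratowski pair `{{x}, {x, y}}` in the model. -/
def IsPair (p x y : V) : Prop :=
  ∀ z : V, z ∊ p ↔ (∀ t : V, t ∊ z ↔ t = x) ∨ (∀ t : V, t ∊ z ↔ t = x ∨ t = y)

/-- The relation `P` between the elements of `a` and `b` is a set of the model. -/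
def IsSetRel₂ {a b : V} (P : El a → El b → Prop) : Prop :=
  ∃ r : V, ∀ x y, P x y ↔ ∃ p : V, IsPair p x.1 y.1 ∧ p ∊ r

/-- The ternary relation `P` between the elements of `a`, `b` and `c` is a set of the model. -/
def IsSetRel₃ {a b c : V} (P : El a → El b → El c → Prop) : Prop :=
  ∃ r : V, ∀ x y z, P x y z ↔ ∃ q p : V, IsPair q x.1 y.1 ∧ IsPair p q z.1 ∧ p ∊ r

/-- The function `f` from `a` to `b` is a set of the model. -/
def IsSetFun {a b : V} (f : El a → El b) : Prop := IsSetRel₂ fun x y => f x = y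

/-- The binary function `f` from `a` and `b` to `c` is a set of the model. -/
def IsSetFun₂ {a b c : V} (f : El a → El b → El c) : Prop := IsSetRel₃ fun x y z => f x y = z

/-- The set of those elements of `c` that belong to `u`. -/
def trace (c u : V) : Set (El c) := {x | x.1 ∊ u}

/-- The family of the subsets of `c` cut out by the elements of `F`. -/
def traceFamily (c F : V) : Set (Set (El c)) := {U | ∃ u : V, u ∊ F ∧ trace c u = U}

/-- `s` is finite in the sense of the model: it belongs to every set of the model that contains
the empty set and is closed under adjoining one element of `s`. (In ZF this is equivalent to
`s` having a bijection with a natural number.) -/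
def VFinite (s : V) : Prop :=
  ∀ K : V, (∃ e : V, e ∊ K ∧ ∀ t : V, ¬ t ∊ e) →
    (∀ u x : V, u ∊ K → x ∊ s → ∃ u' : V, u' ∊ K ∧ ∀ t : V, t ∊ u' ↔ t ∊ u ∨ t = x) → s ∊ K

/-! ### Definable classes and closure of the sets of a model under composition -/

/-- `P` is first-order definable with parameters. -/
def Dfn {n : ℕ} (P : (Fin n → V) → Prop) : Prop := (Set.univ : Set V).Definable setLang {v | P v}

namespace Dfn

variable {n : ℕ} {P Q : (Fin n → V) → Prop}

theorem mem (i j : Fin n) : Dfn fun v : Fin n → V => v i ∊ v j := by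
  refine (Set.Definable.mono (A := ∅) ?_ (Set.empty_subset _))
  rw [Set.empty_definable_iff]
  refine ⟨FirstOrder.Language.Relations.formula₂ (L := setLang) SetLangRel.mem
    (FirstOrder.Language.Term.var i) (FirstOrder.Language.Term.var j), ?_⟩
  ext v
  refine Iff.symm ?_
  exact FirstOrder.Language.Formula.realize_rel₂ (L := setLang) (M := V)

theorem eq (i j : Fin n) : Dfn fun v : Fin n → V => v i = v j := by
  refine (Set.Definable.mono (A := ∅) ?_ (Set.empty_subset _))
  rw [Set.empty_definable_iff]
  refine ⟨(FirstOrder.Language.Term.var i).equal (FirstOrder.Language.Term.var j), ?_⟩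
  ext v
  simp

theorem eq_const (i : Fin n) (c : V) : Dfn fun v : Fin n → V => v i = c :=
  (Set.Definable.singleton_of_mem (L := setLang) (Set.mem_univ c)).preimage_comp
    (fun _ : Fin 1 => i)

theorem not (h : Dfn P) : Dfn fun v => ¬ P v := Set.Definable.compl h

theorem and (h : Dfn P) (h' : Dfn Q) : Dfn fun v => P v ∧ Q v := Set.Definable.inter h h'

theorem or (h : Dfn P) (h' : Dfn Q) : Dfn fun v => P v ∨ Q v := Set.Definable.union h h'

theorem imp (h : Dfn P) (h' : Dfn Q) : Dfn fun v => P v → Q v := by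
  simpa only [imp_iff_not_or] using h.not.or h'

theorem iff (h : Dfn P) (h' : Dfn Q) : Dfn fun v => P v ↔ Q v := by
  simpa only [iff_iff_implies_and_implies] using (h.imp h').and (h'.imp h)

theorem ex {P : (Fin n → V) → V → Prop}
    (h : Dfn fun v : Fin (n + 1) → V => P (fun i => v i.castSucc) (v (Fin.last n))) :
    Dfn fun v => ∃ x, P v x := by
  have h1 := Set.Definable.image_comp h (Fin.castSucc : Fin n → Fin (n + 1))
  refine (congrArg (Set.Definable Set.univ setLang) (Set.ext fun v => ?_)).mp h1
  constructor
  · rintro ⟨w, hw, rfl⟩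
    exact ⟨_, hw⟩
  · rintro ⟨x, hx⟩
    refine ⟨Fin.snoc v x, ?_, ?_⟩
    · simpa using hx
    · ext i
      simp

theorem all {P : (Fin n → V) → V → Prop}
    (h : Dfn fun v : Fin (n + 1) → V => P (fun i => v i.castSucc) (v (Fin.last n))) :
    Dfn fun v => ∀ x, P v x := by
  have := (ex (P := fun v x => ¬ P v x) h.not).not
  simpa only [not_exists, not_not] using this

theorem mem_const (i : Fin n) (c : V) : Dfn fun v : Fin n → V => v i ∊ c := by
  have : Dfn fun v : Fin n → V => ∃ x, x = c ∧ v i ∊ x := ex ((eq_const _ c).and (mem _ _))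
  simpa using this

theorem isPair (i j k : Fin n) : Dfn fun v : Fin n → V => IsPair (v i) (v j) (v k) :=
  all ((mem _ _).iff ((all ((mem _ _).iff (eq _ _))).or
    (all ((mem _ _).iff ((eq _ _).or (eq _ _))))))

end Dfn

variable [IsZFModel V]

theorem exists_isPair (x y : V) : ∃ p : V, IsPair p x y := by
  obtain ⟨a, ha⟩ := IsZFModel.pairing x x
  obtain ⟨b, hb⟩ := IsZFModel.pairing x y
  obtain ⟨p, hp⟩ := IsZFModel.pairing a b
  refine ⟨p, fun z => (hp z).trans (or_congr ⟨?_, fun h => ?_⟩ ⟨?_, fun h => ?_⟩)⟩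
  · rintro rfl t
    simpa using ha t
  · exact IsZFModel.extensionality _ _ fun t => by rw [h, ha]; simp
  · rintro rfl t
    exact hb t
  · exact IsZFModel.extensionality _ _ fun t => by rw [h, hb]

theorem IsPair.inj {p x y x' y' : V} (h : IsPair p x y) (h' : IsPair p x' y') :
    x = x' ∧ y = y' := by
  obtain ⟨a, ha⟩ := IsZFModel.pairing x x
  obtain ⟨b, hb⟩ := IsZFModel.pairing x y
  obtain ⟨b', hb'⟩ := IsZFModel.pairing x' y'
  have h1 := (h' a).1 ((h a).2 (.inl fun t => by simpa using ha t))
  have h2 := (h' b).1 ((h b).2 (.inr hb))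
  have h4 := (h b').1 ((h' b').2 (.inr hb'))
  simp only [ha, hb, hb', or_self] at h1 h2 h4
  obtain rfl : x = x' := by
    rcases h1 with h1 | h1
    · exact ((h1 x').2 rfl).symm
    · exact ((h1 x').2 (.inl rfl)).symm
  refine ⟨rfl, ?_⟩
  rcases h2 with h2 | h2 <;> rcases h4 with h4 | h4 <;>
    have e2 := h2 y <;> have e4 := h4 y' <;> grind

/-- A definable relation between the elements of two sets is a set of the model. -/
theorem isSetRel₂_of_dfn {P : V → V → Prop} (hP : Dfn fun v : Fin 2 → V => P (v 0) (v 1))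
    (a b : V) : IsSetRel₂ fun (x : El a) (y : El b) => P x.1 y.1 := by
  obtain ⟨ab, hab⟩ := IsZFModel.pairing a b
  obtain ⟨c, hc⟩ := IsZFModel.union ab
  obtain ⟨d, hd⟩ := IsZFModel.powerset c
  obtain ⟨m, hm⟩ := IsZFModel.powerset d
  have hD : Dfn fun v : Fin 1 → V => ∃ x y, IsPair (v 0) x y ∧ P x y :=
    Dfn.ex (Dfn.ex ((Dfn.isPair _ _ _).and
      (Set.Definable.preimage_comp (![1, 2] : Fin 2 → Fin 3) hP)))
  obtain ⟨r, hr⟩ := IsZFModel.separation {p : V | ∃ x y, IsPair p x y ∧ P x y} hD m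
  refine ⟨r, fun x y => ⟨fun h => ?_, ?_⟩⟩
  · obtain ⟨p, hp⟩ := exists_isPair x.1 y.1
    refine ⟨p, hp, (hr p).2 ⟨(hm p).2 fun s hs => (hd s).2 fun t ht => (hc t).2 ?_, _, _, hp, h⟩⟩
    rcases (hp s).1 hs with h1 | h1
    · exact ⟨a, (h1 t).1 ht ▸ x.2, (hab a).2 (.inl rfl)⟩
    · rcases (h1 t).1 ht with rfl | rfl
      · exact ⟨a, x.2, (hab a).2 (.inl rfl)⟩
      · exact ⟨b, y.2, (hab b).2 (.inr rfl)⟩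
  · rintro ⟨p, hp, hpr⟩
    obtain ⟨-, x', y', hp', h⟩ := (hr p).1 hpr
    obtain ⟨h1, h2⟩ := hp.inj hp'
    rw [h1, h2]
    exact h

theorem isSetFun_id (a : V) : IsSetFun (id : El a → El a) := by
  obtain ⟨r, hr⟩ := isSetRel₂_of_dfn (P := fun x y : V => x = y) (Dfn.eq _ _) a a
  exact ⟨r, fun x y => (Subtype.ext_iff.trans Iff.rfl).trans (hr x y)⟩

theorem IsSetFun.comp {a b c : V} {f : El a → El b} {g : El b → El c} (hf : IsSetFun f)
    (hg : IsSetFun g) : IsSetFun (g ∘ f) := by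
  obtain ⟨r, hr⟩ := hf
  obtain ⟨s, hs⟩ := hg
  obtain ⟨t, ht⟩ := isSetRel₂_of_dfn (P := fun x z : V => ∃ y, y ∊ b ∧
    (∃ p, IsPair p x y ∧ p ∊ r) ∧ ∃ p, IsPair p y z ∧ p ∊ s)
    (Dfn.ex ((Dfn.mem_const _ _).and ((Dfn.ex ((Dfn.isPair _ _ _).and (Dfn.mem_const _ _))).and
      (Dfn.ex ((Dfn.isPair _ _ _).and (Dfn.mem_const _ _)))))) a c
  refine ⟨t, fun x z => Iff.trans ?_ (ht x z)⟩
  constructor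
  · rintro rfl
    exact ⟨(f x).1, (f x).2, (hr x _).1 rfl, (hs _ _).1 rfl⟩
  · rintro ⟨y, hy, h1, h2⟩
    have e1 := (hr x ⟨y, hy⟩).2 h1
    have e2 := (hs ⟨y, hy⟩ z).2 h2
    rw [Function.comp_apply, e1, e2]

end Model

/-! ## The categories `COL` and `CUVO` inside a model of ZF -/

section ModelCategories

variable {V : Type w} [setLang.Structure V]

/-- A cylindric ortholattice in the sense of the model `V`, of dimension `I ∈ V`: a set of the
model with operations that are sets of the model. -/
structure VCOL (I : V) where
  carrier : V
  [ortholattice : Ortholattice (El carrier)]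
  [cylindric : CylindricOrtholattice (El I) (El carrier)]
  isSet_inf : IsSetFun₂ fun a b : El carrier => a ⊓ b
  isSet_sup : IsSetFun₂ fun a b : El carrier => a ⊔ b
  isSet_compl : IsSetFun fun a : El carrier => aᶜ
  isSet_ex : IsSetFun₂ fun (i : El I) (a : El carrier) => ex i a
  isSet_diag : IsSetFun₂ fun i k : El I => (diag i k : El carrier)

attribute [instance] VCOL.ortholattice VCOL.cylindric

/-- The homomorphisms that are sets of the model. -/
instance VCOL.instCategory [IsZFModel V] (I : V) : Category (VCOL I) where
  Hom A B := {h : CylHom (El I) (El A.carrier) (El B.carrier) // IsSetFun (fun a => h a)}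
  id A := ⟨CylHom.id _ _, isSetFun_id A.carrier⟩
  comp h g := ⟨h.1.comp g.1, IsSetFun.comp (f := fun a => h.1 a) (g := fun b => g.1 b) h.2 g.2⟩

section VSpace

variable (c top : V)

/-- Open sets with respect to `top ∈ V`, a set of subsets of `c`. -/
def VIsOpen (U : Set (El c)) : Prop := U ∈ traceFamily c top

/-- `top` is a topology on `c` in the sense of the model. -/
structure VIsTopology : Prop where
  subset : ∀ u : V, u ∊ top → ∀ x : V, x ∊ u → x ∊ c
  univ : VIsOpen c top Set.univ
  inter : ∀ U W, VIsOpen c top U → VIsOpen c top W → VIsOpen c top (U ∩ W)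
  sUnion : ∀ t : V, (∀ u : V, u ∊ t → u ∊ top) → VIsOpen c top (⋃₀ traceFamily c t)

/-- Compactness in the sense of the model. -/
def VIsCompact (U : Set (El c)) : Prop :=
  ∀ t : V, (∀ u : V, u ∊ t → u ∊ top) → U ⊆ ⋃₀ traceFamily c t →
    ∃ s : V, (∀ u : V, u ∊ s → u ∊ t) ∧ VFinite s ∧ U ⊆ ⋃₀ traceFamily c s

/-- `CO(X)` in the sense of the model. -/
def VCO : Set (Set (El c)) := {U | VIsCompact c top U ∧ VIsOpen c top U}

/-- `COB(X)` in the sense of the model. -/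
def VCOB (perp : El c → El c → Prop) : Set (Set (El c)) := {U | U ∈ VCO c top ∧ IsBiorth perp U}

/-- Upper Vietoris orthospaces in the sense of the model. -/
structure VIsUVOSpace (perp : El c → El c → Prop) : Prop extends IsOrthoframe perp where
  isTopology : VIsTopology c top
  t0 : ∀ x y : El c, x ≠ y → ∃ U, VIsOpen c top U ∧ ¬ (x ∈ U ↔ y ∈ U)
  basis : ∀ U, VIsOpen c top U → ∀ x ∈ U, ∃ W ∈ VCOB c top perp, x ∈ W ∧ W ⊆ U
  inter_mem : ∀ U W, U ∈ VCOB c top perp → W ∈ VCOB c top perp → U ∩ W ∈ VCOB c top perp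
  orth_mem : ∀ U, U ∈ VCOB c top perp → orth perp U ∈ VCOB c top perp
  filter : ∀ F : V, IsProperFilterIn (VCOB c top perp) (traceFamily c F) →
    ∃ x : El c, traceFamily c F = {U | U ∈ VCOB c top perp ∧ x ∈ U}
  perp_sep : ∀ x y, perp x y → ∃ U ∈ VCOB c top perp, x ∈ U ∧ y ∈ orth perp U

/-- Monadic UVO-spaces in the sense of the model. -/
structure VIsMonadicUVOSpace (perp R : El c → El c → Prop) : Prop
    extends VIsUVOSpace c top perp, IsMonadicOrthoframe perp R where
  image_mem : ∀ U, U ∈ VCOB c top perp → relImage R U ∈ VCOB c top perp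
  rel_sep : ∀ x y, ¬ R x y → ∃ U ∈ VCOB c top perp,
    (∃ W ∈ VCOB c top perp, x ∈ W ∧ U = orth perp (orth perp (relImage R W))) ∧ y ∉ U

/-- Cylindric UVO-spaces in the sense of the model. -/
structure VIsCylindricUVOSpace {I : V} (perp : El c → El c → Prop)
    (R : El I → El c → El c → Prop) (Δ : El I → El I → Set (El c)) : Prop
    extends VIsUVOSpace c top perp, IsCylindricOrthoframe perp R Δ where
  monadicUVO : ∀ i, VIsMonadicUVOSpace c top perp (R i)
  diag_mem : ∀ i k, Δ i k ∈ VCO c top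

end VSpace

/-- A cylindric UVO-space in the sense of the model `V`, of dimension `I ∈ V`. -/
structure VCUVO (I : V) where
  carrier : V
  top : V
  perp : El carrier → El carrier → Prop
  R : El I → El carrier → El carrier → Prop
  Δ : El I → El I → Set (El carrier)
  isSet_perp : IsSetRel₂ perp
  isSet_R : IsSetRel₃ R
  isSet_Δ : IsSetRel₃ fun i k x => x ∈ Δ i k
  isCylindric : VIsCylindricUVOSpace carrier top perp R Δ

/-- Cylindric UVO-maps in the sense of the model. -/
structure VIsCUVOMap {I : V} (X Y : VCUVO I) (f : El X.carrier → El Y.carrier) : Prop where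
  isSet : IsSetFun f
  spectral : ∀ U, U ∈ VCO Y.carrier Y.top → f ⁻¹' U ∈ VCO X.carrier X.top
  nonperp : ∀ x y, ¬ X.perp x y → ¬ Y.perp (f x) (f y)
  lift : ∀ z y, ¬ Y.perp z (f y) →
    ∃ x, ¬ X.perp x y ∧ ∀ U, VIsOpen Y.carrier Y.top U → z ∈ U → f x ∈ U
  image : ∀ i U, U ∈ VCOB Y.carrier Y.top Y.perp →
    relImage (X.R i) (f ⁻¹' U) = f ⁻¹' relImage (Y.R i) U
  diag : ∀ i k, f ⁻¹' Y.Δ i k = X.Δ i k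

theorem VIsCUVOMap.preimage_mem {I : V} {X Y : VCUVO I} {f : El X.carrier → El Y.carrier}
    (hf : VIsCUVOMap X Y f) {U : Set (El Y.carrier)} (hU : U ∈ VCOB Y.carrier Y.top Y.perp) :
    f ⁻¹' U ∈ VCOB X.carrier X.top X.perp := by
  have key : ∀ W, W ∈ VCOB Y.carrier Y.top Y.perp →
      f ⁻¹' orth Y.perp W = orth X.perp (f ⁻¹' W) := fun W hW =>
    preimage_orth (le := fun z w => ∀ U, VIsOpen Y.carrier Y.top U → z ∈ U → w ∈ U)
      X.isCylindric.toIsOrthoframe Y.isCylindric.toIsOrthoframe hf.nonperp hf.lift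
      (fun z w h => h W hW.1.2)
  refine ⟨hf.spectral U hU.1, ?_⟩
  rw [IsBiorth, ← key U hU, ← key _ (Y.isCylindric.orth_mem U hU), hU.2]

variable [IsZFModel V]

theorem VIsCUVOMap.id {I : V} (X : VCUVO I) : VIsCUVOMap X X id :=
  ⟨isSetFun_id _, fun _ h => h, fun _ _ h => h, fun z _ h => ⟨z, h, fun _ _ h => h⟩,
    fun _ _ _ => rfl, fun _ _ => rfl⟩

theorem VIsCUVOMap.comp {I : V} {X Y Z : VCUVO I} {f : El X.carrier → El Y.carrier}
    {g : El Y.carrier → El Z.carrier} (hf : VIsCUVOMap X Y f) (hg : VIsCUVOMap Y Z g) :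
    VIsCUVOMap X Z (g ∘ f) where
  isSet := hf.isSet.comp hg.isSet
  spectral U hU := hf.spectral _ (hg.spectral U hU)
  nonperp x y h := hg.nonperp _ _ (hf.nonperp x y h)
  lift z y h := by
    obtain ⟨x', hx', hz⟩ := hg.lift z (f y) h
    obtain ⟨x, hx, hx''⟩ := hf.lift x' y hx'
    refine ⟨x, hx, fun U hU hzU => ?_⟩
    obtain ⟨W, hW, hzW, hWU⟩ := Z.isCylindric.basis U hU z hzU
    exact hWU (hx'' _ (hg.spectral W hW.1).2 (hz W hW.1.2 hzW))
  image i U hU := by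
    rw [Set.preimage_comp, hf.image i _ (hg.preimage_mem hU), hg.image i U hU]
    rfl
  diag i k := by rw [Set.preimage_comp, hg.diag, hf.diag]

instance VCUVO.instCategory (I : V) : Category (VCUVO I) where
  Hom X Y := {f : El X.carrier → El Y.carrier // VIsCUVOMap X Y f}
  id X := ⟨id, VIsCUVOMap.id X⟩
  comp f g := ⟨g.1 ∘ f.1, f.2.comp g.2⟩

/-- `X` is the spectrum `S₀(A)`, formed in the model: its points are the proper filters of `A`
that are sets of the model, and its topology is generated by the sets `{x | a ∈ x}`. -/
structure VIsSpectrum {I : V} (A : VCOL I) (X : VCUVO I) : Prop where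
  carrier : ∀ x : V, x ∊ X.carrier ↔
    (∀ a : V, a ∊ x → a ∊ A.carrier) ∧ IsProperFilter (trace A.carrier x)
  perp : ∀ x y, X.perp x y ↔ ∃ a ∈ trace A.carrier x.1, aᶜ ∈ trace A.carrier y.1
  R : ∀ i x y, X.R i x y ↔ ∀ a ∈ trace A.carrier x.1, ex i a ∈ trace A.carrier y.1
  Δ : ∀ i k, X.Δ i k = {x | diag i k ∈ trace A.carrier x.1}
  top : ∀ u : V, u ∊ X.top ↔ (∀ x : V, x ∊ u → x ∊ X.carrier) ∧
    ∀ x ∈ trace X.carrier u, ∃ a ∈ trace A.carrier x.1,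
      {y | a ∈ trace A.carrier y.1} ⊆ trace X.carrier u

/-- `A` is the algebra `A₀(X)`, formed in the model: its elements are the compact open
biorthogonally closed sets of `X`. -/
structure VIsCOBAlgebra {I : V} (X : VCUVO I) (A : VCOL I) : Prop where
  carrier : ∀ u : V, u ∊ A.carrier ↔
    (∀ x : V, x ∊ u → x ∊ X.carrier) ∧ trace X.carrier u ∈ VCOB X.carrier X.top X.perp
  inf : ∀ a b : El A.carrier,
    trace X.carrier (a ⊓ b).1 = trace X.carrier a.1 ∩ trace X.carrier b.1
  sup : ∀ a b : El A.carrier, trace X.carrier (a ⊔ b).1 =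
    orth X.perp (orth X.perp (trace X.carrier a.1 ∪ trace X.carrier b.1))
  compl : ∀ a : El A.carrier, trace X.carrier aᶜ.1 = orth X.perp (trace X.carrier a.1)
  bot : trace X.carrier (⊥ : El A.carrier).1 = ∅
  top : trace X.carrier (⊤ : El A.carrier).1 = Set.univ
  ex : ∀ (i : El I) (a : El A.carrier), trace X.carrier (ex i a).1 =
    orth X.perp (orth X.perp (relImage (X.R i) (trace X.carrier a.1)))
  diag : ∀ i k : El I, trace X.carrier (diag i k : El A.carrier).1 = X.Δ i k

end ModelCategories

/-- Contravariant functors `S` and `A` that are mutually quasi-inverse. -/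
def IsDualEquivalence {C : Type*} {D : Type*} [Category C] [Category D]
    (S : Cᵒᵖ ⥤ D) (A : Dᵒᵖ ⥤ C) : Prop :=
  ∃ e : Cᵒᵖ ≌ D, e.functor = S ∧ e.inverse = A.rightOp

/-!
For `a ≠ 0`, an open set of filters contains the principal filter of `a` iff it contains all of
`φ a`. So `φ` reflects the order and each `φ a` is compact. A compact open set is a finite union of
sets `φ a_j`, and its biorthogonal closure is `φ (⋁ a_j)`. Hence `φ` maps `A` onto `COB(S₀(A))`. On
the other side `ψ` is injective because `COB(X)` is a basis of a `T₀` space, and surjective because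
every proper filter of `COB(X)` is the filter of a point. The separation conditions on `⊥` and `R`
make it an isomorphism.

Since the spectrum consists of all proper filters, no prime filter theorem is needed: every filter
that occurs is principal, or is obtained from given ones by an explicit first-order formula. In a
model `V` of ZF the same argument therefore applies to the external structures carried by the
elements of `V`, once the filters, sets and relations that occur are seen to be definable with
parameters, so that Separation turns them into elements of `V`. The induction on finite covers is
carried out inside `V`, whose finite sets may be nonstandard.
-/

/-! ## Dual equivalences from natural isomorphisms -/

theorem isDualEquivalence_of_natIso {C : Type*} {D : Type*} [Category C] [Category D]
    {S : Cᵒᵖ ⥤ D} {A : Dᵒᵖ ⥤ C} (η : 𝟭 C ≅ S.rightOp ⋙ A) (θ : 𝟭 D ≅ A.rightOp ⋙ S) :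
    IsDualEquivalence S A := by
  let unit : 𝟭 Cᵒᵖ ≅ S ⋙ A.rightOp :=
    NatIso.ofComponents (fun X => (η.app X.unop).op.symm) fun {X Y} f =>
      Quiver.Hom.unop_inj (η.inv.naturality f.unop).symm
  exact ⟨CategoryTheory.Equivalence.mk S A.rightOp unit θ.symm, rfl, rfl⟩

namespace CylHom

variable {I : Type u} {A B : Type*} [Ortholattice A] [Ortholattice B]
  [CylindricOrtholattice I A] [CylindricOrtholattice I B]

theorem ext_toFun {h g : CylHom I A B} (H : ∀ a, h.toFun a = g.toFun a) : h = g :=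
  DFunLike.coe_injective (funext H)

/-- The inverse of a bijective homomorphism. -/
def symm (h : CylHom I A B) (e : A ≃ B) (he : ∀ a, e a = h.toFun a) : CylHom I B A where
  toFun := e.symm
  map_sup' a b := by rw [Equiv.symm_apply_eq, he, h.map_sup', ← he, ← he]; simp
  map_inf' a b := by rw [Equiv.symm_apply_eq, he, h.map_inf', ← he, ← he]; simp
  map_top' := by rw [Equiv.symm_apply_eq, he, h.map_top']
  map_bot' := by rw [Equiv.symm_apply_eq, he, h.map_bot']
  map_compl' a := by rw [Equiv.symm_apply_eq, he, h.map_compl', ← he]; simp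
  map_ex' i a := by rw [Equiv.symm_apply_eq, he, h.map_ex', ← he]; simp
  map_diag' i k := by rw [Equiv.symm_apply_eq, he, h.map_diag']

end CylHom

/-! ## Families of proper filters -/

section FilterFamily

variable {I : Type u} {A : Type v} {X : Type w} [Ortholattice A]

theorem specPerp.mono {x x' y y' : ProperFilter A} (h : specPerp A x y) (hx : x.1 ⊆ x'.1)
    (hy : y.1 ⊆ y'.1) : specPerp A x' y' :=
  let ⟨a, ha, ha'⟩ := h
  ⟨a, hx ha, hy ha'⟩

theorem IsOrthoframe.invImage {Y : Type*} {perp : Y → Y → Prop} (h : IsOrthoframe perp)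
    (f : X → Y) : IsOrthoframe (InvImage perp f) :=
  ⟨fun x => h.irrefl (f x), fun x y => h.symm (f x) (f y)⟩

theorem mem_relImage_singleton {R : X → X → Prop} {x y : X} :
    y ∈ relImage R {x} ↔ R x y := by
  simp only [relImage, Set.mem_singleton_iff, exists_eq_left, Set.mem_ofPred_eq]

/-- The family `pt` contains all principal filters. Together with `IsClosedUnderEx`, this is what
the representation of an algebra by its filters requires of a family of filters: the filters that
belong to a model of ZF have both properties although they need not be all filters. -/
def HasPrincipalFilters (pt : X → ProperFilter A) : Prop :=
  ∀ a : A, a ≠ ⊥ → ∃ x, (pt x).1 = Set.Ici a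

variable {pt : X → ProperFilter A}

theorem preimage_phi_bot : pt ⁻¹' phi ⊥ = ∅ := by rw [phi_bot, Set.preimage_empty]

theorem preimage_phi_top : pt ⁻¹' phi ⊤ = Set.univ := by rw [phi_top, Set.preimage_univ]

theorem preimage_phi_inf (a b : A) : pt ⁻¹' phi (a ⊓ b) = pt ⁻¹' phi a ∩ pt ⁻¹' phi b := by
  rw [phi_inf, Set.preimage_inter]

namespace HasPrincipalFilters

variable (hpt : HasPrincipalFilters pt)
include hpt

theorem preimage_phi_subset {a b : A} : pt ⁻¹' phi a ⊆ pt ⁻¹' phi b ↔ a ≤ b := by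
  refine ⟨fun h => ?_, fun h => Set.preimage_mono (phi_subset.2 h)⟩
  by_cases ha : a = ⊥
  · exact ha.trans_le bot_le
  · obtain ⟨x, hx⟩ := hpt a ha
    have hxb : x ∈ pt ⁻¹' phi b := h (hx.ge le_rfl)
    exact hx.le hxb

theorem preimage_phi_injective : Function.Injective fun a : A => pt ⁻¹' phi a := fun _ _ h =>
  le_antisymm (hpt.preimage_phi_subset.1 h.le) (hpt.preimage_phi_subset.1 h.ge)

theorem orth_preimage_phi (a : A) :
    orth (InvImage (specPerp A) pt) (pt ⁻¹' phi a) = pt ⁻¹' phi aᶜ := by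
  refine Set.Subset.antisymm (fun x hx => ?_) fun x hx y hy => (orth_phi a).ge hx _ hy
  by_cases ha : a = ⊥
  · rw [ha, Ortholattice.compl_bot, preimage_phi_top]
    trivial
  · obtain ⟨y, hy⟩ := hpt a ha
    refine (orth_phi a).le fun z hz => (hx y (hy.ge le_rfl)).mono subset_rfl ?_
    exact hy.le.trans fun b hb => z.2.upward a b hz hb

theorem isBiorth_preimage_phi (a : A) : IsBiorth (InvImage (specPerp A) pt) (pt ⁻¹' phi a) := by
  rw [IsBiorth, hpt.orth_preimage_phi, hpt.orth_preimage_phi, Ortholattice.compl_compl]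

theorem orth_preimage_phi_union (a b : A) :
    orth (InvImage (specPerp A) pt) (pt ⁻¹' phi a ∪ pt ⁻¹' phi b) = pt ⁻¹' phi (a ⊔ b)ᶜ := by
  rw [orth_union, hpt.orth_preimage_phi, hpt.orth_preimage_phi, ← preimage_phi_inf,
    ← Ortholattice.compl_sup]

theorem orth_orth_preimage_phi_union (a b : A) :
    orth (InvImage (specPerp A) pt)
      (orth (InvImage (specPerp A) pt) (pt ⁻¹' phi a ∪ pt ⁻¹' phi b)) = pt ⁻¹' phi (a ⊔ b) := by
  rw [hpt.orth_preimage_phi_union, hpt.orth_preimage_phi, Ortholattice.compl_compl]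

end HasPrincipalFilters

variable [CylindricOrtholattice I A]

theorem specR.anti {i : I} {x x' y : ProperFilter A} (h : specR I A i x y) (hx : x'.1 ⊆ x.1) :
    specR I A i x' y :=
  (Set.image_mono hx).trans h

theorem specR_exFilter (i : I) (x : ProperFilter A) : specR I A i x (exFilter i x) := by
  rintro _ ⟨a, ha, rfl⟩
  exact ⟨a, ha, le_rfl⟩

theorem exFilter_subset {i : I} {x y : ProperFilter A} (h : specR I A i x y) :
    (exFilter i x).1 ⊆ y.1 := by
  rintro b ⟨a, ha, hab⟩
  exact y.2.upward _ b (h ⟨a, ha, rfl⟩) hab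

variable (I) in
/-- With every filter `x`, the family `pt` contains the filters generated by the `∃_i[x]`. -/
def IsClosedUnderEx (pt : X → ProperFilter A) : Prop :=
  ∀ (i : I) (x : X), ∃ y, pt y = exFilter i (pt x)

theorem HasPrincipalFilters.relImage_preimage_phi (hpt : HasPrincipalFilters pt) (i : I) (a : A) :
    relImage (InvImage (specR I A i) pt) (pt ⁻¹' phi a) = pt ⁻¹' phi (ex i a) := by
  refine Set.Subset.antisymm ?_ fun y hy => ?_
  · rintro y ⟨x, hx, hxy⟩
    exact (relImage_phi i a).le ⟨pt x, hx, hxy⟩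
  · have ⟨z, hz, hzy⟩ := (relImage_phi i a).ge hy
    have ha : a ≠ ⊥ := fun h => z.2.bot_notMem (h ▸ hz)
    obtain ⟨x, hx⟩ := hpt a ha
    exact ⟨x, hx.ge le_rfl, hzy.anti (hx.le.trans fun b hb => z.2.upward a b hz hb)⟩

namespace IsClosedUnderEx

variable (hpt : IsClosedUnderEx I pt)
include hpt

theorem comm {i k : I} {x z : X}
    (h : ∃ y, InvImage (specR I A i) pt x y ∧ InvImage (specR I A k) pt y z) :
    ∃ y, InvImage (specR I A k) pt x y ∧ InvImage (specR I A i) pt y z := by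
  obtain ⟨y, hxy, hyz⟩ := h
  obtain ⟨y', hxy', hyz'⟩ := spec_comm_aux i k _ _ ⟨pt y, hxy, hyz⟩
  obtain ⟨g, hg⟩ := hpt k x
  have hxg : specR I A k (pt x) (pt g) := hg ▸ specR_exFilter k (pt x)
  exact ⟨g, hxg, hyz'.anti (hg ▸ exFilter_subset hxy')⟩

theorem isMonadicOrthoframe (i : I) :
    IsMonadicOrthoframe (InvImage (specPerp A) pt) (InvImage (specR I A i) pt) where
  toIsOrthoframe := isOrthoframe_spec.invImage pt
  refl x := (isMonadicOrthoframe_spec i).refl (pt x)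
  trans x y z := (isMonadicOrthoframe_spec i).trans (pt x) (pt y) (pt z)
  image_orth x := by
    rintro y ⟨t, ht, hty⟩ z hz
    obtain ⟨g, hg⟩ := hpt i x
    have hxg : specR I A i (pt x) (pt g) := hg ▸ specR_exFilter i (pt x)
    have htg : specPerp A (pt t) (exFilter i (pt x)) := hg ▸ ht g (mem_relImage_singleton.2 hxg)
    have hxz : specR I A i (pt x) (pt z) := (mem_relImage_singleton (x := x)).1 hz
    refine (isMonadicOrthoframe_spec i).image_orth (pt x) ⟨pt t, fun z' hz' => ?_, hty⟩ (pt z)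
      (mem_relImage_singleton.2 hxz)
    exact htg.mono subset_rfl (exFilter_subset (mem_relImage_singleton.1 hz'))

theorem isCylindricOrthoframe (hpr : HasPrincipalFilters pt) :
    IsCylindricOrthoframe (InvImage (specPerp A) pt) (fun i : I => InvImage (specR I A i) pt)
      fun i k => pt ⁻¹' specDiag I A i k where
  toIsOrthoframe := isOrthoframe_spec.invImage pt
  monadic := hpt.isMonadicOrthoframe
  comm _ _ _ _ := ⟨hpt.comm, hpt.comm⟩
  diag_symm i k := congrArg (pt ⁻¹' phi ·) (CylindricOrtholattice.diag_symm i k)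
  diag_biorth i k := hpr.isBiorth_preimage_phi (diag i k)
  diag_self i := by rw [specDiag, CylindricOrtholattice.diag_self, preimage_phi_top]
  image_diag i k l h h' := by
    rw [specDiag, specDiag, ← preimage_phi_inf, hpr.relImage_preimage_phi,
      CylindricOrtholattice.ex_diag i k l h h', specDiag]

end IsClosedUnderEx

end FilterFamily

/-! ## Transport of filters -/

section FilterTransport

variable {A : Type v} {X : Type w} [Ortholattice A] {s : A → Set X} {B : Set (Set X)}

theorem IsProperFilterIn.isProperFilter_preimage {𝓕 : Set (Set X)} (h : IsProperFilterIn B 𝓕)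
    (range_eq : Set.range s = B) (s_mono : Monotone s) (s_inf : ∀ a b, s (a ⊓ b) = s a ∩ s b) :
    IsProperFilter (s ⁻¹' 𝓕) where
  nonempty := by
    obtain ⟨U, hU⟩ := h.nonempty
    obtain ⟨a, rfl⟩ := range_eq.ge (h.subset hU)
    exact ⟨a, hU⟩
  upward a b ha hab := h.upward _ _ ha (range_eq ▸ ⟨b, rfl⟩) (s_mono hab)
  inf_mem a b ha hb := by
    rw [Set.mem_preimage, s_inf]
    exact h.inter_mem _ _ ha hb
  proper hA := h.proper <| Set.Subset.antisymm h.subset <| range_eq ▸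
    Set.range_subset_iff.2 fun a => hA.ge (Set.mem_univ a)

theorem IsProperFilter.isProperFilterIn_image {y : Set A} (h : IsProperFilter y)
    (range_eq : Set.range s = B) (le_of_subset : ∀ a b, s a ⊆ s b → a ≤ b)
    (s_inf : ∀ a b, s (a ⊓ b) = s a ∩ s b) : IsProperFilterIn B (s '' y) where
  subset := range_eq ▸ Set.image_subset_range s y
  nonempty := h.nonempty.image s
  upward := by
    rintro _ W ⟨a, ha, rfl⟩ hW hab
    obtain ⟨b, rfl⟩ := range_eq.ge hW
    exact ⟨b, h.upward a b ha (le_of_subset a b hab), rfl⟩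
  inter_mem := by
    rintro _ _ ⟨a, ha, rfl⟩ ⟨b, hb, rfl⟩
    exact ⟨a ⊓ b, h.inf_mem a b ha hb, s_inf a b⟩
  proper hB := h.bot_notMem <| by
    obtain ⟨a, ha, hab⟩ := hB.ge (range_eq ▸ Set.mem_range_self ⊥)
    exact h.upward a ⊥ ha (le_of_subset a ⊥ hab.le)

end FilterTransport

/-! ## Separation of points by a family of sets -/

section Separation

variable {X : Type v} {Y : Type w} {perp R : X → X → Prop} {B : Set (Set X)} {x y : X}

theorem perp_iff_exists_mem_orth (hp : IsOrthoframe perp)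
    (sep : perp x y → ∃ U ∈ B, x ∈ U ∧ y ∈ orth perp U) :
    perp x y ↔ ∃ U ∈ B, x ∈ U ∧ y ∈ orth perp U :=
  ⟨sep, fun ⟨_, _, hx, hy⟩ => hp.symm y x (hy x hx)⟩

theorem rel_iff_forall_mem_closure_relImage (hp : IsOrthoframe perp)
    (sep : ¬ R x y → ∃ U ∈ B, (∃ W ∈ B, x ∈ W ∧ U = orth perp (orth perp (relImage R W))) ∧ y ∉ U) :
    R x y ↔ ∀ W ∈ B, x ∈ W → y ∈ orth perp (orth perp (relImage R W)) := by
  refine ⟨fun h W _ hx => subset_orth_orth hp _ ⟨x, hx, h⟩, fun h => ?_⟩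
  by_contra hn
  obtain ⟨_, _, ⟨W, hW, hx, rfl⟩, hy⟩ := sep hn
  exact hy (h W hW hx)

theorem relImage_preimage_equiv {S : Y → Y → Prop} (e : X ≃ Y)
    (hR : ∀ x y, R x y ↔ S (e x) (e y)) (U : Set Y) :
    relImage R (e ⁻¹' U) = e ⁻¹' relImage S U := by
  ext y
  simp only [relImage, Set.mem_preimage, Set.mem_ofPred_eq, hR]
  exact e.surjective.exists (p := fun z => z ∈ U ∧ S z (e y)) |>.symm

end Separation

/-! ## The natural isomorphisms `φ` and `ψ` -/

section Unit

variable {I : Type u}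

theorem hasPrincipalFilters_id {A : Type v} [Ortholattice A] :
    HasPrincipalFilters (id : ProperFilter A → ProperFilter A) :=
  fun _ ha => ⟨⟨_, isProperFilter_Ici ha⟩, rfl⟩

/-- The homomorphism `φ : A → A₀(S₀(A))`. -/
def phiHom (A : COL.{u, v} I) : CylHom I A.carrier (A₀ (S₀ A)).carrier where
  toFun a := ⟨phi a, phi_mem_COB a⟩
  map_sup' a b := Subtype.ext (hasPrincipalFilters_id.orth_orth_preimage_phi_union a b).symm
  map_inf' a b := Subtype.ext (phi_inf a b)
  map_top' := Subtype.ext phi_top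
  map_bot' := Subtype.ext phi_bot
  map_compl' a := Subtype.ext (orth_phi a).symm
  map_ex' i a := Subtype.ext <| by
    change phi (ex i a) = orth (specPerp A.carrier) (orth (specPerp A.carrier)
      (relImage (specR I A.carrier i) (phi a)))
    rw [relImage_phi, isBiorth_phi]
  map_diag' i k := rfl

theorem phiHom_bijective (A : COL.{u, v} I) : Function.Bijective (phiHom A).toFun := by
  constructor
  · exact fun a b h => hasPrincipalFilters_id.preimage_phi_injective (congrArg Subtype.val h)
  · rintro ⟨U, hU⟩
    obtain ⟨a, rfl⟩ := COB_spec.le hU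
    exact ⟨a, rfl⟩

/-- `φ` as an isomorphism of cylindric ortholattices. -/
noncomputable def phiIso (A : COL.{u, v} I) : A ≅ A₀ (S₀ A) where
  hom := phiHom A
  inv := (phiHom A).symm (Equiv.ofBijective _ (phiHom_bijective A)) fun _ => rfl
  hom_inv_id := CylHom.ext_toFun fun a =>
    (Equiv.ofBijective _ (phiHom_bijective A)).symm_apply_apply a
  inv_hom_id := CylHom.ext_toFun fun a =>
    (Equiv.ofBijective _ (phiHom_bijective A)).apply_symm_apply a

/-- `φ` as a natural isomorphism. -/
noncomputable def phiNatIso (I : Type u) : 𝟭 (COL.{u, v} I) ≅ (S_F I).rightOp ⋙ A_F I :=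
  NatIso.ofComponents phiIso fun _ => rfl

theorem preimage_mem_CO_of_COB {Z : Type w} [TopologicalSpace Z] {Y : CUVO.{u, v} I}
    {f : Z → Y.carrier} (hf : ∀ U ∈ COB Y.perp, f ⁻¹' U ∈ CO Z) {U : Set Y.carrier}
    (hU : U ∈ CO Y.carrier) : f ⁻¹' U ∈ CO Z := by
  have hB : TopologicalSpace.IsTopologicalBasis
      (Set.range (Subtype.val : COB Y.perp → Set Y.carrier)) := by
    rw [Subtype.range_coe]
    exact Y.isCylindric.basis
  obtain ⟨s, hs, rfl⟩ := (isCompact_open_iff_eq_finite_iUnion_of_isTopologicalBasis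
    Subtype.val hB (fun W => W.2.1.1) U).1 hU
  rw [Set.preimage_iUnion₂]
  exact ⟨hs.isCompact_biUnion fun W _ => (hf W.1 W.2).1, isOpen_biUnion fun W _ => (hf W.1 W.2).2⟩

theorem isCUVOMap_of_equiv {X Y : CUVO.{u, v} I} (e : X.carrier ≃ Y.carrier)
    (hB : ∀ U ∈ COB Y.perp, e ⁻¹' U ∈ CO X.carrier)
    (hp : ∀ x y, X.perp x y ↔ Y.perp (e x) (e y))
    (hR : ∀ i x y, X.R i x y ↔ Y.R i (e x) (e y)) (hΔ : ∀ i k, e ⁻¹' Y.Δ i k = X.Δ i k) :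
    IsCUVOMap X Y e where
  spectral _ hU := preimage_mem_CO_of_COB hB hU
  nonperp x y := (not_congr (hp x y)).1
  lift z y h := ⟨e.symm z, by rwa [hp, e.apply_symm_apply], by simp⟩
  image i U _ := relImage_preimage_equiv e (hR i) U
  diag := hΔ

variable (X : CUVO.{u, v} I)

/-- `ψ x`, the filter of those `U ∈ COB(X)` that contain `x`. -/
def psi (x : X.carrier) : (S₀ (A₀ X)).carrier :=
  ⟨{U : {U // U ∈ COB X.perp} | x ∈ U.1},
    { nonempty := ⟨⟨Set.univ, X.univ_mem⟩, trivial⟩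
      upward := fun _ _ hU h => h hU
      inf_mem := fun _ _ hU hW => ⟨hU, hW⟩
      proper := fun h => (h.ge (Set.mem_univ ⟨∅, X.empty_mem⟩) : x ∈ (∅ : Set X.carrier)) }⟩

theorem psi_injective : Function.Injective (psi X) := by
  intro x y h
  have := X.isCylindric.t0
  refine X.isCylindric.basis.inseparable_iff.2 (fun U hU => ?_) |>.eq
  exact Set.ext_iff.1 (congrArg Subtype.val h) ⟨U, hU⟩

theorem psi_surjective : Function.Surjective (psi X) := by
  rintro ⟨y, hy⟩
  have hF : IsProperFilterIn (COB X.perp) (Subtype.val '' y) :=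
    hy.isProperFilterIn_image Subtype.range_coe (fun _ _ h => h) (fun _ _ => rfl)
  obtain ⟨x, hx⟩ := X.isCylindric.filter _ hF
  refine ⟨x, Subtype.ext (Set.ext fun U => ?_)⟩
  calc x ∈ U.1 ↔ U.1 ∈ {W | W ∈ COB X.perp ∧ x ∈ W} := (and_iff_right U.2).symm
    _ ↔ U.1 ∈ Subtype.val '' y := by rw [hx]
    _ ↔ U ∈ y := Subtype.val_injective.mem_set_image

/-- `ψ` as a bijection. -/
noncomputable def psiEquiv : X.carrier ≃ (S₀ (A₀ X)).carrier :=
  Equiv.ofBijective _ ⟨psi_injective X, psi_surjective X⟩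

theorem psi_perp (x y : X.carrier) :
    X.perp x y ↔ (S₀ (A₀ X)).perp (psiEquiv X x) (psiEquiv X y) :=
  (perp_iff_exists_mem_orth X.isCylindric.toIsOrthoframe (X.isCylindric.perp_sep x y)).trans
    ⟨fun ⟨U, hU, h⟩ => ⟨⟨U, hU⟩, h⟩, fun ⟨U, h⟩ => ⟨U.1, U.2, h⟩⟩

theorem psi_R (i : I) (x y : X.carrier) :
    X.R i x y ↔ (S₀ (A₀ X)).R i (psiEquiv X x) (psiEquiv X y) := by
  refine (rel_iff_forall_mem_closure_relImage X.isCylindric.toIsOrthoframe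
    ((X.isCylindric.monadicUVO i).rel_sep x y)).trans ⟨?_, fun h U hU hx => h ⟨⟨U, hU⟩, hx, rfl⟩⟩
  rintro h _ ⟨U, hx, rfl⟩
  exact h U.1 U.2 hx

theorem isCUVOMap_psi : IsCUVOMap X (S₀ (A₀ X)) (psiEquiv X) := by
  refine isCUVOMap_of_equiv _ (fun U hU => ?_) (psi_perp X) (psi_R X) fun _ _ => rfl
  obtain ⟨W, rfl⟩ := COB_spec.le hU
  exact W.2.1

theorem isCUVOMap_psi_symm : IsCUVOMap (S₀ (A₀ X)) X (psiEquiv X).symm := by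
  have hsymm (W : (A₀ X).carrier) : (psiEquiv X).symm ⁻¹' W.1 = phi W :=
    (psiEquiv X).symm_preimage_preimage (phi W)
  refine isCUVOMap_of_equiv _ (fun U hU => ?_) (fun x y => ?_) (fun i x y => ?_) fun i k => ?_
  · exact (hsymm ⟨U, hU⟩).symm ▸ phi_mem_CO (A := (A₀ X).carrier) ⟨U, hU⟩
  · rw [psi_perp X, Equiv.apply_symm_apply, Equiv.apply_symm_apply]
  · rw [psi_R X, Equiv.apply_symm_apply, Equiv.apply_symm_apply]
  · exact hsymm (diag i k)

/-- `ψ` as an isomorphism of cylindric UVO-spaces. -/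
noncomputable def psiIso : X ≅ S₀ (A₀ X) where
  hom := ⟨psiEquiv X, isCUVOMap_psi X⟩
  inv := ⟨(psiEquiv X).symm, isCUVOMap_psi_symm X⟩
  hom_inv_id := Subtype.ext (Equiv.symm_comp_self _)
  inv_hom_id := Subtype.ext (Equiv.self_comp_symm _)

/-- `ψ` as a natural isomorphism. -/
noncomputable def psiNatIso (I : Type u) : 𝟭 (CUVO.{u, v} I) ≅ (A_F I).rightOp ⋙ S_F I :=
  NatIso.ofComponents psiIso fun _ => rfl

end Unit

/-! ## Definable types, predicates and functions over a model -/

section Definability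

variable {V : Type w} [setLang.Structure V]

/-- A type whose elements are coded by the tuples in a definable class of the model `V`. Together
with `DefinablePred` and `DefinableFun` it lets instance search read off the definability of a
formula from its shape, with the bound variables ranging over such types. -/
class DefinableType (V : outParam (Type w)) [setLang.Structure V] (T : Type*) where
  ix : Type
  finite : Finite ix
  code : T → ix → V
  code_injective : Function.Injective code
  definable_range : (Set.univ : Set V).Definable setLang (Set.range code)

attribute [instance] DefinableType.finite

open DefinableType (ix code code_injective definable_range)

namespace DefinableType

instance self : DefinableType V V where
  ix := Unit
  finite := inferInstance
  code x _ := x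
  code_injective _ _ h := congrFun h ()
  definable_range := by
    convert Set.definable_univ
    exact Set.eq_univ_of_forall fun v => ⟨v (), rfl⟩

instance fin (n : ℕ) : DefinableType V (Fin n → V) where
  ix := Fin n
  finite := inferInstance
  code v := v
  code_injective := Function.injective_id
  definable_range := by
    convert Set.definable_univ
    exact Set.range_id

instance el (c : V) : DefinableType V (El c) where
  ix := Unit
  finite := inferInstance
  code x _ := x.1
  code_injective _ _ h := Subtype.ext (congrFun h ())
  definable_range := by
    convert (Dfn.mem_const (0 : Fin 1) c).preimage_comp fun _ => ()
    ext v
    exact ⟨fun ⟨x, hx⟩ => hx ▸ x.2, fun h => ⟨⟨v (), h⟩, rfl⟩⟩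

instance prod {T S : Type*} [DefinableType V T] [DefinableType V S] : DefinableType V (T × S) where
  ix := ix T ⊕ ix S
  finite := inferInstance
  code p := Sum.elim (code p.1) (code p.2)
  code_injective p q h := by
    obtain ⟨h₁, h₂⟩ := Sum.elim_eq_iff.1 h
    exact Prod.ext (code_injective h₁) (code_injective h₂)
  definable_range := by
    convert ((definable_range (T := T)).preimage_comp Sum.inl).inter
      ((definable_range (T := S)).preimage_comp Sum.inr)
    ext v
    constructor
    · rintro ⟨p, rfl⟩
      exact ⟨⟨p.1, rfl⟩, ⟨p.2, rfl⟩⟩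
    · rintro ⟨⟨t, ht⟩, ⟨s, hs⟩⟩
      exact ⟨(t, s), (congrArg₂ Sum.elim ht hs).trans (Sum.elim_comp_inl_inr v)⟩

end DefinableType

/-- The predicate `P` on a definable type is first-order definable with parameters. -/
class DefinablePred {T : Type*} [DefinableType V T] (P : T → Prop) : Prop where
  definable : (Set.univ : Set V).Definable setLang (code '' {t | P t})

/-- The graph of `f` is first-order definable with parameters. -/
class DefinableFun {T S : Type*} [DefinableType V T] [DefinableType V S] (f : T → S) : Prop where
  graph : DefinablePred fun p : T × S => f p.1 = p.2

/-- On codes, `r` only selects, permutes and repeats entries, so that substituting `r` into a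
formula amounts to renaming its free variables. -/
class IsReindexing {T S : Type*} [DefinableType V T] [DefinableType V S] (r : S → T) : Prop where
  exists_comp : ∃ ρ : ix T → ix S, ∀ s, code (r s) = code s ∘ ρ

section Calculus

variable {T S R : Type*} [DefinableType V T] [DefinableType V S] [DefinableType V R]

namespace IsReindexing

instance id : IsReindexing fun t : T => t := ⟨_root_.id, fun _ => rfl⟩

instance fst {r : T → S × R} [h : IsReindexing r] : IsReindexing fun t => (r t).1 := by
  obtain ⟨ρ, hρ⟩ := h
  exact ⟨ρ ∘ Sum.inl, fun t => funext fun i => congrFun (hρ t) (Sum.inl i)⟩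

instance snd {r : T → S × R} [h : IsReindexing r] : IsReindexing fun t => (r t).2 := by
  obtain ⟨ρ, hρ⟩ := h
  exact ⟨ρ ∘ Sum.inr, fun t => funext fun i => congrFun (hρ t) (Sum.inr i)⟩

theorem comp (r : S → R) [h : IsReindexing r] (r' : T → S) [h' : IsReindexing r'] :
    IsReindexing fun t => r (r' t) := by
  obtain ⟨ρ, hρ⟩ := h
  obtain ⟨ρ', hρ'⟩ := h'
  exact ⟨ρ' ∘ ρ, fun t => by rw [hρ, hρ']; rfl⟩

instance pair {r : T → S} {r' : T → R} [h : IsReindexing r] [h' : IsReindexing r'] :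
    IsReindexing fun t => (r t, r' t) := by
  obtain ⟨ρ, hρ⟩ := h
  obtain ⟨ρ', hρ'⟩ := h'
  refine ⟨Sum.elim ρ ρ', fun t => ?_⟩
  rw [Sum.comp_elim, ← hρ, ← hρ']
  rfl

instance val {c : V} : IsReindexing fun x : El c => x.1 := ⟨_root_.id, fun _ => rfl⟩

instance eval {n : ℕ} (i : Fin n) : IsReindexing fun v : Fin n → V => v i :=
  ⟨fun _ => i, fun _ => rfl⟩

instance vec₂ : IsReindexing fun p : V × V => ![p.1, p.2] :=
  ⟨![Sum.inl (), Sum.inr ()], fun _ => funext (Fin.forall_fin_two.2 ⟨rfl, rfl⟩)⟩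

end IsReindexing

theorem DefinablePred.dfn {n : ℕ} {P : (Fin n → V) → Prop} (h : DefinablePred P) : Dfn P := by
  have := h.definable
  rwa [show code = (id : (Fin n → V) → Fin n → V) from rfl, Set.image_id] at this

theorem Dfn.definablePred {n : ℕ} {P : (Fin n → V) → Prop} (h : Dfn P) : DefinablePred P :=
  ⟨by rwa [show code = (id : (Fin n → V) → Fin n → V) from rfl, Set.image_id]⟩

namespace DefinablePred

theorem congr {P Q : T → Prop} (h : DefinablePred P) (H : ∀ t, Q t ↔ P t) : DefinablePred Q := by
  rwa [show Q = P from funext fun t => propext (H t)]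

theorem comp_reindexing {P : T → Prop} (h : DefinablePred P) (r : S → T) [hr : IsReindexing r] :
    DefinablePred fun s => P (r s) := by
  obtain ⟨ρ, hρ⟩ := hr
  have image_eq : code '' {s : S | P (r s)} =
      Set.range code ∩ (fun v => v ∘ ρ) ⁻¹' (code '' {t | P t}) := by
    ext v
    constructor
    · rintro ⟨s, hs, rfl⟩
      exact ⟨⟨s, rfl⟩, ⟨r s, hs, hρ s⟩⟩
    · rintro ⟨⟨s, rfl⟩, hs⟩
      rw [Set.mem_preimage, ← hρ, code_injective.mem_set_image] at hs
      exact ⟨s, hs, rfl⟩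
  exact ⟨image_eq ▸ definable_range.inter (h.definable.preimage_comp ρ)⟩

instance not {P : T → Prop} [h : DefinablePred P] : DefinablePred fun t => ¬ P t := by
  have image_eq : code '' {t : T | ¬ P t} = Set.range code \ code '' {t | P t} :=
    (Set.range_sdiff_image code_injective _).symm
  exact ⟨image_eq ▸ definable_range.sdiff h.definable⟩

instance and {P Q : T → Prop} [h : DefinablePred P] [h' : DefinablePred Q] :
    DefinablePred fun t => P t ∧ Q t := by
  have image_eq : code '' {t : T | P t ∧ Q t} = code '' {t | P t} ∩ code '' {t | Q t} :=
    Set.image_inter code_injective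
  exact ⟨image_eq ▸ h.definable.inter h'.definable⟩

instance or {P Q : T → Prop} [h : DefinablePred P] [h' : DefinablePred Q] :
    DefinablePred fun t => P t ∨ Q t := by
  have image_eq : code '' {t : T | P t ∨ Q t} = code '' {t | P t} ∪ code '' {t | Q t} :=
    Set.image_union _ _ _
  exact ⟨image_eq ▸ h.definable.union h'.definable⟩

instance imp {P Q : T → Prop} [DefinablePred P] [DefinablePred Q] :
    DefinablePred fun t => P t → Q t :=
  (inferInstance : DefinablePred fun t => ¬ P t ∨ Q t).congr fun _ => imp_iff_not_or

instance iff {P Q : T → Prop} [DefinablePred P] [DefinablePred Q] :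
    DefinablePred fun t => P t ↔ Q t :=
  (inferInstance : DefinablePred fun t => (P t → Q t) ∧ (Q t → P t)).congr
    fun _ => iff_iff_implies_and_implies

theorem true : DefinablePred fun _ : T => True := by
  refine ⟨?_⟩
  rw [show {_t : T | True} = Set.univ from rfl, Set.image_univ]
  exact definable_range

instance ex {P : T → S → Prop} [h : DefinablePred fun p : T × S => P p.1 p.2] :
    DefinablePred fun t => ∃ s, P t s := by
  have image_eq : code '' {t : T | ∃ s, P t s} =
      (fun v => v ∘ Sum.inl) '' (code '' {p : T × S | P p.1 p.2}) := by
    rw [← Set.image_comp]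
    ext v
    constructor
    · rintro ⟨t, ⟨s, hs⟩, rfl⟩
      exact ⟨(t, s), hs, rfl⟩
    · rintro ⟨p, hp, rfl⟩
      exact ⟨p.1, ⟨p.2, hp⟩, rfl⟩
  exact ⟨image_eq ▸ h.definable.image_comp Sum.inl⟩

instance all {P : T → S → Prop} [DefinablePred fun p : T × S => P p.1 p.2] :
    DefinablePred fun t => ∀ s, P t s :=
  (inferInstance : DefinablePred fun t => ¬ ∃ s, ¬ P t s).congr fun _ => not_exists_not.symm

theorem diagonal : DefinablePred fun p : T × T => p.1 = p.2 := by
  have image_eq : code '' {p : T × T | p.1 = p.2} = Set.range code ∩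
      ⋂ i : ix T, {v | v (Sum.inl i) = v (Sum.inr i)} := by
    ext v
    constructor
    · rintro ⟨p, hp, rfl⟩
      refine ⟨⟨p, rfl⟩, Set.mem_iInter.2 fun i => ?_⟩
      exact congrArg (fun t : T => code t i) hp
    · rintro ⟨⟨p, rfl⟩, h⟩
      exact ⟨p, code_injective (funext fun i => Set.mem_iInter.1 h i), rfl⟩
  refine ⟨image_eq ▸ definable_range.inter (Set.definable_iInter_of_finite fun i => ?_)⟩
  exact (Dfn.eq (0 : Fin 2) 1).preimage_comp ![Sum.inl i, Sum.inr i]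

theorem singleton (t : T) : DefinablePred fun s : T => t = s := by
  have image_eq : code '' {s : T | t = s} = ⋂ i : ix T, {v | v i = code t i} := by
    ext v
    constructor
    · rintro ⟨s, rfl, rfl⟩
      exact Set.mem_iInter.2 fun i => rfl
    · intro h
      exact ⟨t, rfl, funext fun i => (Set.mem_iInter.1 h i).symm⟩
  refine ⟨image_eq ▸ Set.definable_iInter_of_finite fun i => ?_⟩
  exact (Dfn.eq_const (0 : Fin 1) (code t i)).preimage_comp fun _ => i

theorem comp {P : S → Prop} (h : DefinablePred P) {f : T → S} (hf : DefinableFun f) :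
    DefinablePred fun t => P (f t) := by
  have := hf.graph
  have := h.comp_reindexing fun p : T × S => p.2
  exact (inferInstance : DefinablePred fun t => ∃ s, f t = s ∧ P s).congr fun t => by simp

end DefinablePred

namespace DefinableFun

theorem of_isReindexing (r : S → T) [IsReindexing r] : DefinableFun r :=
  have : IsReindexing fun p : S × T => r p.1 := .comp r fun p : S × T => p.1
  ⟨DefinablePred.diagonal.comp_reindexing fun p : S × T => (r p.1, p.2)⟩

theorem comp {g : S → R} (hg : DefinableFun g) {f : T → S} (hf : DefinableFun f) :
    DefinableFun fun t => g (f t) := by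
  have := hf.graph.comp_reindexing fun q : (T × R) × S => (q.1.1, q.2)
  have := hg.graph.comp_reindexing fun q : (T × R) × S => (q.2, q.1.2)
  exact ⟨(inferInstance : DefinablePred fun p : T × R => ∃ s, f p.1 = s ∧ g s = p.2).congr
    fun p => by simp⟩

instance const (s : S) : DefinableFun fun _ : T => s :=
  ⟨(DefinablePred.singleton s).comp_reindexing fun p : T × S => p.2⟩

instance id : DefinableFun fun t : T => t := of_isReindexing _

instance fst {f : T → S × R} [hf : DefinableFun f] : DefinableFun fun t => (f t).1 :=
  (of_isReindexing fun p : S × R => p.1).comp hf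

instance snd {f : T → S × R} [hf : DefinableFun f] : DefinableFun fun t => (f t).2 :=
  (of_isReindexing fun p : S × R => p.2).comp hf

instance val {c : V} {f : T → El c} [hf : DefinableFun f] : DefinableFun fun t => (f t).1 :=
  (of_isReindexing fun x : El c => x.1).comp hf

theorem pair {f : T → S} {g : T → R} [hf : DefinableFun f] [hg : DefinableFun g] :
    DefinableFun fun t => (f t, g t) := by
  have := hf.graph.comp_reindexing fun q : T × S × R => (q.1, q.2.1)
  have := hg.graph.comp_reindexing fun q : T × S × R => (q.1, q.2.2)
  exact ⟨(inferInstance : DefinablePred fun q : T × S × R => f q.1 = q.2.1 ∧ g q.1 = q.2.2).congr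
    fun q => Prod.ext_iff⟩

end DefinableFun

namespace DefinablePred

theorem comp₂ {P : S → R → Prop} (h : DefinablePred fun p : S × R => P p.1 p.2) {f : T → S}
    {g : T → R} (hf : DefinableFun f) (hg : DefinableFun g) :
    DefinablePred fun t => P (f t) (g t) :=
  h.comp (.pair (hf := hf) (hg := hg))

theorem comp₃ {Q : Type*} [DefinableType V Q] {P : S → R → Q → Prop}
    (h : DefinablePred fun p : S × R × Q => P p.1 p.2.1 p.2.2) {f : T → S} {g : T → R} {k : T → Q}
    (hf : DefinableFun f) (hg : DefinableFun g) (hk : DefinableFun k) :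
    DefinablePred fun t => P (f t) (g t) (k t) :=
  have hgk : DefinableFun fun t => (g t, k t) := .pair (hf := hg) (hg := hk)
  h.comp (f := fun t => (f t, g t, k t)) (.pair (hf := hf) (hg := hgk))

instance eq {f g : T → S} [hf : DefinableFun f] [hg : DefinableFun g] :
    DefinablePred fun t => f t = g t :=
  diagonal.comp₂ hf hg

instance vmem {f g : T → V} [hf : DefinableFun f] [hg : DefinableFun g] :
    DefinablePred fun t => f t ∊ g t :=
  ((Dfn.mem (V := V) (0 : Fin 2) 1).definablePred.comp_reindexing
    fun p : V × V => ![p.1, p.2]).comp₂ (P := fun x y => x ∊ y) hf hg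

instance isPair {p x y : T → V} [hp : DefinableFun p] [hx : DefinableFun x]
    [hy : DefinableFun y] : DefinablePred fun t => IsPair (p t) (x t) (y t) :=
  (inferInstance : DefinablePred fun t : V × V × V => ∀ z : V, z ∊ t.1 ↔
    (∀ s : V, s ∊ z ↔ s = t.2.1) ∨ (∀ s : V, s ∊ z ↔ s = t.2.1 ∨ s = t.2.2)).comp₃
    (P := IsPair) hp hx hy

instance mem_trace {c : V} {f : T → El c} {g : T → V} [DefinableFun f] [DefinableFun g] :
    DefinablePred fun t => f t ∈ trace c (g t) :=
  (inferInstance : DefinablePred fun t => (f t).1 ∊ g t)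

theorem rel₂ {a b : V} {P : El a → El b → Prop} (hP : IsSetRel₂ P) {f : T → El a}
    {g : T → El b} [hf : DefinableFun f] [hg : DefinableFun g] :
    DefinablePred fun t => P (f t) (g t) := by
  obtain ⟨r, hr⟩ := hP
  exact ((inferInstance : DefinablePred fun t : El a × El b =>
    ∃ p : V, IsPair p t.1.1 t.2.1 ∧ p ∊ r).congr fun t => hr _ _).comp₂ (P := P) hf hg

theorem rel₃ {a b c : V} {P : El a → El b → El c → Prop} (hP : IsSetRel₃ P)
    {f : T → El a} {g : T → El b} {h : T → El c} [hf : DefinableFun f] [hg : DefinableFun g]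
    [hh : DefinableFun h] : DefinablePred fun t => P (f t) (g t) (h t) := by
  obtain ⟨r, hr⟩ := hP
  exact ((inferInstance : DefinablePred fun t : El a × El b × El c => ∃ q p : V,
    IsPair q t.1.1 t.2.1.1 ∧ IsPair p q t.2.2.1 ∧ p ∊ r).congr fun t => hr _ _ _).comp₃
    (P := P) hf hg hh

set_option synthInstance.maxSize 1000 in
set_option synthInstance.maxHeartbeats 200000 in
-- The instance search passes through every connective of the formula.
instance vfinite {f : T → V} [hf : DefinableFun f] : DefinablePred fun t => VFinite (f t) :=
  (inferInstance : DefinablePred fun s : V => ∀ K : V, (∃ e : V, e ∊ K ∧ ∀ t : V, ¬ t ∊ e) →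
    (∀ u x : V, u ∊ K → x ∊ s → ∃ u' : V, u' ∊ K ∧ ∀ t : V, t ∊ u' ↔ t ∊ u ∨ t = x) →
      s ∊ K).comp hf

end DefinablePred

theorem DefinableFun.app {a b : V} {F : El a → El b} (hF : IsSetFun F) {f : T → El a}
    [hf : DefinableFun f] : DefinableFun fun t => F (f t) :=
  DefinableFun.comp (g := F)
    ⟨DefinablePred.rel₂ hF (f := fun p : El a × El b => p.1) (g := fun p => p.2)⟩ hf

theorem DefinableFun.app₂ {a b c : V} {F : El a → El b → El c} (hF : IsSetFun₂ F) {f : T → El a}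
    {g : T → El b} [DefinableFun f] [DefinableFun g] : DefinableFun fun t => F (f t) (g t) :=
  DefinableFun.comp (g := fun p : El a × El b => F p.1 p.2)
    ⟨DefinablePred.rel₃ hF (f := fun p : (El a × El b) × El c => p.1.1) (g := fun p => p.1.2)
      (h := fun p => p.2)⟩ (f := fun t => (f t, g t)) DefinableFun.pair

end Calculus

/-! ## Sets of a model -/

section Sets

variable [IsZFModel V]

theorem trace_injOn (c : V) : Set.InjOn (trace c) {u | ∀ x : V, x ∊ u → x ∊ c} :=
  fun _ hu _ hw h => IsZFModel.extensionality _ _ fun z =>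
    ⟨fun hz => h.le (show (⟨z, hu z hz⟩ : El c) ∈ trace c _ from hz),
      fun hz => h.ge (show (⟨z, hw z hz⟩ : El c) ∈ trace c _ from hz)⟩

theorem exists_sep (c : V) (P : V → Prop) [DefinablePred P] :
    ∃ z : V, ∀ t : V, t ∊ z ↔ t ∊ c ∧ P t :=
  IsZFModel.separation {t | P t}
    (DefinablePred.comp_reindexing (P := P) inferInstance fun v : Fin 1 → V => v 0).dfn c

theorem exists_trace_eq {c : V} (P : El c → Prop) [h : DefinablePred P] :
    ∃ u : V, (∀ x : V, x ∊ u → x ∊ c) ∧ trace c u = {x | P x} := by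
  have := h.comp_reindexing fun p : V × El c => p.2
  obtain ⟨u, hu⟩ := exists_sep c fun x => ∃ y : El c, y.1 = x ∧ P y
  refine ⟨u, fun x hx => ((hu x).1 hx).1, Set.ext fun x => ?_⟩
  refine (hu x.1).trans ⟨?_, fun hx => ⟨x.2, x, rfl, hx⟩⟩
  rintro ⟨-, y, hy, hP⟩
  exact (Subtype.ext hy : y = x) ▸ hP

theorem IsPair.unique {p q x y : V} (hp : IsPair p x y) (hq : IsPair q x y) : p = q :=
  IsZFModel.extensionality _ _ fun z => (hp z).trans (hq z).symm

theorem isSetRel₂_of_definablePred {a b : V} {P : El a → El b → Prop}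
    (h : DefinablePred fun p : El a × El b => P p.1 p.2) : IsSetRel₂ P := by
  have := h.comp_reindexing fun q : ((Fin 2 → V) × El a) × El b => (q.1.2, q.2)
  have eval_definable (i : Fin 2) : DefinableFun fun q : ((Fin 2 → V) × El a) × El b => q.1.1 i :=
    (DefinableFun.of_isReindexing fun v : Fin 2 → V => v i).comp
      (f := fun q : ((Fin 2 → V) × El a) × El b => q.1.1) inferInstance
  obtain ⟨r, hr⟩ := isSetRel₂_of_dfn
    (P := fun s t => ∃ (x : El a) (y : El b), x.1 = s ∧ y.1 = t ∧ P x y)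
    (DefinablePred.dfn inferInstance) a b
  refine ⟨r, fun x y => Iff.trans ⟨fun h => ⟨x, y, rfl, rfl, h⟩, ?_⟩ (hr x y)⟩
  rintro ⟨x', y', hx, hy, hP⟩
  obtain rfl : x' = x := Subtype.ext hx
  obtain rfl : y' = y := Subtype.ext hy
  exact hP

theorem isSetRel₃_of_definablePred {a b c : V} {P : El a → El b → El c → Prop}
    (h : DefinablePred fun p : El a × El b × El c => P p.1 p.2.1 p.2.2) : IsSetRel₃ P := by
  obtain ⟨D, hD⟩ := isSetRel₂_of_definablePred (a := a) (b := b) (P := fun _ _ => True)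
    DefinablePred.true
  have := h.comp_reindexing fun q : ((El D × El c) × El a) × El b => (q.1.2, q.2, q.1.1.2)
  obtain ⟨r, hr⟩ := isSetRel₂_of_definablePred (a := D) (b := c)
    (P := fun q z => ∃ (x : El a) (y : El b), IsPair q.1 x.1 y.1 ∧ P x y z) inferInstance
  refine ⟨r, fun x y z => ?_⟩
  obtain ⟨q, hq, hqD⟩ := (hD x y).1 trivial
  constructor
  · intro hP
    obtain ⟨p, hp, hpr⟩ := (hr ⟨q, hqD⟩ z).1 ⟨x, y, hq, hP⟩
    exact ⟨q, p, hq, hp, hpr⟩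
  · rintro ⟨q', p, hq', hp, hpr⟩
    obtain rfl := hq.unique hq'
    obtain ⟨x', y', hxy, hP⟩ := (hr ⟨q, hqD⟩ z).2 ⟨p, hp, hpr⟩
    obtain ⟨h₁, h₂⟩ := hq.inj hxy
    obtain rfl : x = x' := Subtype.ext h₁
    obtain rfl : y = y' := Subtype.ext h₂
    exact hP

theorem IsSetFun.symm {a b : V} {e : El a ≃ El b} (h : IsSetFun e) : IsSetFun e.symm :=
  isSetRel₂_of_definablePred <| (DefinablePred.rel₂ h (f := fun p : El b × El a => p.2)
    (g := fun p => p.1)).congr fun p => by rw [Equiv.symm_apply_eq, eq_comm]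

end Sets

/-! ## Finiteness and compactness in a model -/

section Finite

theorem mem_sUnion_traceFamily {c t : V} {x : El c} :
    x ∈ ⋃₀ traceFamily c t ↔ ∃ u : V, u ∊ t ∧ x.1 ∊ u := by
  constructor
  · rintro ⟨_, ⟨u, hu, rfl⟩, hx⟩
    exact ⟨u, hu, hx⟩
  · rintro ⟨u, hu, hx⟩
    exact ⟨_, ⟨u, hu, rfl⟩, hx⟩

set_option synthInstance.maxSize 1000 in
set_option synthInstance.maxHeartbeats 200000 in
-- The instance search passes through every connective of the formula.
theorem DefinablePred.mem_VCO {c top : V} {T : Type w} [DefinableType V T] {U : T → Set (El c)}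
    (hU : DefinablePred fun p : T × El c => p.2 ∈ U p.1) :
    DefinablePred fun t => U t ∈ VCO c top := by
  have mem_definable {T' : Type w} [DefinableType V T'] {f : T' → T} {g : T' → El c}
      [hf : DefinableFun f] [hg : DefinableFun g] : DefinablePred fun t => g t ∈ U (f t) :=
    hU.comp₂ (P := fun t x => x ∈ U t) hf hg
  have : DefinablePred fun t => (∀ r : V, (∀ u : V, u ∊ r → u ∊ top) →
      (∀ x : El c, x ∈ U t → ∃ u : V, u ∊ r ∧ x.1 ∊ u) → ∃ s : V, (∀ u : V, u ∊ s → u ∊ r) ∧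
        VFinite s ∧ (∀ x : El c, x ∈ U t → ∃ u : V, u ∊ s ∧ x.1 ∊ u)) ∧
      ∃ u : V, u ∊ top ∧ ∀ x : El c, x.1 ∊ u ↔ x ∈ U t := inferInstance
  refine this.congr fun t => ?_
  simp only [← mem_sUnion_traceFamily (c := c)]
  refine and_congr Iff.rfl ?_
  exact ⟨fun ⟨u, hu, h⟩ => ⟨u, hu, fun x => by rw [← h]; rfl⟩,
    fun ⟨u, hu, h⟩ => ⟨u, hu, Set.ext h⟩⟩

variable [IsZFModel V]

theorem exists_vempty (c : V) : ∃ e : V, ∀ t : V, ¬ t ∊ e := by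
  obtain ⟨e, he⟩ := exists_sep c fun x => ¬ x = x
  exact ⟨e, fun t ht => ((he t).1 ht).2 rfl⟩

theorem exists_vunion (u w : V) : ∃ z : V, ∀ t : V, t ∊ z ↔ t ∊ u ∨ t ∊ w := by
  obtain ⟨p, hp⟩ := IsZFModel.pairing u w
  obtain ⟨z, hz⟩ := IsZFModel.union p
  exact ⟨z, fun t => (hz t).trans (by simp [hp, and_or_left, exists_or])⟩

theorem exists_vinsert (u x : V) : ∃ z : V, ∀ t : V, t ∊ z ↔ t ∊ u ∨ t = x := by
  obtain ⟨s, hs⟩ := IsZFModel.pairing x x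
  obtain ⟨z, hz⟩ := exists_vunion u s
  exact ⟨z, fun t => by rw [hz, hs, or_self]⟩

theorem VFinite.induction {s : V} (hs : VFinite s) (Q : V → Prop) [DefinablePred Q]
    (empty : ∀ e : V, (∀ t : V, ¬ t ∊ e) → Q e)
    (insert : ∀ u x u' : V, Q u → x ∊ s → (∀ t : V, t ∊ u' ↔ t ∊ u ∨ t = x) → Q u') : Q s := by
  obtain ⟨P, hP⟩ := IsZFModel.powerset s
  obtain ⟨K, hK⟩ := exists_sep P Q
  refine ((hK s).1 (hs K ?_ fun u x hu hx => ?_)).2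
  · obtain ⟨e, he⟩ := exists_vempty s
    exact ⟨e, (hK e).2 ⟨(hP e).2 fun t ht => (he t ht).elim, empty e he⟩, he⟩
  · obtain ⟨u', hu'⟩ := exists_vinsert u x
    obtain ⟨huP, huQ⟩ := (hK u).1 hu
    refine ⟨u', (hK u').2 ⟨(hP u').2 fun t ht => ?_, insert u x u' huQ hx hu'⟩, hu'⟩
    rcases (hu' t).1 ht with h | rfl
    · exact (hP u).1 huP t h
    · exact hx

theorem VFinite.of_empty {e : V} (he : ∀ t : V, ¬ t ∊ e) : VFinite e := by
  rintro K ⟨e', he', h⟩ -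
  rwa [IsZFModel.extensionality e e' fun z => iff_of_false (he z) (h z)]

theorem VFinite.of_singleton {s x : V} (hs : ∀ t : V, t ∊ s ↔ t = x) : VFinite s := by
  rintro K ⟨e, he, h⟩ hK
  obtain ⟨u, hu, h'⟩ := hK e x he ((hs x).2 rfl)
  rwa [IsZFModel.extensionality s u fun z => by rw [hs, h', or_iff_right (h z)]]

theorem VFinite.union {r s z : V} (hr : VFinite r) (hs : VFinite s)
    (hz : ∀ t : V, t ∊ z ↔ t ∊ r ∨ t ∊ s) : VFinite z := by
  intro K hK hK'
  have hrK : r ∊ K := hr K hK fun u x hu hx => hK' u x hu ((hz x).2 (.inl hx))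
  refine hs.induction (fun u => ∀ w : V, (∀ t : V, t ∊ w ↔ t ∊ r ∨ t ∊ u) → w ∊ K)
    (fun e he w hw => ?_) (fun u x u' hu hx hu' w hw => ?_) z hz
  · rwa [IsZFModel.extensionality w r fun t => by rw [hw, or_iff_left (he t)]]
  · obtain ⟨y, hy⟩ := exists_vunion r u
    obtain ⟨y', hy', h⟩ := hK' y x (hu y hy) ((hz x).2 (.inr hx))
    rwa [IsZFModel.extensionality w y' fun t => by rw [hw, h, hy, hu', or_assoc]]

variable {c top : V}

theorem VIsOpen.union (h : VIsTopology c top) {U W : Set (El c)} (hU : VIsOpen c top U)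
    (hW : VIsOpen c top W) : VIsOpen c top (U ∪ W) := by
  obtain ⟨u, hu, rfl⟩ := hU
  obtain ⟨w, hw, rfl⟩ := hW
  obtain ⟨t, ht⟩ := IsZFModel.pairing u w
  convert h.sUnion t fun y hy => ?_ using 1
  · ext x
    rw [mem_sUnion_traceFamily]
    simp only [ht, or_and_right, exists_or, exists_eq_left]
    rfl
  · rcases (ht y).1 hy with rfl | rfl
    · exact hu
    · exact hw

theorem VIsOpen.empty (h : VIsTopology c top) : VIsOpen c top ∅ := by
  obtain ⟨e, he⟩ := exists_vempty c
  convert h.sUnion e fun u hu => (he u hu).elim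
  ext x
  rw [mem_sUnion_traceFamily]
  simp [he]

theorem VIsCompact.empty : VIsCompact c top ∅ := by
  intro t _ _
  obtain ⟨e, he⟩ := exists_vempty c
  exact ⟨e, fun u hu => (he u hu).elim, .of_empty he, Set.empty_subset _⟩

theorem VIsCompact.union {U W : Set (El c)} (hU : VIsCompact c top U)
    (hW : VIsCompact c top W) : VIsCompact c top (U ∪ W) := by
  intro t ht h
  obtain ⟨r, hr, hr', hrU⟩ := hU t ht (Set.subset_union_left.trans h)
  obtain ⟨s, hs, hs', hsW⟩ := hW t ht (Set.subset_union_right.trans h)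
  obtain ⟨z, hz⟩ := exists_vunion r s
  refine ⟨z, fun u hu => ((hz u).1 hu).elim (hr u) (hs u), hr'.union hs' hz, ?_⟩
  rintro x (hx | hx)
  · obtain ⟨u, hu, hxu⟩ := mem_sUnion_traceFamily.1 (hrU hx)
    exact mem_sUnion_traceFamily.2 ⟨u, (hz u).2 (.inl hu), hxu⟩
  · obtain ⟨u, hu, hxu⟩ := mem_sUnion_traceFamily.1 (hsW hx)
    exact mem_sUnion_traceFamily.2 ⟨u, (hz u).2 (.inr hu), hxu⟩

theorem empty_mem_VCO (h : VIsTopology c top) : ∅ ∈ VCO c top :=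
  ⟨.empty, .empty h⟩

theorem union_mem_VCO (h : VIsTopology c top) {U W : Set (El c)} (hU : U ∈ VCO c top)
    (hW : W ∈ VCO c top) : U ∪ W ∈ VCO c top :=
  ⟨hU.1.union hW.1, hU.2.union h hW.2⟩

/-- The class `B` need not be definable: what the compactness argument separates is the class of
the open sets that may be adjoined without losing `P`. -/
theorem VCO_induction {P : Set (El c) → Prop} (hP : DefinablePred fun u : V => P (trace c u))
    {B : Set (Set (El c))} (isOpen : ∀ W ∈ B, VIsOpen c top W)
    (basis : ∀ U, VIsOpen c top U → ∀ x ∈ U, ∃ W ∈ B, x ∈ W ∧ W ⊆ U) (empty : P ∅)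
    (union : ∀ U, P U → ∀ W ∈ B, P (U ∪ W)) {U : Set (El c)} (hU : U ∈ VCO c top) : P U := by
  obtain ⟨hc, u, hu, rfl⟩ := hU
  have trace_union {x y z : V} (h : ∀ t, t ∊ z ↔ t ∊ x ∨ t ∊ y) :
      trace c z = trace c x ∪ trace c y := Set.ext fun t => h t.1
  have := hP.comp_reindexing fun p : (V × V) × V => p.1.2
  have := hP.comp_reindexing fun p : (V × V) × V => p.2
  have := hP.comp_reindexing fun p : V × V => p.2
  obtain ⟨t, ht⟩ := exists_sep top fun s => (∀ x : El c, x ∈ trace c s → x ∈ trace c u) ∧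
    ∀ x y : V, P (trace c x) → (∀ z, z ∊ y ↔ z ∊ x ∨ z ∊ s) → P (trace c y)
  obtain ⟨s, hst, hs, hus⟩ := hc t (fun w hw => ((ht w).1 hw).1) fun x hx => by
    obtain ⟨W, hW, hxW, hWu⟩ := basis _ ⟨u, hu, rfl⟩ x hx
    obtain ⟨w, hw, rfl⟩ := isOpen W hW
    refine ⟨_, ⟨w, (ht w).2 ⟨hw, hWu, fun y z hy hz => ?_⟩, rfl⟩, hxW⟩
    rw [trace_union hz]
    exact union _ hy _ hW
  have sUnion_subset : ⋃₀ traceFamily c s ⊆ trace c u := by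
    rintro x ⟨_, ⟨w, hw, rfl⟩, hxw⟩
    exact ((ht w).1 (hst w hw)).2.1 x hxw
  have sUnion_P : ∃ z : V, (∀ x : V, x ∊ z ↔ ∃ w : V, x ∊ w ∧ w ∊ s) ∧ P (trace c z) := by
    refine hs.induction (fun s => ∃ z : V, (∀ x : V, x ∊ z ↔ ∃ w : V, x ∊ w ∧ w ∊ s) ∧
      P (trace c z)) (fun e he => ⟨e, fun x => ?_, ?_⟩) fun r w r' hr hw hr' => ?_
    · simp [he]
    · convert empty
      exact Set.eq_empty_of_forall_notMem fun x => he x.1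
    · obtain ⟨z, hz, hzP⟩ := hr
      obtain ⟨z', hz'⟩ := exists_vunion z w
      refine ⟨z', fun x => ?_, ((ht w).1 (hst w hw)).2.2 z z' hzP hz'⟩
      simp only [hz', hz, hr', and_or_left, exists_or, exists_eq_right]
  obtain ⟨z, hz, hzP⟩ := sUnion_P
  convert hzP using 1
  refine (hus.antisymm sUnion_subset).trans (Set.ext fun x => ?_)
  rw [mem_sUnion_traceFamily]
  exact (exists_congr fun _ => and_comm).trans (hz x.1).symm

theorem preimage_mem_VCO {c' top' : V} (h : VIsTopology c top) {f : El c → El c'}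
    (hf : IsSetFun f) {B : Set (Set (El c'))} (isOpen : ∀ W ∈ B, VIsOpen c' top' W)
    (basis : ∀ U, VIsOpen c' top' U → ∀ x ∈ U, ∃ W ∈ B, x ∈ W ∧ W ⊆ U)
    (hfB : ∀ W ∈ B, f ⁻¹' W ∈ VCO c top) {U : Set (El c')} (hU : U ∈ VCO c' top') :
    f ⁻¹' U ∈ VCO c top := by
  have : DefinableFun fun p : V × El c => f p.2 := .app hf
  have hP : DefinablePred fun s : V => f ⁻¹' trace c' s ∈ VCO c top := .mem_VCO
    (inferInstance : DefinablePred fun p : V × El c => f p.2 ∈ trace c' p.1)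
  exact VCO_induction (P := fun U => f ⁻¹' U ∈ VCO c top) hP isOpen basis (empty_mem_VCO h)
    (fun _ hU W hW => union_mem_VCO h hU (hfB W hW)) hU

end Finite

end Definability

/-! ## The spectrum in a model -/

section ModelSpectrum

variable {V : Type w} [setLang.Structure V]

section Operations

variable {T : Type*} [DefinableType V T] {I : V} {A : VCOL I} {f g : T → El A.carrier}
  {i k : T → El I}

instance DefinableFun.inf [DefinableFun f] [DefinableFun g] : DefinableFun fun t => f t ⊓ g t :=
  DefinableFun.app₂ A.isSet_inf

instance DefinableFun.compl [DefinableFun f] : DefinableFun fun t => (f t)ᶜ :=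
  DefinableFun.app A.isSet_compl

instance DefinableFun.cylEx [DefinableFun i] [DefinableFun f] :
    DefinableFun fun t => ex (i t) (f t) :=
  DefinableFun.app₂ A.isSet_ex

instance DefinableFun.cylDiag [DefinableFun i] [DefinableFun k] :
    DefinableFun fun t => (diag (i t) (k t) : El A.carrier) :=
  DefinableFun.app₂ A.isSet_diag

instance DefinablePred.le [DefinableFun f] [DefinableFun g] : DefinablePred fun t => f t ≤ g t :=
  (inferInstance : DefinablePred fun t => f t ⊓ g t = f t).congr fun _ => inf_eq_left.symm

end Operations

variable {I : V} (A : VCOL I)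

instance VCOL.definablePred_isProperFilter :
    DefinablePred fun x : V => IsProperFilter (trace A.carrier x) := by
  have : DefinablePred fun x : V => (∃ a : El A.carrier, a ∈ trace A.carrier x) ∧
    (∀ a b : El A.carrier, a ∈ trace A.carrier x → a ≤ b → b ∈ trace A.carrier x) ∧
    (∀ a b : El A.carrier, a ∈ trace A.carrier x → b ∈ trace A.carrier x →
      a ⊓ b ∈ trace A.carrier x) ∧ ∃ a : El A.carrier, ¬ a ∈ trace A.carrier x := inferInstance
  refine this.congr fun x => ⟨fun h => ⟨h.1, h.2, h.3, (Set.ne_univ_iff_exists_notMem _).1 h.4⟩,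
    fun h => ⟨h.1, h.2.1, h.2.2.1, (Set.ne_univ_iff_exists_notMem _).2 h.2.2.2⟩⟩

variable [IsZFModel V]

theorem VCOL.exists_specCarrier : ∃ c : V, ∀ x : V, x ∊ c ↔
    (∀ a : V, a ∊ x → a ∊ A.carrier) ∧ IsProperFilter (trace A.carrier x) := by
  obtain ⟨p, hp⟩ := IsZFModel.powerset A.carrier
  obtain ⟨c, hc⟩ := exists_sep p fun x => IsProperFilter (trace A.carrier x)
  exact ⟨c, fun x => by rw [hc, hp]⟩

/-- The set of the proper filters of `A` in the model. -/
noncomputable def VCOL.specCarrier : V := A.exists_specCarrier.choose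

theorem VCOL.mem_specCarrier (x : V) : x ∊ A.specCarrier ↔
    (∀ a : V, a ∊ x → a ∊ A.carrier) ∧ IsProperFilter (trace A.carrier x) :=
  A.exists_specCarrier.choose_spec x

variable {A}

/-- The proper filter that is the point `x` of the spectrum. -/
def specPt (x : El A.specCarrier) : ProperFilter (El A.carrier) :=
  ⟨trace A.carrier x.1, ((A.mem_specCarrier x.1).1 x.2).2⟩

theorem specPt_injective : Function.Injective (specPt (A := A)) := fun x y h =>
  Subtype.ext <| trace_injOn A.carrier ((A.mem_specCarrier x.1).1 x.2).1
    ((A.mem_specCarrier y.1).1 y.2).1 (congrArg Subtype.val h)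

instance DefinablePred.mem_specPt {T : Type*} [DefinableType V T] {f : T → El A.carrier}
    {g : T → El A.specCarrier} [DefinableFun f] [DefinableFun g] :
    DefinablePred fun t => f t ∈ (specPt (g t)).1 :=
  (inferInstance : DefinablePred fun t => (f t).1 ∊ (g t).1)

theorem exists_specPt_eq (F : ProperFilter (El A.carrier)) [DefinablePred fun a => a ∈ F.1] :
    ∃ x : El A.specCarrier, specPt x = F := by
  obtain ⟨x, hx, hxF⟩ := exists_trace_eq fun a => a ∈ F.1
  have hxF' : trace A.carrier x = F.1 := hxF
  exact ⟨⟨x, (A.mem_specCarrier x).2 ⟨hx, hxF'.symm ▸ F.2⟩⟩, Subtype.ext hxF'⟩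

theorem hasPrincipalFilters_specPt : HasPrincipalFilters (specPt (A := A)) := fun a ha =>
  have : DefinablePred fun b => b ∈ Set.Ici a :=
    DefinablePred.le (f := fun _ => a) (g := fun b => b)
  (exists_specPt_eq ⟨_, isProperFilter_Ici ha⟩).imp fun _ => congrArg Subtype.val

theorem isClosedUnderEx_specPt : IsClosedUnderEx (El I) (specPt (A := A)) := fun i x =>
  have : DefinablePred fun b => b ∈ (exFilter i (specPt x)).1 :=
    (inferInstance : DefinablePred fun b : El A.carrier =>
      ∃ a : El A.carrier, a ∈ (specPt x).1 ∧ ex i a ≤ b)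
  exists_specPt_eq (exFilter i (specPt x))

/-- The set of the points of the spectrum that contain `a`. -/
def vphi (a : El A.carrier) : Set (El A.specCarrier) := specPt ⁻¹' phi a

instance DefinablePred.mem_vphi {T : Type*} [DefinableType V T] {f : T → El A.carrier}
    {g : T → El A.specCarrier} [DefinableFun f] [DefinableFun g] :
    DefinablePred fun t => g t ∈ vphi (f t) :=
  (inferInstance : DefinablePred fun t => f t ∈ (specPt (g t)).1)

theorem vphi_bot : vphi (⊥ : El A.carrier) = ∅ := preimage_phi_bot

theorem vphi_top : vphi (⊤ : El A.carrier) = Set.univ := preimage_phi_top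

theorem vphi_inf (a b : El A.carrier) : vphi (a ⊓ b) = vphi a ∩ vphi b := preimage_phi_inf a b

theorem vphi_subset {a b : El A.carrier} : vphi a ⊆ vphi b ↔ a ≤ b :=
  hasPrincipalFilters_specPt.preimage_phi_subset

theorem vphi_injective : Function.Injective (vphi (A := A)) :=
  hasPrincipalFilters_specPt.preimage_phi_injective

/-- Orthogonality in the spectrum. -/
def vperp : El A.specCarrier → El A.specCarrier → Prop := InvImage (specPerp (El A.carrier)) specPt

/-- The accessibility relations of the spectrum. -/
def vrel (i : El I) : El A.specCarrier → El A.specCarrier → Prop :=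
  InvImage (specR (El I) (El A.carrier) i) specPt

theorem vrel_iff {i : El I} {x y : El A.specCarrier} :
    vrel i x y ↔ ∀ a ∈ (specPt x).1, ex i a ∈ (specPt y).1 :=
  Set.image_subset_iff

instance DefinablePred.vperp {T : Type*} [DefinableType V T] {f g : T → El A.specCarrier}
    [hf : DefinableFun f] [hg : DefinableFun g] : DefinablePred fun t => vperp (f t) (g t) :=
  (inferInstance : DefinablePred fun p : El A.specCarrier × El A.specCarrier =>
    ∃ a : El A.carrier, a ∈ (specPt p.1).1 ∧ aᶜ ∈ (specPt p.2).1).comp₂ (P := _root_.vperp) hf hg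

theorem orth_vphi (a : El A.carrier) : orth vperp (vphi a) = vphi aᶜ :=
  hasPrincipalFilters_specPt.orth_preimage_phi a

theorem isBiorth_vphi (a : El A.carrier) : IsBiorth vperp (vphi a) :=
  hasPrincipalFilters_specPt.isBiorth_preimage_phi a

theorem relImage_vphi (i : El I) (a : El A.carrier) :
    relImage (vrel i) (vphi a) = vphi (ex i a) :=
  hasPrincipalFilters_specPt.relImage_preimage_phi i a

variable (A)

theorem VCOL.exists_specTop : ∃ t : V, ∀ u : V, u ∊ t ↔ (∀ x : V, x ∊ u → x ∊ A.specCarrier) ∧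
    ∀ x ∈ trace A.specCarrier u, ∃ a ∈ (specPt x).1, vphi a ⊆ trace A.specCarrier u := by
  obtain ⟨p, hp⟩ := IsZFModel.powerset A.specCarrier
  obtain ⟨t, ht⟩ := exists_sep p fun u : V => ∀ x : El A.specCarrier,
    x ∈ trace A.specCarrier u → ∃ a : El A.carrier, a ∈ (specPt x).1 ∧
      ∀ y : El A.specCarrier, y ∈ vphi a → y ∈ trace A.specCarrier u
  exact ⟨t, fun u => by rw [ht, hp]; rfl⟩

/-- The topology of the spectrum in the model. -/
noncomputable def VCOL.specTop : V := A.exists_specTop.choose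

theorem VCOL.mem_specTop (u : V) : u ∊ A.specTop ↔ (∀ x : V, x ∊ u → x ∊ A.specCarrier) ∧
    ∀ x ∈ trace A.specCarrier u, ∃ a ∈ (specPt x).1, vphi a ⊆ trace A.specCarrier u :=
  A.exists_specTop.choose_spec u

variable {A}

theorem vIsOpen_spec {U : Set (El A.specCarrier)} [DefinablePred fun x => x ∈ U]
    (h : ∀ x ∈ U, ∃ a ∈ (specPt x).1, vphi a ⊆ U) : VIsOpen A.specCarrier A.specTop U := by
  obtain ⟨u, hu, hU⟩ := exists_trace_eq fun x => x ∈ U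
  change trace _ u = U at hU
  exact ⟨u, (A.mem_specTop u).2 ⟨hu, hU ▸ h⟩, hU⟩

theorem exists_vphi_subset {U : Set (El A.specCarrier)} (hU : VIsOpen A.specCarrier A.specTop U)
    {x : El A.specCarrier} (hx : x ∈ U) : ∃ a ∈ (specPt x).1, vphi a ⊆ U := by
  obtain ⟨u, hu, rfl⟩ := hU
  exact ((A.mem_specTop u).1 hu).2 x hx

theorem vIsOpen_vphi (a : El A.carrier) : VIsOpen A.specCarrier A.specTop (vphi a) :=
  have : DefinablePred fun x => x ∈ vphi a :=
    DefinablePred.mem_vphi (f := fun _ => a) (g := fun x => x)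
  vIsOpen_spec fun _ hx => ⟨a, hx, subset_rfl⟩

theorem vIsTopology_spec : VIsTopology A.specCarrier A.specTop where
  subset u hu := ((A.mem_specTop u).1 hu).1
  univ := by
    rw [← vphi_top]
    exact vIsOpen_vphi ⊤
  inter := by
    rintro _ _ ⟨u, hu, rfl⟩ ⟨w, hw, rfl⟩
    have : DefinablePred fun x => x ∈ trace A.specCarrier u ∩ trace A.specCarrier w :=
      (inferInstance : DefinablePred fun x : El A.specCarrier => x.1 ∊ u ∧ x.1 ∊ w)
    refine vIsOpen_spec fun x hx => ?_
    obtain ⟨a, ha, hau⟩ := exists_vphi_subset ⟨u, hu, rfl⟩ hx.1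
    obtain ⟨b, hb, hbw⟩ := exists_vphi_subset ⟨w, hw, rfl⟩ hx.2
    exact ⟨a ⊓ b, (specPt x).2.inf_mem _ _ ha hb,
      (vphi_inf a b).trans_subset (Set.inter_subset_inter hau hbw)⟩
  sUnion t ht := by
    have : DefinablePred fun x => x ∈ ⋃₀ traceFamily A.specCarrier t :=
      (inferInstance : DefinablePred fun x : El A.specCarrier => ∃ u : V, u ∊ t ∧ x.1 ∊ u).congr
        fun x => mem_sUnion_traceFamily
    refine vIsOpen_spec fun x hx => ?_
    obtain ⟨u, hu, hx⟩ := mem_sUnion_traceFamily.1 hx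
    obtain ⟨a, ha, h⟩ := exists_vphi_subset (U := trace _ u) ⟨u, ht u hu, rfl⟩ hx
    exact ⟨a, ha, h.trans fun y hy => mem_sUnion_traceFamily.2 ⟨u, hu, hy⟩⟩

theorem vIsCompact_vphi (a : El A.carrier) : VIsCompact A.specCarrier A.specTop (vphi a) := by
  by_cases ha : a = ⊥
  · rw [ha, vphi_bot]
    exact VIsCompact.empty
  · intro t ht hc
    obtain ⟨x, hx⟩ := hasPrincipalFilters_specPt a ha
    obtain ⟨u, hu, hxu⟩ := mem_sUnion_traceFamily.1 (hc (show x ∈ vphi a from hx.ge le_rfl))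
    obtain ⟨b, hb, hbu⟩ := exists_vphi_subset (U := trace _ u) ⟨u, ht u hu, rfl⟩ hxu
    have hab : a ≤ b := hx.le hb
    obtain ⟨s, hs⟩ := IsZFModel.pairing u u
    simp only [or_self] at hs
    refine ⟨s, fun w hw => (hs w).1 hw ▸ hu, VFinite.of_singleton hs, fun y hy => ?_⟩
    exact mem_sUnion_traceFamily.2 ⟨u, (hs u).2 rfl, hbu (vphi_subset.2 hab hy)⟩

theorem vphi_mem_VCO (a : El A.carrier) : vphi a ∈ VCO A.specCarrier A.specTop :=
  ⟨vIsCompact_vphi a, vIsOpen_vphi a⟩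

theorem vphi_mem_VCOB (a : El A.carrier) : vphi a ∈ VCOB A.specCarrier A.specTop vperp :=
  ⟨vphi_mem_VCO a, isBiorth_vphi a⟩

theorem exists_orth_eq_vphi_compl {U : Set (El A.specCarrier)}
    (hU : U ∈ VCO A.specCarrier A.specTop) : ∃ a : El A.carrier, orth vperp U = vphi aᶜ := by
  refine VCO_induction (P := fun U => ∃ a : El A.carrier, orth vperp U = vphi aᶜ)
    (B := Set.range vphi) ?_ (Set.forall_mem_range.2 vIsOpen_vphi) (fun U hU x hx => ?_) ?_ ?_ hU
  · exact (inferInstance : DefinablePred fun u : V => ∃ a : El A.carrier, ∀ x : El A.specCarrier,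
      (∀ y : El A.specCarrier, y ∈ trace A.specCarrier u → vperp x y) ↔ x ∈ vphi aᶜ).congr
        fun u => exists_congr fun a => Set.ext_iff
  · obtain ⟨a, ha, haU⟩ := exists_vphi_subset hU hx
    exact ⟨vphi a, ⟨a, rfl⟩, ha, haU⟩
  · exact ⟨⊥, by rw [← vphi_bot, orth_vphi]⟩
  · rintro U ⟨a, ha⟩ _ ⟨b, rfl⟩
    exact ⟨a ⊔ b, by rw [orth_union, ha, orth_vphi, ← vphi_inf, Ortholattice.compl_sup]⟩

theorem VCOB_spec : VCOB A.specCarrier A.specTop vperp = Set.range vphi := by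
  refine Set.Subset.antisymm (fun U hU => ?_) (Set.range_subset_iff.2 vphi_mem_VCOB)
  obtain ⟨a, ha⟩ := exists_orth_eq_vphi_compl hU.1
  exact ⟨a, by rw [← hU.2, ha, orth_vphi, Ortholattice.compl_compl]⟩

theorem exists_traceFamily_eq_setOf_mem {F : V} (hF : IsProperFilterIn
    (VCOB A.specCarrier A.specTop vperp) (traceFamily A.specCarrier F)) :
    ∃ x, traceFamily A.specCarrier F = {U | U ∈ VCOB A.specCarrier A.specTop vperp ∧ x ∈ U} := by
  have hd : DefinablePred fun a => a ∈ vphi ⁻¹' traceFamily A.specCarrier F :=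
    (inferInstance : DefinablePred fun a : El A.carrier => ∃ u : V, u ∊ F ∧
      ∀ x : El A.specCarrier, x ∈ trace A.specCarrier u ↔ x ∈ vphi a).congr fun a =>
        exists_congr fun u => and_congr_right fun _ => Set.ext_iff
  obtain ⟨x, hx⟩ := exists_specPt_eq ⟨_, hF.isProperFilter_preimage VCOB_spec.symm
    (fun _ _ => vphi_subset.2) vphi_inf⟩
  have mem_vphi (a : El A.carrier) : x ∈ vphi a ↔ vphi a ∈ traceFamily A.specCarrier F :=
    Set.ext_iff.1 (congrArg Subtype.val hx) a
  refine ⟨x, Set.ext fun U => ⟨fun hU => ?_, fun ⟨hU, hxU⟩ => ?_⟩⟩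
  · obtain ⟨a, rfl⟩ := VCOB_spec.le (hF.subset hU)
    exact ⟨vphi_mem_VCOB a, (mem_vphi a).2 hU⟩
  · obtain ⟨a, rfl⟩ := VCOB_spec.le hU
    exact (mem_vphi a).1 hxU

theorem vIsUVOSpace_spec : VIsUVOSpace A.specCarrier A.specTop vperp where
  toIsOrthoframe := isOrthoframe_spec.invImage specPt
  isTopology := vIsTopology_spec
  t0 x y hxy := by
    by_contra! h
    exact hxy <| specPt_injective <| Subtype.ext <| Set.ext fun a => h (vphi a) (vIsOpen_vphi a)
  basis U hU x hx := by
    obtain ⟨a, ha, haU⟩ := exists_vphi_subset hU hx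
    exact ⟨vphi a, vphi_mem_VCOB a, ha, haU⟩
  inter_mem := by
    rw [VCOB_spec]
    rintro _ _ ⟨a, rfl⟩ ⟨b, rfl⟩
    exact ⟨a ⊓ b, vphi_inf a b⟩
  orth_mem := by
    rw [VCOB_spec]
    rintro _ ⟨a, rfl⟩
    exact ⟨aᶜ, (orth_vphi a).symm⟩
  filter _ := exists_traceFamily_eq_setOf_mem
  perp_sep := by
    rintro x y ⟨a, ha, ha'⟩
    exact ⟨vphi a, vphi_mem_VCOB a, ha, (orth_vphi a).ge ha'⟩

theorem vIsMonadicUVOSpace_spec (i : El I) :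
    VIsMonadicUVOSpace A.specCarrier A.specTop vperp (vrel i) where
  toVIsUVOSpace := vIsUVOSpace_spec
  refl := (isClosedUnderEx_specPt.isMonadicOrthoframe i).refl
  trans := (isClosedUnderEx_specPt.isMonadicOrthoframe i).trans
  image_orth := (isClosedUnderEx_specPt.isMonadicOrthoframe i).image_orth
  image_mem := by
    rw [VCOB_spec]
    rintro _ ⟨a, rfl⟩
    exact ⟨ex i a, (relImage_vphi i a).symm⟩
  rel_sep x y h := by
    rw [vrel_iff] at h
    push Not at h
    obtain ⟨a, ha, hy⟩ := h
    refine ⟨vphi (ex i a), vphi_mem_VCOB _, ⟨vphi a, vphi_mem_VCOB a, ha, ?_⟩, hy⟩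
    rw [relImage_vphi, isBiorth_vphi]

theorem vIsCylindricUVOSpace_spec : VIsCylindricUVOSpace A.specCarrier A.specTop vperp vrel
    fun i k : El I => vphi (diag i k) where
  toVIsUVOSpace := vIsUVOSpace_spec
  __ := isClosedUnderEx_specPt.isCylindricOrthoframe hasPrincipalFilters_specPt
  monadicUVO := vIsMonadicUVOSpace_spec
  diag_mem i k := vphi_mem_VCO (diag i k)

/-- The spectrum of `A` in the model. -/
noncomputable abbrev VCOL.spec (A : VCOL I) : VCUVO I where
  carrier := A.specCarrier
  top := A.specTop
  perp := vperp
  R := vrel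
  Δ i k := vphi (diag i k)
  isSet_perp := isSetRel₂_of_definablePred inferInstance
  isSet_R := isSetRel₃_of_definablePred <| (inferInstance : DefinablePred
    fun p : El I × El A.specCarrier × El A.specCarrier =>
      ∀ a : El A.carrier, a ∈ (specPt p.2.1).1 → ex p.1 a ∈ (specPt p.2.2).1).congr
        fun _ => vrel_iff
  isSet_Δ := isSetRel₃_of_definablePred inferInstance
  isCylindric := vIsCylindricUVOSpace_spec

theorem VCOL.vIsSpectrum_spec (A : VCOL I) : VIsSpectrum A A.spec where
  carrier := A.mem_specCarrier
  perp _ _ := Iff.rfl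
  R _ _ _ := vrel_iff
  Δ _ _ := rfl
  top := A.mem_specTop

end ModelSpectrum

/-! ## The algebra of a space in a model -/

section Frame

variable {X : Type v} {perp : X → X → Prop}

theorem IsMonadicOrthoframe.relImage_orth_orth_union {R : X → X → Prop}
    (h : IsMonadicOrthoframe perp R) {U W : Set X}
    (hUW : IsBiorth perp (relImage R (orth perp (orth perp (U ∪ W))))) :
    relImage R (orth perp (orth perp (U ∪ W))) =
      orth perp (orth perp (relImage R U ∪ relImage R W)) := by
  have subset_orth_orth_union := subset_orth_orth h.toIsOrthoframe (U ∪ W)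
  refine Set.Subset.antisymm ?_ ?_
  · have image_union : relImage R (relImage R U ∪ relImage R W) = relImage R U ∪ relImage R W := by
      refine Set.Subset.antisymm ?_ (h.subset_image _)
      rintro y ⟨x, hx | hx, hxy⟩
      · exact .inl ((h.image_image U).le ⟨x, hx, hxy⟩)
      · exact .inr ((h.image_image W).le ⟨x, hx, hxy⟩)
    rw [← h.image_orth_of (h.image_orth_of image_union)]
    exact relImage_mono <| orth_anti <| orth_anti <|
      Set.union_subset_union (h.subset_image U) (h.subset_image W)
  · rw [← hUW]
    exact orth_anti <| orth_anti <| Set.union_subset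
      (relImage_mono (Set.subset_union_left.trans subset_orth_orth_union))
      (relImage_mono (Set.subset_union_right.trans subset_orth_orth_union))

theorem relImage_comm {R S : X → X → Prop}
    (h : ∀ x z, (∃ y, R x y ∧ S y z) ↔ ∃ y, S x y ∧ R y z) (U : Set X) :
    relImage S (relImage R U) = relImage R (relImage S U) := by
  ext z
  constructor
  · rintro ⟨y, ⟨x, hx, hxy⟩, hyz⟩
    obtain ⟨y', hxy', hyz'⟩ := (h x z).1 ⟨y, hxy, hyz⟩
    exact ⟨y', ⟨x, hx, hxy'⟩, hyz'⟩
  · rintro ⟨y, ⟨x, hx, hxy⟩, hyz⟩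
    obtain ⟨y', hxy', hyz'⟩ := (h x z).2 ⟨y, hxy, hyz⟩
    exact ⟨y', ⟨x, hx, hxy'⟩, hyz'⟩

end Frame

section ModelAlgebra

variable {V : Type w} [setLang.Structure V] {I : V}

section Relations

variable {T : Type*} [DefinableType V T] {X : VCUVO I} {f g : T → El X.carrier} {i k : T → El I}

instance DefinablePred.perp [DefinableFun f] [DefinableFun g] :
    DefinablePred fun t => X.perp (f t) (g t) :=
  DefinablePred.rel₂ X.isSet_perp

instance DefinablePred.cylRel [DefinableFun i] [DefinableFun f] [DefinableFun g] :
    DefinablePred fun t => X.R (i t) (f t) (g t) :=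
  DefinablePred.rel₃ X.isSet_R

instance DefinablePred.mem_cylDiag [DefinableFun i] [DefinableFun k] [DefinableFun f] :
    DefinablePred fun t => f t ∈ X.Δ (i t) (k t) :=
  DefinablePred.rel₃ X.isSet_Δ

end Relations

variable (X : VCUVO I)

/-- `COB(X)` in the sense of the model. -/
abbrev VCUVO.cob : Set (Set (El X.carrier)) := VCOB X.carrier X.top X.perp

instance VCUVO.definablePred_trace_mem_cob :
    DefinablePred fun u : V => trace X.carrier u ∈ X.cob := by
  have mem_VCO : DefinablePred fun u : V => trace X.carrier u ∈ VCO X.carrier X.top :=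
    DefinablePred.mem_VCO inferInstance
  exact (inferInstance : DefinablePred fun u : V => trace X.carrier u ∈ VCO X.carrier X.top ∧
    ∀ x : El X.carrier, (∀ y : El X.carrier,
      (∀ z : El X.carrier, z ∈ trace X.carrier u → X.perp y z) → X.perp x y) ↔
        x ∈ trace X.carrier u).congr fun u => and_congr_right fun _ => Set.ext_iff

variable {X}

theorem VCUVO.orth_orth_union_mem {U W : Set (El X.carrier)} (hU : U ∈ X.cob) (hW : W ∈ X.cob) :
    orth X.perp (orth X.perp (U ∪ W)) ∈ X.cob := by
  rw [orth_union]
  exact X.isCylindric.orth_mem _ (X.isCylindric.inter_mem _ _ (X.isCylindric.orth_mem _ hU)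
    (X.isCylindric.orth_mem _ hW))

theorem VCUVO.diag_mem (i k : El I) : X.Δ i k ∈ X.cob :=
  ⟨X.isCylindric.diag_mem i k, X.isCylindric.diag_biorth i k⟩

variable (X) [IsZFModel V]

theorem VCUVO.empty_mem : ∅ ∈ X.cob := by
  rcases isEmpty_or_nonempty (El X.carrier) with h | ⟨⟨x⟩⟩
  · exact ⟨empty_mem_VCO X.isCylindric.isTopology, Subsingleton.elim _ _⟩
  · obtain ⟨U, hU, -⟩ :=
      X.isCylindric.basis _ X.isCylindric.isTopology.univ x (Set.mem_univ x)
    rw [← inter_orth X.isCylindric.toIsOrthoframe U]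
    exact X.isCylindric.inter_mem _ _ hU (X.isCylindric.orth_mem _ hU)

theorem VCUVO.univ_mem : Set.univ ∈ X.cob := by
  rw [← orth_empty X.perp]
  exact X.isCylindric.orth_mem _ X.empty_mem

theorem VCUVO.exists_cobCarrier : ∃ c : V, ∀ u : V, u ∊ c ↔
    (∀ x : V, x ∊ u → x ∊ X.carrier) ∧ trace X.carrier u ∈ X.cob := by
  obtain ⟨p, hp⟩ := IsZFModel.powerset X.carrier
  obtain ⟨c, hc⟩ := exists_sep p fun u => trace X.carrier u ∈ X.cob
  exact ⟨c, fun u => by rw [hc, hp]⟩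

/-- `COB(X)` as a set of the model. -/
noncomputable def VCUVO.cobCarrier : V := X.exists_cobCarrier.choose

theorem VCUVO.mem_cobCarrier (u : V) : u ∊ X.cobCarrier ↔
    (∀ x : V, x ∊ u → x ∊ X.carrier) ∧ trace X.carrier u ∈ X.cob :=
  X.exists_cobCarrier.choose_spec u

variable {X}

/-- The set of points of an element of `COB(X)`. -/
def cobSet (a : El X.cobCarrier) : Set (El X.carrier) := trace X.carrier a.1

theorem cobSet_mem (a : El X.cobCarrier) : cobSet a ∈ X.cob := ((X.mem_cobCarrier a.1).1 a.2).2

theorem cobSet_injective : Function.Injective (cobSet (X := X)) := fun a b h =>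
  Subtype.ext <| trace_injOn X.carrier ((X.mem_cobCarrier a.1).1 a.2).1
    ((X.mem_cobCarrier b.1).1 b.2).1 h

theorem cobSet_inj {a b : El X.cobCarrier} : cobSet a = cobSet b ↔ a = b :=
  cobSet_injective.eq_iff

theorem exists_cobSet_eq {U : Set (El X.carrier)} (hU : U ∈ X.cob) :
    ∃ a : El X.cobCarrier, cobSet a = U := by
  obtain ⟨⟨-, u, hu, rfl⟩, -⟩ := id hU
  exact ⟨⟨u, (X.mem_cobCarrier u).2 ⟨X.isCylindric.isTopology.subset u hu, hU⟩⟩, rfl⟩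

theorem range_cobSet : Set.range (cobSet (X := X)) = X.cob :=
  Set.Subset.antisymm (Set.range_subset_iff.2 cobSet_mem) fun _ => exists_cobSet_eq

/-- The element of `COB(X)` with a given set of points. -/
noncomputable def cobMk (U : Set (El X.carrier)) (hU : U ∈ X.cob) : El X.cobCarrier :=
  (exists_cobSet_eq hU).choose

theorem cobSet_cobMk (U : Set (El X.carrier)) (hU : U ∈ X.cob) : cobSet (cobMk U hU) = U :=
  (exists_cobSet_eq hU).choose_spec

instance DefinablePred.mem_cobSet {T : Type*} [DefinableType V T] {f : T → El X.carrier}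
    {g : T → El X.cobCarrier} [DefinableFun f] [DefinableFun g] :
    DefinablePred fun t => f t ∈ cobSet (g t) :=
  (inferInstance : DefinablePred fun t => (f t).1 ∊ (g t).1)

noncomputable instance VCUVO.instOrtholattice : Ortholattice (El X.cobCarrier) where
  le a b := cobSet a ⊆ cobSet b
  le_refl _ := subset_rfl
  le_trans _ _ _ h h' := h.trans h'
  le_antisymm _ _ h h' := cobSet_injective (h.antisymm h')
  inf a b := cobMk (cobSet a ∩ cobSet b)
    (X.isCylindric.inter_mem _ _ (cobSet_mem a) (cobSet_mem b))
  inf_le_left _ _ := (cobSet_cobMk _ _).trans_subset Set.inter_subset_left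
  inf_le_right _ _ := (cobSet_cobMk _ _).trans_subset Set.inter_subset_right
  le_inf _ _ _ h h' := (Set.subset_inter h h').trans_eq (cobSet_cobMk _ _).symm
  sup a b := cobMk (orth X.perp (orth X.perp (cobSet a ∪ cobSet b)))
    (VCUVO.orth_orth_union_mem (cobSet_mem a) (cobSet_mem b))
  le_sup_left _ _ := (Set.subset_union_left.trans
    (subset_orth_orth X.isCylindric.toIsOrthoframe _)).trans_eq (cobSet_cobMk _ _).symm
  le_sup_right _ _ := (Set.subset_union_right.trans
    (subset_orth_orth X.isCylindric.toIsOrthoframe _)).trans_eq (cobSet_cobMk _ _).symm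
  sup_le _ _ c h h' := (cobSet_cobMk _ _).trans_subset <|
    (orth_anti (orth_anti (Set.union_subset h h'))).trans_eq (cobSet_mem c).2
  top := cobMk Set.univ X.univ_mem
  le_top _ := (Set.subset_univ _).trans_eq (cobSet_cobMk _ _).symm
  bot := cobMk ∅ X.empty_mem
  bot_le _ := (cobSet_cobMk _ _).trans_subset (Set.empty_subset _)
  compl a := cobMk (orth X.perp (cobSet a)) (X.isCylindric.orth_mem _ (cobSet_mem a))
  inf_compl a := cobSet_injective <| by
    refine (cobSet_cobMk _ _).trans (Eq.trans ?_ (cobSet_cobMk _ _).symm)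
    rw [cobSet_cobMk, inter_orth X.isCylindric.toIsOrthoframe]
  sup_compl a := cobSet_injective <| by
    refine (cobSet_cobMk _ _).trans (Eq.trans ?_ (cobSet_cobMk _ _).symm)
    rw [cobSet_cobMk, orth_union, inter_orth X.isCylindric.toIsOrthoframe, orth_empty]
  compl_anti _ _ h :=
    ((cobSet_cobMk _ _).trans_subset (orth_anti h)).trans_eq (cobSet_cobMk _ _).symm
  compl_compl a := cobSet_injective <| by
    refine (cobSet_cobMk _ _).trans ?_
    rw [cobSet_cobMk, (cobSet_mem a).2]

theorem cobSet_subset {a b : El X.cobCarrier} : cobSet a ⊆ cobSet b ↔ a ≤ b := Iff.rfl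

theorem cobSet_inf (a b : El X.cobCarrier) : cobSet (a ⊓ b) = cobSet a ∩ cobSet b :=
  cobSet_cobMk _ _

theorem cobSet_sup (a b : El X.cobCarrier) :
    cobSet (a ⊔ b) = orth X.perp (orth X.perp (cobSet a ∪ cobSet b)) :=
  cobSet_cobMk _ _

theorem cobSet_compl (a : El X.cobCarrier) : cobSet aᶜ = orth X.perp (cobSet a) :=
  cobSet_cobMk _ _

theorem cobSet_top : cobSet (⊤ : El X.cobCarrier) = Set.univ := cobSet_cobMk _ _

theorem cobSet_bot : cobSet (⊥ : El X.cobCarrier) = ∅ := cobSet_cobMk _ _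

/-- The quantifier `U ↦ R_i[U]` on `COB(X)`. The closure `R_i[U]^⊥⊥` need not be taken because
`R_i[U]` is in `COB(X)`. -/
noncomputable def cobEx (i : El I) (a : El X.cobCarrier) : El X.cobCarrier :=
  cobMk (relImage (X.R i) (cobSet a)) ((X.isCylindric.monadicUVO i).image_mem _ (cobSet_mem a))

theorem cobSet_cobEx (i : El I) (a : El X.cobCarrier) :
    cobSet (cobEx i a) = relImage (X.R i) (cobSet a) :=
  cobSet_cobMk _ _

theorem isQuantifier_cobEx (i : El I) : IsQuantifier (cobEx (X := X) i) where
  map_sup a b := cobSet_injective <| by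
    have biorth_image := (cobSet_mem (cobEx i (a ⊔ b))).2
    rw [cobSet_cobEx, cobSet_sup] at biorth_image
    rw [cobSet_cobEx, cobSet_sup, cobSet_sup, cobSet_cobEx, cobSet_cobEx,
      (X.isCylindric.monadic i).relImage_orth_orth_union biorth_image]
  map_bot := cobSet_injective <| by
    rw [cobSet_cobEx, cobSet_bot]
    exact Set.eq_empty_of_forall_notMem fun y ⟨_, hx, _⟩ => hx
  idem a := cobSet_injective <| by
    rw [cobSet_cobEx, cobSet_cobEx, (X.isCylindric.monadic i).image_image]
  le a := cobSet_subset.1 <| by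
    rw [cobSet_cobEx]
    exact (X.isCylindric.monadic i).subset_image _
  compl a := cobSet_injective <| by
    rw [cobSet_cobEx, cobSet_compl, cobSet_cobEx, (X.isCylindric.monadic i).image_orth_image]

noncomputable instance VCUVO.instCylindric : CylindricOrtholattice (El I) (El X.cobCarrier) where
  ex := cobEx
  diag i k := cobMk (X.Δ i k) (VCUVO.diag_mem i k)
  quantifier := isQuantifier_cobEx
  ex_comm i k a := cobSet_injective <| by
    simp only [cobSet_cobEx, relImage_comm (X.isCylindric.comm i k)]
  diag_symm i k := cobSet_injective <| by
    rw [cobSet_cobMk, cobSet_cobMk, X.isCylindric.diag_symm i k]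
  diag_self i := cobSet_injective <| by
    rw [cobSet_cobMk, cobSet_top, X.isCylindric.diag_self i]
  ex_diag i k l h h' := cobSet_injective <| by
    rw [cobSet_cobEx, cobSet_inf, cobSet_cobMk, cobSet_cobMk, cobSet_cobMk,
      X.isCylindric.image_diag i k l h h']

theorem cobSet_ex (i : El I) (a : El X.cobCarrier) :
    cobSet (ex i a) = relImage (X.R i) (cobSet a) :=
  cobSet_cobEx i a

theorem cobSet_diag (i k : El I) : cobSet (diag i k : El X.cobCarrier) = X.Δ i k :=
  cobSet_cobMk _ _

/-- The algebra of `X` in the model. -/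
noncomputable abbrev VCUVO.alg (X : VCUVO I) : VCOL I where
  carrier := X.cobCarrier
  isSet_inf := isSetRel₃_of_definablePred <|
    (inferInstance : DefinablePred fun p : El X.cobCarrier × El X.cobCarrier × El X.cobCarrier =>
      ∀ x : El X.carrier, (x ∈ cobSet p.1 ∧ x ∈ cobSet p.2.1) ↔ x ∈ cobSet p.2.2).congr
    fun p => by rw [← cobSet_inj, Set.ext_iff, cobSet_inf]; rfl
  isSet_sup := isSetRel₃_of_definablePred <|
    (inferInstance : DefinablePred fun p : El X.cobCarrier × El X.cobCarrier × El X.cobCarrier =>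
      ∀ x : El X.carrier, (∀ y : El X.carrier, (∀ z : El X.carrier,
        z ∈ cobSet p.1 ∨ z ∈ cobSet p.2.1 → X.perp y z) → X.perp x y) ↔ x ∈ cobSet p.2.2).congr
    fun p => by rw [← cobSet_inj, Set.ext_iff, cobSet_sup]; rfl
  isSet_compl := isSetRel₂_of_definablePred <|
    (inferInstance : DefinablePred fun p : El X.cobCarrier × El X.cobCarrier =>
      ∀ x : El X.carrier,
        (∀ y : El X.carrier, y ∈ cobSet p.1 → X.perp x y) ↔ x ∈ cobSet p.2).congr
    fun p => by rw [← cobSet_inj, Set.ext_iff, cobSet_compl]; rfl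
  isSet_ex := isSetRel₃_of_definablePred <|
    (inferInstance : DefinablePred fun p : El I × El X.cobCarrier × El X.cobCarrier =>
      ∀ y : El X.carrier, (∃ x : El X.carrier, x ∈ cobSet p.2.1 ∧ X.R p.1 x y) ↔
        y ∈ cobSet p.2.2).congr
    fun p => by rw [← cobSet_inj, Set.ext_iff, cobSet_ex]; rfl
  isSet_diag := isSetRel₃_of_definablePred <|
    (inferInstance : DefinablePred fun p : El I × El I × El X.cobCarrier =>
      ∀ x : El X.carrier, x ∈ X.Δ p.1 p.2.1 ↔ x ∈ cobSet p.2.2).congr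
    fun p => by rw [← cobSet_inj, Set.ext_iff, cobSet_diag]

theorem VCUVO.vIsCOBAlgebra_alg (X : VCUVO I) : VIsCOBAlgebra X X.alg where
  carrier := X.mem_cobCarrier
  inf := cobSet_inf (X := X)
  sup := cobSet_sup (X := X)
  compl := cobSet_compl (X := X)
  bot := cobSet_bot (X := X)
  top := cobSet_top (X := X)
  ex i a := (cobSet_ex (X := X) i a).trans
    ((X.isCylindric.monadicUVO i).image_mem _ (cobSet_mem a)).2.symm
  diag := cobSet_diag (X := X)

end ModelAlgebra

/-! ## Filters along homomorphisms -/

section HomFilter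

variable {A : Type v} {B : Type w} [Ortholattice A] [Ortholattice B]

/-- The preimage of a proper filter under a homomorphism. -/
def ProperFilter.comap (h : BoundedLatticeHom A B) (F : ProperFilter B) : ProperFilter A where
  val := h ⁻¹' F.1
  property :=
    { nonempty := ⟨⊤, by simpa only [Set.mem_preimage, map_top] using F.2.top_mem⟩
      upward := fun _ _ ha hab => F.2.upward _ _ ha (OrderHomClass.mono h hab)
      inf_mem := fun a b ha hb => by
        simpa only [Set.mem_preimage, map_inf] using F.2.inf_mem _ _ ha hb
      proper := fun hu => F.2.bot_notMem <| by
        simpa only [Set.mem_preimage, map_bot] using hu.ge (Set.mem_univ ⊥) }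

/-- The filter generated by the image of a proper filter under a homomorphism. -/
def ProperFilter.map (h : BoundedLatticeHom A B) (F : ProperFilter A)
    (ne_bot : ∀ a ∈ F.1, h a ≠ ⊥) : ProperFilter B where
  val := {b | ∃ a ∈ F.1, h a ≤ b}
  property :=
    { nonempty := ⟨⊤, ⊤, F.2.top_mem, le_top⟩
      upward := fun _ _ ⟨a, ha, hab⟩ hbc => ⟨a, ha, hab.trans hbc⟩
      inf_mem := fun _ _ ⟨a, ha, hab⟩ ⟨a', ha', hac⟩ =>
        ⟨a ⊓ a', F.2.inf_mem _ _ ha ha', (map_inf h a a').trans_le (inf_le_inf hab hac)⟩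
      proper := fun hu =>
        let ⟨a, ha, hab⟩ := hu.ge (Set.mem_univ ⊥)
        ne_bot a ha (le_bot_iff.1 hab) }

variable {h : BoundedLatticeHom A B} (map_compl : ∀ a, h aᶜ = (h a)ᶜ) {F : ProperFilter A}
  {G : ProperFilter B}

include map_compl

theorem specPerp_map_iff (ne_bot : ∀ a ∈ F.1, h a ≠ ⊥) :
    specPerp B (F.map h ne_bot) G ↔ specPerp A F (G.comap h) := by
  constructor
  · rintro ⟨b, ⟨a, ha, hab⟩, hb⟩
    refine ⟨a, ha, ?_⟩
    change h aᶜ ∈ G.1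
    exact map_compl a ▸ G.2.upward _ _ hb (Ortholattice.compl_anti _ _ hab)
  · rintro ⟨a, ha, ha'⟩
    exact ⟨h a, ⟨a, ha, le_rfl⟩, map_compl a ▸ ha'⟩

theorem map_ne_bot_of_not_specPerp_comap (hFG : ¬ specPerp A F (G.comap h)) :
    ∀ a ∈ F.1, h a ≠ ⊥ := by
  refine fun a ha hbot => hFG ⟨a, ha, ?_⟩
  change h aᶜ ∈ G.1
  rw [map_compl, hbot, Ortholattice.compl_bot]
  exact G.2.top_mem

end HomFilter

/-! ## The dual equivalence in a model -/

section ModelDuality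

variable {V : Type w} [setLang.Structure V] {I : V}

theorem VIsCUVOMap.preimage_orth {X Y : VCUVO I} {f : El X.carrier → El Y.carrier}
    (hf : VIsCUVOMap X Y f) {U : Set (El Y.carrier)} (hU : VIsOpen Y.carrier Y.top U) :
    f ⁻¹' orth Y.perp U = orth X.perp (f ⁻¹' U) :=
  _root_.preimage_orth (le := fun z w => ∀ W, VIsOpen Y.carrier Y.top W → z ∈ W → w ∈ W)
    X.isCylindric.toIsOrthoframe Y.isCylindric.toIsOrthoframe hf.nonperp hf.lift
    (fun _ _ h => h U hU)

variable [IsZFModel V]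

instance VCOL.definableFun_hom {T : Type*} [DefinableType V T] {A B : VCOL I} (h : A ⟶ B)
    {f : T → El A.carrier} [DefinableFun f] : DefinableFun fun t => h.1.toFun (f t) :=
  DefinableFun.app h.2

instance VCUVO.definableFun_hom {T : Type*} [DefinableType V T] {X Y : VCUVO I} (f : X ⟶ Y)
    {g : T → El X.carrier} [DefinableFun g] : DefinableFun fun t => f.1 (g t) :=
  DefinableFun.app f.2.isSet

section SpecMap

variable {A B : VCOL I}

theorem exists_specPt_eq_comap (h : A ⟶ B) (x : El B.specCarrier) :
    ∃ y : El A.specCarrier, specPt y = (specPt x).comap h.1.toBoundedLatticeHom :=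
  have : DefinableFun h.1.toFun := VCOL.definableFun_hom h (f := fun a => a)
  have : DefinablePred fun a => a ∈ ((specPt x).comap h.1.toBoundedLatticeHom).1 :=
    (inferInstance : DefinablePred fun a : El A.carrier => h.1.toFun a ∈ (specPt x).1)
  exists_specPt_eq _

/-- The map of spectra that takes preimages under `h`. -/
noncomputable def specMap (h : A ⟶ B) (x : El B.specCarrier) : El A.specCarrier :=
  (exists_specPt_eq_comap h x).choose

theorem specPt_specMap (h : A ⟶ B) (x : El B.specCarrier) :
    specPt (specMap h x) = (specPt x).comap h.1.toBoundedLatticeHom :=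
  (exists_specPt_eq_comap h x).choose_spec

theorem specMap_preimage_vphi (h : A ⟶ B) (a : El A.carrier) :
    specMap h ⁻¹' vphi a = vphi (h.1.toFun a) :=
  Set.ext fun x => Set.ext_iff.1 (congrArg Subtype.val (specPt_specMap h x)) a

theorem isSetFun_specMap (h : A ⟶ B) : IsSetFun (specMap h) := by
  refine isSetRel₂_of_definablePred <| (inferInstance : DefinablePred fun p : El B.specCarrier ×
    El A.specCarrier => ∀ a : El A.carrier,
      h.1.toFun a ∈ (specPt p.1).1 ↔ a ∈ (specPt p.2).1).congr fun p => ?_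
  rw [← specPt_injective.eq_iff, specPt_specMap]
  exact Subtype.ext_iff.trans Set.ext_iff

theorem specMap_preimage_mem_VCO (h : A ⟶ B) {U : Set (El A.specCarrier)}
    (hU : U ∈ VCO A.specCarrier A.specTop) : specMap h ⁻¹' U ∈ VCO B.specCarrier B.specTop := by
  refine preimage_mem_VCO vIsTopology_spec (isSetFun_specMap h) (B := Set.range vphi)
    (Set.forall_mem_range.2 vIsOpen_vphi) (fun U hU x hx => ?_) ?_ hU
  · obtain ⟨a, ha, haU⟩ := exists_vphi_subset hU hx
    exact ⟨_, ⟨a, rfl⟩, ha, haU⟩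
  · rintro _ ⟨a, rfl⟩
    rw [specMap_preimage_vphi]
    exact vphi_mem_VCO _

theorem vperp_specMap_iff (h : A ⟶ B) (z : El A.specCarrier) (y : El B.specCarrier) :
    vperp z (specMap h y) ↔
      specPerp (El A.carrier) (specPt z) ((specPt y).comap h.1.toBoundedLatticeHom) := by
  rw [vperp, InvImage, specPt_specMap]

/-- The point is the filter generated by the image of `z`. -/
theorem specMap_lift (h : A ⟶ B) (z : El A.specCarrier) (y : El B.specCarrier)
    (hzy : ¬ vperp z (specMap h y)) : ∃ x : El B.specCarrier, ¬ vperp x y ∧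
      ∀ U, VIsOpen A.specCarrier A.specTop U → z ∈ U → specMap h x ∈ U := by
  rw [vperp_specMap_iff] at hzy
  let F := (specPt z).map _ (map_ne_bot_of_not_specPerp_comap h.1.map_compl' hzy)
  have : DefinablePred fun b => b ∈ F.1 := (inferInstance : DefinablePred
    fun b : El B.carrier => ∃ a : El A.carrier, a ∈ (specPt z).1 ∧ h.1.toFun a ≤ b)
  obtain ⟨x, hx⟩ := exists_specPt_eq F
  refine ⟨x, ?_, fun U hU hzU => ?_⟩
  · rwa [vperp, InvImage, hx, specPerp_map_iff h.1.map_compl']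
  · obtain ⟨a, ha, haU⟩ := exists_vphi_subset hU hzU
    refine haU ?_
    rw [← Set.mem_preimage, specMap_preimage_vphi]
    exact (congrArg Subtype.val hx).ge ⟨a, ha, le_rfl⟩

theorem vIsCUVOMap_specMap (h : A ⟶ B) : VIsCUVOMap B.spec A.spec (specMap h) where
  isSet := isSetFun_specMap h
  spectral _ := specMap_preimage_mem_VCO h
  nonperp x y hxy := by
    change ¬ vperp (specMap h x) (specMap h y)
    rw [vperp_specMap_iff, specPt_specMap]
    rintro ⟨a, ha, ha'⟩
    exact hxy ⟨h.1.toFun a, ha, (h.1.map_compl' a).symm ▸ ha'⟩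
  lift := specMap_lift h
  image i U hU := by
    obtain ⟨a, rfl⟩ := VCOB_spec.le hU
    calc relImage (vrel i) (specMap h ⁻¹' vphi a) = vphi (ex i (h.1.toFun a)) := by
          rw [specMap_preimage_vphi, relImage_vphi]
      _ = specMap h ⁻¹' relImage (vrel i) (vphi a) := by
          rw [relImage_vphi, specMap_preimage_vphi, h.1.map_ex']
  diag i k := (specMap_preimage_vphi h _).trans (congrArg vphi (h.1.map_diag' i k))

end SpecMap

/-- The contravariant functor `S_F` in the model. -/
noncomputable def vSpec (I : V) : (VCOL I)ᵒᵖ ⥤ VCUVO I where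
  obj A := A.unop.spec
  map h := ⟨specMap h.unop, vIsCUVOMap_specMap h.unop⟩
  map_id A := Subtype.ext <| funext fun x => specPt_injective (specPt_specMap (𝟙 A.unop) x)
  map_comp h g := Subtype.ext <| funext fun x => specPt_injective <| by
    refine (specPt_specMap (g.unop ≫ h.unop) x).trans ?_
    refine Eq.trans ?_ (specPt_specMap g.unop (specMap h.unop x)).symm
    rw [specPt_specMap]
    rfl

section AlgMap

variable {X Y : VCUVO I}

/-- The map of algebras that takes preimages under `f`. -/
noncomputable def algMapFun (f : X ⟶ Y) (a : El Y.cobCarrier) : El X.cobCarrier :=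
  cobMk (f.1 ⁻¹' cobSet a) (f.2.preimage_mem (cobSet_mem a))

theorem cobSet_algMapFun (f : X ⟶ Y) (a : El Y.cobCarrier) :
    cobSet (algMapFun f a) = f.1 ⁻¹' cobSet a :=
  cobSet_cobMk _ _

theorem algMapFun_sup (f : X ⟶ Y) (a b : El Y.cobCarrier) :
    algMapFun f (a ⊔ b) = algMapFun f a ⊔ algMapFun f b := cobSet_injective <| by
  have isOpen_orth : VIsOpen Y.carrier Y.top (orth Y.perp (cobSet a ∪ cobSet b)) := by
    rw [orth_union]
    exact Y.isCylindric.isTopology.inter _ _ (Y.isCylindric.orth_mem _ (cobSet_mem a)).1.2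
      (Y.isCylindric.orth_mem _ (cobSet_mem b)).1.2
  have isOpen_union : VIsOpen Y.carrier Y.top (cobSet a ∪ cobSet b) :=
    VIsOpen.union Y.isCylindric.isTopology (cobSet_mem a).1.2 (cobSet_mem b).1.2
  rw [cobSet_algMapFun, cobSet_sup, cobSet_sup, cobSet_algMapFun, cobSet_algMapFun,
    f.2.preimage_orth isOpen_orth, f.2.preimage_orth isOpen_union, Set.preimage_union]

theorem algMapFun_inf (f : X ⟶ Y) (a b : El Y.cobCarrier) :
    algMapFun f (a ⊓ b) = algMapFun f a ⊓ algMapFun f b := cobSet_injective <| by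
  rw [cobSet_algMapFun, cobSet_inf, cobSet_inf, cobSet_algMapFun, cobSet_algMapFun,
    Set.preimage_inter]

theorem algMapFun_compl (f : X ⟶ Y) (a : El Y.cobCarrier) :
    algMapFun f aᶜ = (algMapFun f a)ᶜ := cobSet_injective <| by
  rw [cobSet_algMapFun, cobSet_compl, cobSet_compl, cobSet_algMapFun,
    f.2.preimage_orth (cobSet_mem a).1.2]

theorem algMapFun_ex (f : X ⟶ Y) (i : El I) (a : El Y.cobCarrier) :
    algMapFun f (ex i a) = ex i (algMapFun f a) := cobSet_injective <| by
  rw [cobSet_algMapFun, cobSet_ex, cobSet_ex, cobSet_algMapFun, f.2.image i _ (cobSet_mem a)]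

/-- `algMapFun` as a homomorphism. -/
noncomputable def algMap (f : X ⟶ Y) : CylHom (El I) (El Y.cobCarrier) (El X.cobCarrier) where
  toFun := algMapFun f
  map_sup' := algMapFun_sup f
  map_inf' := algMapFun_inf f
  map_top' := cobSet_injective <| by
    rw [cobSet_algMapFun, cobSet_top, cobSet_top, Set.preimage_univ]
  map_bot' := cobSet_injective <| by
    rw [cobSet_algMapFun, cobSet_bot, cobSet_bot, Set.preimage_empty]
  map_compl' := algMapFun_compl f
  map_ex' := algMapFun_ex f
  map_diag' i k := cobSet_injective <| by
    rw [cobSet_algMapFun, cobSet_diag, cobSet_diag, f.2.diag]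

theorem isSetFun_algMap (f : X ⟶ Y) : IsSetFun (algMap f) := by
  refine isSetRel₂_of_definablePred <| (inferInstance : DefinablePred fun p : El Y.cobCarrier ×
    El X.cobCarrier => ∀ x : El X.carrier, f.1 x ∈ cobSet p.1 ↔ x ∈ cobSet p.2).congr fun p => ?_
  change algMapFun f p.1 = p.2 ↔ _
  rw [← cobSet_inj, cobSet_algMapFun, Set.ext_iff]
  rfl

end AlgMap

/-- The contravariant functor `A_F` in the model. -/
noncomputable def vAlg (I : V) : (VCUVO I)ᵒᵖ ⥤ VCOL I where
  obj X := X.unop.alg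
  map f := ⟨algMap f.unop, isSetFun_algMap f.unop⟩
  map_id X := Subtype.ext <| CylHom.ext_toFun fun a =>
    cobSet_injective (cobSet_algMapFun (𝟙 X.unop) a)
  map_comp f g := Subtype.ext <| CylHom.ext_toFun fun a => cobSet_injective <| by
    refine (cobSet_algMapFun (g.unop ≫ f.unop) a).trans ?_
    refine Eq.trans ?_ (cobSet_algMapFun g.unop (algMapFun f.unop a)).symm
    rw [cobSet_algMapFun]
    rfl

section Phi

variable (A : VCOL I)

/-- The homomorphism `φ` in the model. -/
noncomputable def vphiHom : CylHom (El I) (El A.carrier) (El A.spec.cobCarrier) where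
  toFun a := cobMk (X := A.spec) (vphi a) (vphi_mem_VCOB a)
  map_sup' a b := cobSet_injective <| by
    rw [cobSet_sup, cobSet_cobMk, cobSet_cobMk, cobSet_cobMk]
    exact (hasPrincipalFilters_specPt.orth_orth_preimage_phi_union a b).symm
  map_inf' a b := cobSet_injective <| by
    rw [cobSet_inf, cobSet_cobMk, cobSet_cobMk, cobSet_cobMk, vphi_inf]
  map_top' := cobSet_injective <| by rw [cobSet_top, cobSet_cobMk, vphi_top]
  map_bot' := cobSet_injective <| by rw [cobSet_bot, cobSet_cobMk, vphi_bot]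
  map_compl' a := cobSet_injective <| by
    rw [cobSet_compl, cobSet_cobMk, cobSet_cobMk, orth_vphi]
  map_ex' i a := cobSet_injective <| by
    rw [cobSet_ex, cobSet_cobMk, cobSet_cobMk, relImage_vphi]
  map_diag' i k := cobSet_injective <| by rw [cobSet_diag, cobSet_cobMk]

theorem cobSet_vphiHom (a : El A.carrier) : cobSet ((vphiHom A).toFun a) = vphi a :=
  cobSet_cobMk _ (vphi_mem_VCOB a)

theorem vphiHom_bijective : Function.Bijective (vphiHom A).toFun := by
  constructor
  · intro a b h
    rw [← cobSet_inj, cobSet_vphiHom, cobSet_vphiHom] at h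
    exact vphi_injective h
  · intro b
    obtain ⟨a, ha⟩ := VCOB_spec.le (cobSet_mem b)
    exact ⟨a, cobSet_injective ((cobSet_vphiHom A a).trans ha)⟩

/-- `φ` as a bijection. -/
noncomputable def vphiEquiv : El A.carrier ≃ El A.spec.cobCarrier :=
  Equiv.ofBijective _ (vphiHom_bijective A)

theorem isSetFun_vphiEquiv : IsSetFun (vphiEquiv A) := by
  refine isSetRel₂_of_definablePred <| (inferInstance : DefinablePred fun p : El A.carrier ×
    El A.spec.cobCarrier => ∀ x : El A.spec.carrier, x ∈ vphi p.1 ↔ x ∈ cobSet p.2).congr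
      fun p => ?_
  change (vphiHom A).toFun p.1 = p.2 ↔ _
  rw [← cobSet_inj, cobSet_vphiHom, Set.ext_iff]

/-- `φ` as an isomorphism of cylindric ortholattices of the model. -/
noncomputable def vphiIso : A ≅ A.spec.alg where
  hom := ⟨vphiHom A, isSetFun_vphiEquiv A⟩
  inv := ⟨(vphiHom A).symm (vphiEquiv A) fun _ => rfl, (isSetFun_vphiEquiv A).symm⟩
  hom_inv_id := Subtype.ext <| CylHom.ext_toFun (vphiEquiv A).symm_apply_apply
  inv_hom_id := Subtype.ext <| CylHom.ext_toFun (vphiEquiv A).apply_symm_apply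

end Phi

/-- `φ` as a natural isomorphism in the model. -/
noncomputable def vphiNatIso (I : V) : 𝟭 (VCOL I) ≅ (vSpec I).rightOp ⋙ vAlg I :=
  NatIso.ofComponents vphiIso fun {A B} h => Subtype.ext <| CylHom.ext_toFun fun a =>
    cobSet_injective <| by
      refine (cobSet_vphiHom B _).trans ?_
      refine Eq.trans ?_ (cobSet_algMapFun (X := B.spec) (Y := A.spec)
        ⟨specMap h, vIsCUVOMap_specMap h⟩ ((vphiHom A).toFun a)).symm
      rw [cobSet_vphiHom]
      exact (specMap_preimage_vphi h a).symm

theorem vIsCUVOMap_of_equiv {X Y : VCUVO I} (e : El X.carrier ≃ El Y.carrier) (he : IsSetFun e)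
    (hB : ∀ U ∈ Y.cob, e ⁻¹' U ∈ VCO X.carrier X.top)
    (hp : ∀ x y, X.perp x y ↔ Y.perp (e x) (e y))
    (hR : ∀ i x y, X.R i x y ↔ Y.R i (e x) (e y)) (hΔ : ∀ i k, e ⁻¹' Y.Δ i k = X.Δ i k) :
    VIsCUVOMap X Y e where
  isSet := he
  spectral _ hU := preimage_mem_VCO X.isCylindric.isTopology he (fun _ hW => hW.1.2)
    Y.isCylindric.basis hB hU
  nonperp x y := (not_congr (hp x y)).1
  lift z y h := ⟨e.symm z, by rwa [hp, e.apply_symm_apply], by simp⟩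
  image i U _ := relImage_preimage_equiv e (hR i) U
  diag := hΔ

section Psi

variable (X : VCUVO I)

theorem isProperFilter_setOf_mem_cobSet (x : El X.carrier) :
    IsProperFilter {a : El X.cobCarrier | x ∈ cobSet a} where
  nonempty := ⟨⊤, cobSet_top.ge trivial⟩
  upward _ _ ha h := h ha
  inf_mem a b ha hb := (cobSet_inf a b).ge ⟨ha, hb⟩
  proper h := cobSet_bot.le (h.ge (Set.mem_univ ⊥))

theorem exists_specPt_eq_setOf_mem_cobSet (x : El X.carrier) :
    ∃ y : El X.alg.specCarrier, specPt y = ⟨_, isProperFilter_setOf_mem_cobSet X x⟩ :=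
  have : DefinablePred fun a => a ∈ {a : El X.cobCarrier | x ∈ cobSet a} :=
    (inferInstance : DefinablePred fun a : El X.cobCarrier => x ∈ cobSet a)
  exists_specPt_eq (A := X.alg) _

/-- `ψ x`, the filter of those elements of `COB(X)` that contain `x`. -/
noncomputable def vpsi (x : El X.carrier) : El X.alg.specCarrier :=
  (exists_specPt_eq_setOf_mem_cobSet X x).choose

theorem specPt_vpsi (x : El X.carrier) :
    specPt (vpsi X x) = ⟨_, isProperFilter_setOf_mem_cobSet X x⟩ :=
  (exists_specPt_eq_setOf_mem_cobSet X x).choose_spec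

theorem mem_specPt_vpsi {x : El X.carrier} {a : El X.cobCarrier} :
    a ∈ (specPt (A := X.alg) (vpsi X x)).1 ↔ x ∈ cobSet a :=
  Set.ext_iff.1 (congrArg Subtype.val (specPt_vpsi X x)) a

theorem vpsi_injective : Function.Injective (vpsi X) := by
  intro x y h
  have mem_iff_mem : ∀ W ∈ X.cob, x ∈ W ↔ y ∈ W := fun W hW => by
    obtain ⟨a, rfl⟩ := exists_cobSet_eq hW
    rw [← mem_specPt_vpsi, h, mem_specPt_vpsi]
  by_contra hxy
  obtain ⟨U, hU, hn⟩ := X.isCylindric.t0 x y hxy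
  refine hn ⟨fun hx => ?_, fun hy => ?_⟩
  · obtain ⟨W, hW, hxW, hWU⟩ := X.isCylindric.basis U hU x hx
    exact hWU ((mem_iff_mem W hW).1 hxW)
  · obtain ⟨W, hW, hyW, hWU⟩ := X.isCylindric.basis U hU y hy
    exact hWU ((mem_iff_mem W hW).2 hyW)

theorem image_cobSet_specPt (y : El X.alg.specCarrier) :
    cobSet '' (specPt y).1 = traceFamily X.carrier y.1 := by
  ext U
  constructor
  · rintro ⟨a, ha, rfl⟩
    exact ⟨a.1, ha, rfl⟩
  · rintro ⟨u, hu, rfl⟩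
    exact ⟨⟨u, ((X.alg.mem_specCarrier y.1).1 y.2).1 u hu⟩, hu, rfl⟩

theorem vpsi_surjective : Function.Surjective (vpsi X) := by
  intro y
  have hF : IsProperFilterIn X.cob (cobSet '' (specPt y).1) :=
    (specPt y).2.isProperFilterIn_image range_cobSet (fun _ _ h => h) cobSet_inf
  obtain ⟨x, hx⟩ := X.isCylindric.filter y.1 (image_cobSet_specPt X y ▸ hF)
  refine ⟨x, specPt_injective <| Subtype.ext <| Set.ext fun a => ?_⟩
  calc a ∈ (specPt (vpsi X x)).1 ↔ x ∈ cobSet a := mem_specPt_vpsi X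
    _ ↔ cobSet a ∈ {W | W ∈ X.cob ∧ x ∈ W} := (and_iff_right (cobSet_mem a)).symm
    _ ↔ cobSet a ∈ cobSet '' (specPt y).1 := by rw [image_cobSet_specPt, hx]
    _ ↔ a ∈ (specPt y).1 := cobSet_injective.mem_set_image

/-- `ψ` as a bijection. -/
noncomputable def vpsiEquiv : El X.carrier ≃ El X.alg.spec.carrier :=
  Equiv.ofBijective _ ⟨vpsi_injective X, vpsi_surjective X⟩

theorem vpsiEquiv_preimage_vphi (a : El X.cobCarrier) :
    vpsiEquiv X ⁻¹' vphi (A := X.alg) a = cobSet a :=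
  Set.ext fun _ => mem_specPt_vpsi X

theorem isSetFun_vpsiEquiv : IsSetFun (vpsiEquiv X) := by
  refine isSetRel₂_of_definablePred <| (inferInstance : DefinablePred fun p : El X.carrier ×
    El X.alg.specCarrier => ∀ a : El X.cobCarrier, p.1 ∈ cobSet a ↔
      a ∈ (specPt (A := X.alg) p.2).1).congr fun p => ?_
  change vpsi X p.1 = p.2 ↔ _
  rw [← specPt_injective.eq_iff, specPt_vpsi]
  exact Subtype.ext_iff.trans Set.ext_iff

theorem vpsi_perp (x y : El X.carrier) :
    X.perp x y ↔ X.alg.spec.perp (vpsiEquiv X x) (vpsiEquiv X y) := by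
  calc X.perp x y ↔ ∃ U ∈ X.cob, x ∈ U ∧ y ∈ orth X.perp U :=
        perp_iff_exists_mem_orth X.isCylindric.toIsOrthoframe (X.isCylindric.perp_sep x y)
    _ ↔ ∃ a : El X.cobCarrier, x ∈ cobSet a ∧ y ∈ cobSet aᶜ := by
        rw [← range_cobSet]
        simp only [Set.exists_range_iff, cobSet_compl]
    _ ↔ ∃ a : El X.cobCarrier, a ∈ (specPt (A := X.alg) (vpsi X x)).1 ∧
          aᶜ ∈ (specPt (A := X.alg) (vpsi X y)).1 :=
        exists_congr fun a => and_congr (mem_specPt_vpsi X).symm (mem_specPt_vpsi X).symm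

theorem vpsi_R (i : El I) (x y : El X.carrier) :
    X.R i x y ↔ X.alg.spec.R i (vpsiEquiv X x) (vpsiEquiv X y) := by
  calc X.R i x y ↔ ∀ W ∈ X.cob, x ∈ W → y ∈ orth X.perp (orth X.perp (relImage (X.R i) W)) :=
        rel_iff_forall_mem_closure_relImage X.isCylindric.toIsOrthoframe
          ((X.isCylindric.monadicUVO i).rel_sep x y)
    _ ↔ ∀ a : El X.cobCarrier, x ∈ cobSet a → y ∈ cobSet (ex i a) := by
        rw [← range_cobSet, Set.forall_mem_range]
        exact forall_congr' fun a => by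
          rw [cobSet_ex, ((X.isCylindric.monadicUVO i).image_mem _ (cobSet_mem a)).2]
    _ ↔ ∀ a ∈ (specPt (A := X.alg) (vpsi X x)).1, ex i a ∈ (specPt (A := X.alg) (vpsi X y)).1 :=
        forall_congr' fun a => imp_congr (mem_specPt_vpsi X).symm (mem_specPt_vpsi X).symm
    _ ↔ X.alg.spec.R i (vpsiEquiv X x) (vpsiEquiv X y) := vrel_iff.symm

theorem vpsi_diag (i k : El I) : vpsiEquiv X ⁻¹' X.alg.spec.Δ i k = X.Δ i k :=
  (vpsiEquiv_preimage_vphi X _).trans (cobSet_diag i k)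

theorem vIsCUVOMap_vpsi : VIsCUVOMap X X.alg.spec (vpsiEquiv X) := by
  refine vIsCUVOMap_of_equiv _ (isSetFun_vpsiEquiv X) (fun U hU => ?_) (vpsi_perp X) (vpsi_R X)
    (vpsi_diag X)
  obtain ⟨a, rfl⟩ := VCOB_spec.le hU
  rw [vpsiEquiv_preimage_vphi]
  exact (cobSet_mem a).1

theorem vIsCUVOMap_vpsi_symm : VIsCUVOMap X.alg.spec X (vpsiEquiv X).symm := by
  refine vIsCUVOMap_of_equiv _ (isSetFun_vpsiEquiv X).symm (fun U hU => ?_)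
    (fun x y => ?_) (fun i x y => ?_) fun i k => ?_
  · obtain ⟨a, rfl⟩ := exists_cobSet_eq hU
    rw [← vpsiEquiv_preimage_vphi, Equiv.symm_preimage_preimage]
    exact vphi_mem_VCO _
  · rw [vpsi_perp X, Equiv.apply_symm_apply, Equiv.apply_symm_apply]
  · rw [vpsi_R X, Equiv.apply_symm_apply, Equiv.apply_symm_apply]
  · rw [← vpsi_diag, Equiv.symm_preimage_preimage]

/-- `ψ` as an isomorphism of cylindric UVO-spaces of the model. -/
noncomputable def vpsiIso : X ≅ X.alg.spec where
  hom := ⟨vpsiEquiv X, vIsCUVOMap_vpsi X⟩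
  inv := ⟨(vpsiEquiv X).symm, vIsCUVOMap_vpsi_symm X⟩
  hom_inv_id := Subtype.ext (Equiv.symm_comp_self _)
  inv_hom_id := Subtype.ext (Equiv.self_comp_symm _)

end Psi

/-- `ψ` as a natural isomorphism in the model. -/
noncomputable def vpsiNatIso (I : V) : 𝟭 (VCUVO I) ≅ (vAlg I).rightOp ⋙ vSpec I :=
  NatIso.ofComponents vpsiIso fun {X Y} f => Subtype.ext <| funext fun x =>
    specPt_injective <| Subtype.ext <| Set.ext fun a =>
      calc a ∈ (specPt (A := Y.alg) (vpsi Y (f.1 x))).1 ↔ f.1 x ∈ cobSet a := mem_specPt_vpsi Y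
        _ ↔ x ∈ cobSet (algMapFun f a) := (Set.ext_iff.1 (cobSet_algMapFun f a) x).symm
        _ ↔ algMapFun f a ∈ (specPt (A := X.alg) (vpsi X x)).1 := (mem_specPt_vpsi X).symm
        _ ↔ a ∈ (specPt (specMap ((vAlg I).map f.op) (vpsi X x))).1 :=
          (Set.ext_iff.1 (congrArg Subtype.val (specPt_specMap ((vAlg I).map f.op) _)) a).symm

end ModelDuality

theorem mainTheorem1 :
    -- The functors `S_F` and `A_F` form a dual equivalence, by the natural isomorphisms `φ`, `ψ`.
    (∀ I : Type u,
      IsDualEquivalence (S_F.{u, v} I) (A_F.{u, v} I) ∧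
      (∃ η : 𝟭 (COL.{u, v} I) ≅ (S_F I).rightOp ⋙ A_F I,
        ∀ (A : COL.{u, v} I) (a : A.carrier),
          ((η.hom.app A).toFun a).1 = phi a) ∧
      ∃ θ : 𝟭 (CUVO.{u, v} I) ≅ (A_F I).rightOp ⋙ S_F I,
        ∀ (X : CUVO.{u, v} I) (x : X.carrier),
          ((θ.hom.app X).1 x).1 = {U : {U // U ∈ COB X.perp} | x ∈ U.1}) ∧
    -- The duality is choice-free: the same holds inside every model of ZF.
    (∀ (V : Type w) [setLang.Structure V] [IsZFModel V] (I : V),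
      ∃ (S : (VCOL I)ᵒᵖ ⥤ VCUVO I) (A : (VCUVO I)ᵒᵖ ⥤ VCOL I),
        (∀ B : VCOL I, VIsSpectrum B (S.obj (.op B))) ∧
        (∀ (B C : VCOL I) (h : B ⟶ C) (x : El (S.obj (.op C)).carrier),
          trace B.carrier ((S.map h.op).1 x).1 = {b | h.1 b ∈ trace C.carrier x.1}) ∧
        (∀ X : VCUVO I, VIsCOBAlgebra X (A.obj (.op X))) ∧
        (∀ (X Y : VCUVO I) (f : X ⟶ Y) (U : El (A.obj (.op Y)).carrier),
          trace X.carrier ((A.map f.op).1 U).1 = f.1 ⁻¹' trace Y.carrier U.1) ∧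
        IsDualEquivalence S A ∧
        (∃ η : 𝟭 (VCOL I) ≅ S.rightOp ⋙ A, ∀ (B : VCOL I) (b : El B.carrier),
          trace (S.obj (.op B)).carrier ((η.hom.app B).1 b).1 =
            {x | b ∈ trace B.carrier x.1}) ∧
        ∃ θ : 𝟭 (VCUVO I) ≅ A.rightOp ⋙ S, ∀ (X : VCUVO I) (x : El X.carrier),
          trace (A.obj (.op X)).carrier ((θ.hom.app X).1 x).1 =
            {U | x ∈ trace X.carrier U.1}) := by
  refine ⟨fun I => ⟨isDualEquivalence_of_natIso (phiNatIso I) (psiNatIso I),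
    ⟨phiNatIso I, fun _ _ => rfl⟩, ⟨psiNatIso I, fun _ _ => rfl⟩⟩, fun V _ _ I => ?_⟩
  exact ⟨vSpec I, vAlg I, VCOL.vIsSpectrum_spec,
    fun _ _ h x => congrArg Subtype.val (specPt_specMap h x), VCUVO.vIsCOBAlgebra_alg,
    fun _ _ f U => cobSet_algMapFun f U,
    isDualEquivalence_of_natIso (vphiNatIso I) (vpsiNatIso I),
    ⟨vphiNatIso I, cobSet_vphiHom⟩,
    ⟨vpsiNatIso I, fun X x => congrArg Subtype.val (specPt_vpsi X x)⟩⟩
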